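/- **Variational Christ–Kiselev theorem.** Let $G$ be a connected finite-dimensional (real) Lie group with identity $I$ and Lie algebra $\mathfrak g$, let $\|\cdot\|_{\mathfrak g}$ be a norm on $\mathfrak g$, and let $w,v\in\mathfrak g$. Let $1\le p<2$, $1/p+1/p'=1$ and $p<r<\infty$. For $f\in L^p(\mathbb R;\mathbb C)$ and each $k\in\mathbb R$, there is a unique locally absolutely continuous curve $x\mapsto \mathcal{NC}[f](k,x)\in G$ on $\mathbb R$ with $$\mathcal{NC}[f](k,0)=I,\qquad \tfrac{\partial}{\partial x}\mathcal{NC}[f](k,x)=\mathcal{NC}[f](k,x)\big(\operatorname{Re}(e^{-2\pi i kx}f(x))\,w+\operatorname{Im}(e^{-2\pi i kx}f(x))\,v\big)\quad\text{for a.e. }x .$$ Let $d$ be the left-invariant metric on $G$, that is, $d(g,g')$ is the infimum of $\int_a^b\|\gamma(t)^{-1}\gamma'(t)\|_{\mathfrak g}\,dt$ over all $C^1$ paths $\gamma:[a,b]\to G$ from $g$ to $g'$. For a curve $\gamma:\mathbb R\to G$ and $S\subseteq\mathbb R$ let $$\|\gamma|_S\|_{V^r}=\sup\Big(\sum_{j=0}^{n-1}d(\gamma(t_{j+1}),\gamma(t_j))^r\Big)^{1/r},$$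 the supremum being over all $n$ and all $t_0\le t_1\le\dots\le t_n$ in $S$ (it is $0$ if $S=\emptyset$). Let the size $|\mathcal{NC}[f]|$ at $(k,x)$ be either one of the two quantities $d(I,\mathcal{NC}[f](k,x))$ and $\|\mathcal{NC}[f](k,\cdot)\|_{V^r}$ (the latter, over all of $\mathbb R$, does not depend on $x$), and let $\mathbf 1_{|\mathcal{NC}[f]|\le 1}\mathcal{NC}[f](k,\cdot)$ and $\mathbf 1_{|\mathcal{NC}[f]|\ge 1}\mathcal{NC}[f](k,\cdot)$ denote the restrictions of the curve $\mathcal{NC}[f](k,\cdot)$ to the sets of those $x$ where this size is $\le 1$, respectively $\ge 1$. Then for either choice there is a constant $C<\infty$, depending only on $p,r,w,v$, $G$ and $\|\cdot\|_{\mathfrak g}$, such that for all $f\in L^p(\mathbb R)$ the $V^r_x$ quantities below are measurable in $k$ and $$\big\|\mathbf 1_{|\mathcal{NC}[f]|\le 1}\,\mathcal{NC}[f]\big\|_{L^{p'}_k(V^r_x)}\le C\,\|f\|_{L^p(\mathbb R)},\qquad \big\|\mathbf 1_{|\mathcal{NC}[f]|\ge 1}\,\mathcal{NC}[f]\big\|_{L^{p'/r}_k(V^r_x)}^{1/r}\le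 C\,\|f\|_{L^p(\mathbb R)} .$$ (For $p=1$ one has $p'=p'/r=\infty$.) The same holds for the operator defined by the right-hand equation $\frac{\partial}{\partial x}\mathcal{NC}[f](k,x)=\big(\operatorname{Re}(e^{-2\pi i kx}f(x))\,w+\operatorname{Im}(e^{-2\pi i kx}f(x))\,v\big)\mathcal{NC}[f](k,x)$, $\mathcal{NC}[f](k,0)=I$, when $d$ is replaced by the right-invariant metric, defined with $\|\gamma'(t)\gamma(t)^{-1}\|_{\mathfrak g}$ in place of $\|\gamma(t)^{-1}\gamma'(t)\|_{\mathfrak g}$. -/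

import Mathlib

open MeasureTheory Set
open scoped Manifold ContDiff ENNReal NNReal

noncomputable section

namespace LieVariation

section Group

variable {E : Type*} [NormedAddCommGroup E] [NormedSpace ℝ E]
  {G : Type*} [TopologicalSpace G] [ChartedSpace E G] [Group G]

/-- The left-invariant norm `‖x‖_{T_g G} = ‖g⁻¹ x‖_𝔤` on the tangent spaces of `G`, obtained from
a norm `N` on the Lie algebra `𝔤 = T_1 G`. -/
abbrev leftENorm (N : Seminorm ℝ (GroupLieAlgebra 𝓘(ℝ, E) G)) (g : G) :
    ENorm (TangentSpace 𝓘(ℝ, E) g) where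
  enorm x := ENNReal.ofReal (N (mfderiv 𝓘(ℝ, E) 𝓘(ℝ, E) (fun h : G => g⁻¹ * h) g x))

/-- The right-invariant norm `‖x‖_{T_g G} = ‖x g⁻¹‖_𝔤` on the tangent spaces of `G`. -/
abbrev rightENorm (N : Seminorm ℝ (GroupLieAlgebra 𝓘(ℝ, E) G)) (g : G) :
    ENorm (TangentSpace 𝓘(ℝ, E) g) where
  enorm x := ENNReal.ofReal (N (mfderiv 𝓘(ℝ, E) 𝓘(ℝ, E) (fun h : G => h * g⁻¹) g x))

/-- The left-invariant distance on `G`: the infimum of the lengths `∫ ‖γ'(t)‖_{T_{γ(t)} G} dt` of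
the `C¹` paths `γ` from `g` to `h`, for the left-invariant norms on the tangent spaces. -/
def leftEDist (N : Seminorm ℝ (GroupLieAlgebra 𝓘(ℝ, E) G)) (g h : G) : ℝ≥0∞ :=
  letI : ∀ x : G, ENorm (TangentSpace 𝓘(ℝ, E) x) := leftENorm N
  Manifold.riemannianEDist 𝓘(ℝ, E) g h

/-- The right-invariant distance on `G`. -/
def rightEDist (N : Seminorm ℝ (GroupLieAlgebra 𝓘(ℝ, E) G)) (g h : G) : ℝ≥0∞ :=
  letI : ∀ x : G, ENorm (TangentSpace 𝓘(ℝ, E) x) := rightENorm N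
  Manifold.riemannianEDist 𝓘(ℝ, E) g h

variable (E) in
/-- A curve `γ : ℝ → G` is locally absolutely continuous if it is continuous and, read in any of
the charts of `G`, it is absolutely continuous on each compact interval that it maps into the
domain of that chart. -/
structure IsLocallyAC (γ : ℝ → G) : Prop where
  continuous : Continuous γ
  absolutelyContinuous : ∀ (g : G) (a b : ℝ), a ≤ b →
    (∀ t ∈ Icc a b, γ t ∈ (chartAt E g).source) →
    AbsolutelyContinuousOnInterval (fun t => extChartAt 𝓘(ℝ, E) g (γ t)) a b

/-- The Lie algebra element `Re(e^{-2πikx} f(x)) w + Im(e^{-2πikx} f(x)) v`. -/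
def symbol (w v : GroupLieAlgebra 𝓘(ℝ, E) G) (f : ℝ → ℂ) (k x : ℝ) :
    GroupLieAlgebra 𝓘(ℝ, E) G :=
  (Complex.exp (-(2 * Real.pi * k * x : ℝ) * Complex.I) * f x).re • w +
    (Complex.exp (-(2 * Real.pi * k * x : ℝ) * Complex.I) * f x).im • v

/-- `Γ = NC[f]` for the left trace: for each `k`, `Γ k` is the solution in the sense of
Carathéodory (locally absolutely continuous, equation valid for almost every `x`) of
`∂ₓ Γ(k,x) = Γ(k,x) (Re(e^{-2πikx} f(x)) w + Im(e^{-2πikx} f(x)) v)` with `Γ(k,0) = 1`. Here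
`mulInvariantVectorField X g` is the tangent vector `g X` at `g`. -/
structure IsLeftNC (w v : GroupLieAlgebra 𝓘(ℝ, E) G) (f : ℝ → ℂ) (Γ : ℝ → ℝ → G) : Prop where
  init : ∀ k, Γ k 0 = 1
  locallyAC : ∀ k, IsLocallyAC E (Γ k)
  ode : ∀ k, ∀ᵐ x : ℝ, HasMFDerivAt 𝓘(ℝ, ℝ) 𝓘(ℝ, E) (Γ k) x
    ((1 : ℝ →L[ℝ] ℝ).smulRight (mulInvariantVectorField (symbol w v f k x) (Γ k x)))

/-- The tangent vector `X g` at `g`, for `X` in the Lie algebra. -/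
def rightInvariantVectorField (X : GroupLieAlgebra 𝓘(ℝ, E) G) (g : G) :
    TangentSpace 𝓘(ℝ, E) g :=
  mfderiv 𝓘(ℝ, E) 𝓘(ℝ, E) (fun h : G => h * g) (1 : G) X

/-- `Γ = NC[f]` for the right trace: as `IsLeftNC`, for the equation
`∂ₓ Γ(k,x) = (Re(e^{-2πikx} f(x)) w + Im(e^{-2πikx} f(x)) v) Γ(k,x)`, `Γ(k,0) = 1`. -/
structure IsRightNC (w v : GroupLieAlgebra 𝓘(ℝ, E) G) (f : ℝ → ℂ) (Γ : ℝ → ℝ → G) : Prop where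
  init : ∀ k, Γ k 0 = 1
  locallyAC : ∀ k, IsLocallyAC E (Γ k)
  ode : ∀ k, ∀ᵐ x : ℝ, HasMFDerivAt 𝓘(ℝ, ℝ) 𝓘(ℝ, E) (Γ k) x
    ((1 : ℝ →L[ℝ] ℝ).smulRight (rightInvariantVectorField (symbol w v f k x) (Γ k x)))

end Group

/-- The `r`-variation of the restriction of `γ` to `S ⊆ ℝ`, for a distance function `d`: the
supremum of `(∑_{j<n} d(γ(t_{j+1}), γ(t_j))^r)^{1/r}` over all `t_0 ≤ t_1 ≤ … ≤ t_n` in `S`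
(it is `0` if `S` is empty). -/
def rVariationOn {G : Type*} (d : G → G → ℝ≥0∞) (r : ℝ) (γ : ℝ → G) (S : Set ℝ) : ℝ≥0∞ :=
  ⨆ (n : ℕ) (t : ℕ → ℝ) (_ : Monotone t) (_ : ∀ j, t j ∈ S),
    (∑ j ∈ Finset.range n, d (γ (t (j + 1))) (γ (t j)) ^ r) ^ (1 / r)

/-- The two truncated estimates
`‖1_{|Γ| ≤ 1} Γ‖_{L^q_k(V^r_x)} ≤ B` and `‖1_{|Γ| ≥ 1} Γ‖_{L^{q/r}_k(V^r_x)}^{1/r} ≤ B`,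
where `size k x` is the quantity `|Γ|` used for the truncation. As `Γ` takes values in a group,
the truncation `1_{|Γ| ≤ 1} Γ(k, ·)` is the restriction of the curve `Γ(k, ·)` to the set of all
`x` with `size k x ≤ 1`, and likewise for `≥`. -/
structure TruncatedBounds {G : Type*} (d : G → G → ℝ≥0∞) (q : ℝ≥0∞) (r : ℝ) (B : ℝ≥0∞)
    (Γ : ℝ → ℝ → G) (size : ℝ → ℝ → ℝ≥0∞) : Prop where
  aemeasurable_le : AEMeasurable (fun k => rVariationOn d r (Γ k) {x | size k x ≤ 1}) volume
  bound_le : eLpNorm (fun k => rVariationOn d r (Γ k) {x | size k x ≤ 1}) q volume ≤ B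
  aemeasurable_ge : AEMeasurable (fun k => rVariationOn d r (Γ k) {x | 1 ≤ size k x}) volume
  bound_ge : eLpNorm (fun k => rVariationOn d r (Γ k) {x | 1 ≤ size k x})
    (q / ENNReal.ofReal r) volume ^ (1 / r) ≤ B

end LieVariation

end

/-! Fix `ρ` with p < ρ < min(r, 2). The equation is driven by the path X_k(x) = ∫₀ˣ e^{-2πikt} f(t)
dt, and everything is read off from its ρ-variation a(k). The proof separates a linear estimate
‖a‖_{p'} ≤ C ‖f‖_p from a deterministic comparison of each solution with its driving path.

Linear estimate (`exists_eLpNorm_rVariationOn_partialFourier_le`). As in Christ–Kiselev, the line is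
parametrised by the mass of |f|^p. On an interval carrying the fraction 2^{-n} of the mass,
Hausdorff–Young gains 2^{-n/p}; summing 2^n such intervals in ℓ^ρ costs 2^{n/ρ}. Since ρ > p, the
scales form a convergent geometric series. Exchanging ℓ^ρ and L^{p'} is Minkowski's inequality, as ρ
< 2 < p'. Hausdorff–Young follows by real interpolation between the trivial bound and Plancherel.

Comparison. Let ω(s,t) be the ρ-th power of the ρ-variation of X_k on [s,t]; it is superadditive. In
a chart at 1, after a left translation, the first-order remainder of the solution is O(ω^{2/ρ}).
Since 2/ρ > 1, this is summable under bisection, so no iterated integrals are needed. Hence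
d(Γ(s),Γ(t)) ≤ C ω^{1/ρ} whenever ω(s,t) ≤ δ, uniformly in k and f (`exists_leftEDist_le_of_small`).
Cutting into about ω/δ pieces gives d ≤ C ω when ω > δ (`le_mul_of_local`).

Truncation (`exists_truncated_le`). Where the size is at most 1, distances are at most 2, so d ≤ C
ω^{1/ρ} holds for ω > δ as well and superadditivity yields V^r ≤ C a. If a is below a threshold θ,
the size stays below 1 and the set where it is ≥ 1 is empty; otherwise V^r ≤ C (a + a^ρ) ≤ C' a^r.
The norms of a in L^{p'} and of a^r in L^{p'/r} give the two bounds.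

Existence comes from Picard iteration on shells whose width does not depend on k, which also yields
joint continuity in (k,x); measurability follows, because superlevel sets of the variation are
projections of σ-compact sets. The right equation is the left equation in the opposite group. -/

namespace LieVariation

open Filter Topology

/-! ### Absolutely continuous curves. -/

section AbsolutelyContinuous

variable {X Y : Type*} [PseudoMetricSpace X] [PseudoMetricSpace Y]

theorem absolutelyContinuousOnInterval_of_dist_le {f : ℝ → X} {g : ℝ → Y} {a b K : ℝ}
    (hg : AbsolutelyContinuousOnInterval g a b)
    (h : ∀ x ∈ uIcc a b, ∀ y ∈ uIcc a b, dist (f x) (f y) ≤ K * dist (g x) (g y)) :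
    AbsolutelyContinuousOnInterval f a b := by
  unfold AbsolutelyContinuousOnInterval at hg ⊢
  have hg' := hg.const_mul K
  rw [mul_zero] at hg'
  refine squeeze_zero' ?_ ?_ hg'
  · filter_upwards with E
    exact Finset.sum_nonneg fun _ _ => dist_nonneg
  · have : ∀ᶠ (E : ℕ × (ℕ → ℝ × ℝ)) in AbsolutelyContinuousOnInterval.totalLengthFilter ⊓
        𝓟 (AbsolutelyContinuousOnInterval.disjWithin a b),
        E ∈ AbsolutelyContinuousOnInterval.disjWithin a b :=
      eventually_inf_principal.mpr (by simp)
    filter_upwards [this] with E hE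
    rw [Finset.mul_sum]
    exact Finset.sum_le_sum fun i hi => h _ (hE.1 i hi).1 _ (hE.1 i hi).2

theorem absolutelyContinuousOnInterval_trans {f : ℝ → X} {a b c : ℝ} (hac : a ≤ c) (hcb : c ≤ b)
    (h₁ : AbsolutelyContinuousOnInterval f a c) (h₂ : AbsolutelyContinuousOnInterval f c b) :
    AbsolutelyContinuousOnInterval f a b := by
  rw [absolutelyContinuousOnInterval_iff] at *
  intro ε hε
  obtain ⟨δ₁, hδ₁, H₁⟩ := h₁ (ε / 2) (half_pos hε)
  obtain ⟨δ₂, hδ₂, H₂⟩ := h₂ (ε / 2) (half_pos hε)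
  refine ⟨min δ₁ δ₂, lt_min hδ₁ hδ₂, fun E hE hlen => ?_⟩
  have hmin : ∀ x y : ℝ, dist (min x c) (min y c) ≤ dist x y := fun x y => by
    simp only [Real.dist_eq]; exact (abs_min_sub_min_le_max _ _ _ _).trans (by simp)
  have hmax : ∀ x y : ℝ, dist (max x c) (max y c) ≤ dist x y := fun x y => by
    simp only [Real.dist_eq]; exact (abs_max_sub_max_le_max _ _ _ _).trans (by simp)
  -- Clamping to `[a, c]` and to `[c, b]` keeps the intervals disjoint and does not lengthen them;
  -- an interval straddling `c` is split there by the triangle inequality.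
  have A := H₁ (E.1, fun i => (min (E.2 i).1 c, min (E.2 i).2 c)) (by
    refine ⟨fun i hi => ?_, fun i hi j hj hij => ?_⟩
    · have := hE.1 i hi
      rw [uIcc_of_le (hac.trans hcb)] at this
      rw [uIcc_of_le hac]
      exact ⟨⟨le_min this.1.1 hac, min_le_right _ _⟩, ⟨le_min this.2.1 hac, min_le_right _ _⟩⟩
    · refine (hE.2 hi hj hij).mono ?_ ?_ <;> intro x hx <;>
        simp only [uIoc, mem_Ioc] at hx ⊢ <;> grind)
    ((Finset.sum_le_sum fun i _ => hmin _ _).trans_lt (hlen.trans_le (min_le_left _ _)))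
  have B := H₂ (E.1, fun i => (max (E.2 i).1 c, max (E.2 i).2 c)) (by
    refine ⟨fun i hi => ?_, fun i hi j hj hij => ?_⟩
    · have := hE.1 i hi
      rw [uIcc_of_le (hac.trans hcb)] at this
      rw [uIcc_of_le hcb]
      exact ⟨⟨le_max_right _ _, max_le this.1.2 hcb⟩, ⟨le_max_right _ _, max_le this.2.2 hcb⟩⟩
    · refine (hE.2 hi hj hij).mono ?_ ?_ <;> intro x hx <;>
        simp only [uIoc, mem_Ioc] at hx ⊢ <;> grind)
    ((Finset.sum_le_sum fun i _ => hmax _ _).trans_lt (hlen.trans_le (min_le_right _ _)))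
  refine lt_of_le_of_lt ?_ ((add_lt_add A B).trans_eq (add_halves ε))
  rw [← Finset.sum_add_distrib]
  refine Finset.sum_le_sum fun i _ => ?_
  dsimp only
  generalize (E.2 i).1 = x
  generalize (E.2 i).2 = y
  rcases le_total x c with hx | hx <;> rcases le_total y c with hy | hy
  · simp [hx, hy]
  · simpa [hx, hy] using dist_triangle (f x) (f c) (f y)
  · simpa [hx, hy, add_comm] using dist_triangle (f x) (f c) (f y)
  · simp [hx, hy]

theorem absolutelyContinuousOnInterval_refl (f : ℝ → X) (a : ℝ) :
    AbsolutelyContinuousOnInterval f a a := by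
  rw [absolutelyContinuousOnInterval_iff]
  refine fun ε hε => ⟨1, one_pos, fun E hE _ => ?_⟩
  have : ∀ i ∈ Finset.range E.1, dist (f (E.2 i).1) (f (E.2 i).2) = 0 := fun i hi => by
    have := hE.1 i hi
    simp only [uIcc_self, mem_singleton_iff] at this
    simp [this.1, this.2]
  rw [Finset.sum_eq_zero this]
  exact hε

/-- Absolute continuity is a local property. -/
theorem absolutelyContinuousOnInterval_of_local {f : ℝ → X} {a b : ℝ} (hab : a ≤ b)
    (h : ∀ u ∈ Icc a b, ∃ ε > 0, ∀ c d, c ≤ d → Icc c d ⊆ Icc a b → Icc c d ⊆ Metric.ball u ε →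
      AbsolutelyContinuousOnInterval f c d) :
    AbsolutelyContinuousOnInterval f a b := by
  choose! ε hε H using h
  -- Compactness gives a finite partition with each cell inside one of the good neighbourhoods; the
  -- cells are glued one after another.
  obtain ⟨t, ht0, htm, ⟨m, hm⟩, ht⟩ := exists_monotone_Icc_subset_open_cover_Icc hab
    (c := fun u : Icc a b => Subtype.val ⁻¹' Metric.ball (u : ℝ) (ε u))
    (fun u => Metric.isOpen_ball.preimage continuous_subtype_val)
    (fun u _ => mem_iUnion.2 ⟨u, Metric.mem_ball_self (hε u u.2)⟩)
  have : ∀ n, AbsolutelyContinuousOnInterval f a (t n) := by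
    intro n
    induction n with
    | zero => rw [ht0]; exact absolutelyContinuousOnInterval_refl f a
    | succ n ih =>
      refine absolutelyContinuousOnInterval_trans (t n).2.1 (htm n.le_succ) ih ?_
      obtain ⟨i, hi⟩ := ht n
      have hsub : Icc (t n : ℝ) (t (n + 1)) ⊆ Icc a b :=
        Icc_subset_Icc (t n).2.1 (t (n + 1)).2.2
      refine H i i.2 _ _ (htm n.le_succ) hsub fun x hx => ?_
      exact hi (show (⟨x, hsub hx⟩ : Icc a b) ∈ Icc (t n) (t (n + 1)) from ⟨hx.1, hx.2⟩)
  have hb := this m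
  rwa [hm m le_rfl] at hb

variable {E : Type*} [NormedAddCommGroup E] [NormedSpace ℝ E]

/-- Increments of the primitive are dominated by those of the scalar primitive of `‖f‖`. -/
theorem absolutelyContinuousOnInterval_integral {f : ℝ → E} {a b c : ℝ}
    (h : IntervalIntegrable f volume a b) (hc : c ∈ uIcc a b) :
    AbsolutelyContinuousOnInterval (fun x ↦ ∫ v in c..x, f v) a b := by
  refine absolutelyContinuousOnInterval_of_dist_le (K := 1)
    (h.norm.absolutelyContinuousOnInterval_intervalIntegral hc) fun x hx y hy => ?_
  have hi : ∀ {z}, z ∈ uIcc a b → IntervalIntegrable f volume c z := fun hz =>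
    h.mono_set (uIcc_subset_uIcc hc hz)
  rw [one_mul, dist_comm, dist_comm (∫ v in c..x, ‖f v‖), dist_eq_norm, dist_eq_norm,
    intervalIntegral.integral_interval_sub_left (hi hy) (hi hx),
    intervalIntegral.integral_interval_sub_left (hi hy).norm (hi hx).norm]
  exact intervalIntegral.norm_integral_le_abs_integral_norm

/-- The fundamental theorem of calculus for absolutely continuous functions with values in a
Banach space, when the derivative is known almost everywhere. -/
theorem integral_eq_sub_of_absolutelyContinuous [CompleteSpace E] {z ζ : ℝ → E} {a b : ℝ}
    (hz : AbsolutelyContinuousOnInterval z a b)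
    (hd : ∀ᵐ x, x ∈ uIcc a b → HasDerivAt z (ζ x) x) (hζ : IntervalIntegrable ζ volume a b) :
    ∫ x in a..b, ζ x = z b - z a := by
  -- The difference of `z` and the primitive of `ζ` is absolutely continuous with derivative zero
  -- almost everywhere, hence constant.
  have hD := hz.sub (absolutelyContinuousOnInterval_integral hζ left_mem_uIcc)
  obtain ⟨C, hC⟩ := hD.const_of_ae_hasDerivAt_zero (by
    filter_upwards [hd, hζ.ae_hasDerivAt_integral] with x h₁ h₂ hx
    simpa using (h₁ hx).sub (h₂ hx a left_mem_uIcc))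
  have h₁ := hC a left_mem_uIcc
  have h₂ := hC b right_mem_uIcc
  simp only [Pi.sub_apply, intervalIntegral.integral_same, sub_zero] at h₁ h₂
  rw [h₁, ← h₂]
  abel

end AbsolutelyContinuous

/-! ### Young estimates for controlled equations, ρ < 2. -/

section Young

/-- The best constant in `a ≤ K * b` is attained, and improving it once more gives `K ≤ q * K + D`.
The a priori bound `h0` only ensures that some constant exists; its size does not enter the
conclusion. -/
theorem le_mul_of_self_improvement {ι : Type*} {a b : ι → ℝ} (hb : ∀ i, 0 ≤ b i) {q D : ℝ}
    (hq0 : 0 ≤ q) (hq1 : q < 1) (hD : 0 ≤ D) (h0 : ∃ K, ∀ i, a i ≤ K * b i)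
    (step : ∀ K, 0 ≤ K → (∀ i, a i ≤ K * b i) → ∀ i, a i ≤ (q * K + D) * b i) (i : ι) :
    a i ≤ D / (1 - q) * b i := by
  set S : Set ℝ := {K | 0 ≤ K ∧ ∀ i, a i ≤ K * b i} with hS
  have hne : S.Nonempty := by
    obtain ⟨K, hK⟩ := h0
    refine ⟨max K 0, le_max_right _ _, fun i => (hK i).trans ?_⟩
    gcongr
    · exact hb i
    · exact le_max_left _ _
  have hbdd : BddBelow S := ⟨0, fun K hK => hK.1⟩
  have h0S : 0 ≤ sInf S := le_csInf hne fun K hK => hK.1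
  have hmem : ∀ i, a i ≤ sInf S * b i := by
    intro i
    rcases (hb i).eq_or_lt with h | h
    · obtain ⟨K, hK⟩ := hne
      have := hK.2 i
      rw [← h, mul_zero] at this ⊢
      exact this
    · rw [← div_le_iff₀ h]
      exact le_csInf hne fun K hK => (div_le_iff₀ h).2 (hK.2 i)
  have hle : sInf S ≤ q * sInf S + D :=
    csInf_le hbdd ⟨by positivity, step _ h0S hmem⟩
  refine (hmem i).trans ?_
  have := hb i
  gcongr
  rw [le_div_iff₀ (by linarith)]
  linarith

/-- A superadditive function of intervals can be halved, up to a short middle interval. -/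
theorem exists_halving {Ω : ℝ → ℝ → ℝ} {s u : ℝ} (hsu : s ≤ u)
    (h0 : ∀ x ∈ Icc s u, ∀ z ∈ Icc s u, x ≤ z → 0 ≤ Ω x z)
    (hΩ : ∀ x ∈ Icc s u, ∀ z ∈ Icc s u, ∀ m ∈ Icc x z, Ω x m + Ω m z ≤ Ω x z)
    {η : ℝ} (hη : 0 < η) :
    ∃ m ∈ Icc s u, ∃ m' ∈ Icc m u, m' - m ≤ η ∧ Ω s m ≤ Ω s u / 2 ∧ Ω m' u ≤ Ω s u / 2 := by
  have hs : s ∈ Icc s u := ⟨le_rfl, hsu⟩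
  have hu : u ∈ Icc s u := ⟨hsu, le_rfl⟩
  have hdiag : ∀ x ∈ Icc s u, Ω x x = 0 := fun x hx => by
    have h₁ := hΩ x hx x hx x ⟨le_rfl, le_rfl⟩
    have h₂ := h0 x hx x hx le_rfl
    linarith
  have hpos := h0 s hs u hu hsu
  -- `Ω` is not assumed continuous, so an exact midpoint may not exist. `m` is taken just below the
  -- supremum of `S` and `m'` just above it (or equal to `u`); in the former case `Ω s m'` exceeds
  -- one half, and superadditivity leaves at most one half to `Ω m' u`.
  set S : Set ℝ := {x | x ∈ Icc s u ∧ Ω s x ≤ Ω s u / 2} with hS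
  have hsS : s ∈ S := ⟨hs, by rw [hdiag s hs]; linarith⟩
  have hbdd : BddAbove S := ⟨u, fun x hx => hx.1.2⟩
  obtain ⟨m, hmS, hm⟩ := exists_lt_of_lt_csSup ⟨s, hsS⟩ (show sSup S - η / 2 < sSup S by linarith)
  have hSu : sSup S ≤ u := csSup_le ⟨s, hsS⟩ fun x hx => hx.1.2
  have hmle : m ≤ sSup S := le_csSup hbdd hmS
  refine ⟨m, hmS.1, min u (sSup S + η / 2), ⟨le_min hmS.1.2 (by linarith), min_le_left _ _⟩, ?_,
    hmS.2, ?_⟩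
  · have := min_le_right u (sSup S + η / 2)
    linarith
  · rcases le_total u (sSup S + η / 2) with h | h
    · rw [min_eq_left h, hdiag u hu]; linarith
    · rw [min_eq_right h]
      have hx : sSup S + η / 2 ∈ Icc s u := ⟨by linarith [hmS.1.1], h⟩
      have hnot : ¬ Ω s (sSup S + η / 2) ≤ Ω s u / 2 := fun hle => by
        have := le_csSup hbdd (show sSup S + η / 2 ∈ S from ⟨hx, hle⟩)
        linarith
      have := hΩ s hs u hu _ hx
      linarith

variable {E F : Type*} [NormedAddCommGroup E] [NormedSpace ℝ E]
  [NormedAddCommGroup F] [NormedSpace ℝ F]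

/-- An approximate flow estimate in the Young regime `ρ < 2`: if `y` is to first order driven by
`X` through the Lipschitz field `M`, then the increments of `y` are controlled by those of `X`, with
a constant that does not depend on the a priori bounds `hy` and `hJ`. -/
theorem norm_sub_le_of_young {ρ K L : ℝ} (hρ0 : 0 < ρ) (hρ : ρ < 2) (hK : 0 ≤ K) (hL : 0 ≤ L)
    {y : ℝ → E} {X : ℝ → F} {M : E → F →L[ℝ] E} {B : Set E} {a b : ℝ} (hab : a ≤ b)
    (hMK : ∀ x ∈ B, ‖M x‖ ≤ K) (hML : ∀ x ∈ B, ∀ x' ∈ B, ‖M x - M x'‖ ≤ L * ‖x - x'‖)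
    (hyc : ContinuousOn y (Icc a b)) (hXc : ContinuousOn X (Icc a b))
    (hyB : MapsTo y (Icc a b) B) {Ω : ℝ → ℝ → ℝ}
    (h0 : ∀ x ∈ Icc a b, ∀ z ∈ Icc a b, x ≤ z → 0 ≤ Ω x z)
    (hΩ : ∀ x ∈ Icc a b, ∀ z ∈ Icc a b, ∀ m ∈ Icc x z, Ω x m + Ω m z ≤ Ω x z)
    (hX : ∀ x ∈ Icc a b, ∀ z ∈ Icc a b, x ≤ z → ‖X z - X x‖ ≤ Ω x z ^ (1 / ρ))
    (hy : ∃ κ, ∀ x ∈ Icc a b, ∀ z ∈ Icc a b, x ≤ z → ‖y z - y x‖ ≤ κ * Ω x z ^ (1 / ρ))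
    (hJ : ∃ κ, ∀ x ∈ Icc a b, ∀ z ∈ Icc a b, x ≤ z →
      ‖y z - y x - M (y x) (X z - X x)‖ ≤ κ * Ω x z ^ (2 / ρ))
    (hsmall : Ω a b ^ (1 / ρ) ≤ (1 - 2 ^ (1 - 2 / ρ)) / (4 * (L + 1))) :
    ‖y b - y a‖ ≤ 2 * K * Ω a b ^ (1 / ρ) := by
  -- Two halves of the control contribute 2 · (1/2)^{2/ρ} = `q` times the original power; `q < 1` is
  -- exactly ρ < 2.
  set q : ℝ := 2 ^ (1 - 2 / ρ) with hq
  have hθ : 1 < 2 / ρ := by rwa [lt_div_iff₀ hρ0, one_mul]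
  have hq0 : 0 < q := by positivity
  have hq1 : q < 1 := Real.rpow_lt_one_of_one_lt_of_neg (by norm_num) (by linarith)
  have hmono : ∀ x ∈ Icc a b, ∀ z ∈ Icc a b, x ≤ z → ∀ x' ∈ Icc x z, ∀ z' ∈ Icc x z, x' ≤ z' →
      Ω x' z' ≤ Ω x z := by
    intro x hx z hz hxz x' hx' z' hz' hxz'
    have hx'' : x' ∈ Icc a b := ⟨hx.1.trans hx'.1, hx'.2.trans hz.2⟩
    have hz'' : z' ∈ Icc a b := ⟨hx.1.trans hz'.1, hz'.2.trans hz.2⟩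
    have h₁ := hΩ x hx z hz x' hx'
    have h₂ := hΩ x' hx'' z hz z' ⟨hxz', hz'.2⟩
    have h₃ := h0 x hx x' hx'' hx'.1
    have h₄ := h0 z' hz'' z hz hz'.2
    linarith
  have ha : a ∈ Icc a b := ⟨le_rfl, hab⟩
  have hb : b ∈ Icc a b := ⟨hab, le_rfl⟩
  let ι := {P : ℝ × ℝ // P.1 ∈ Icc a b ∧ P.2 ∈ Icc a b ∧ P.1 ≤ P.2}
  have hι0 : ∀ i : ι, 0 ≤ Ω i.1.1 i.1.2 := fun i => h0 _ i.2.1 _ i.2.2.1 i.2.2.2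
  have hsq : ∀ {x z}, x ∈ Icc a b → z ∈ Icc a b → x ≤ z →
      Ω x z ^ (2 / ρ) = Ω x z ^ (1 / ρ) * Ω x z ^ (1 / ρ) := fun hx hz hxz => by
    rw [← Real.rpow_add_of_nonneg (h0 _ hx _ hz hxz) (by positivity) (by positivity)]
    ring_nf
  -- First self-improvement. The remainder on `[s, u]` is the sum of those on the two halves, that
  -- of a short middle interval and two cross terms, each at most `L * κ * Ω s u ^ (2 / ρ)`. So a
  -- constant `B'` improves to `q * B' + 2 * L * κ`.
  have hJimp : ∀ κ, 0 ≤ κ → (∀ x ∈ Icc a b, ∀ z ∈ Icc a b, x ≤ z →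
      ‖y z - y x‖ ≤ κ * Ω x z ^ (1 / ρ)) → ∀ x ∈ Icc a b, ∀ z ∈ Icc a b, x ≤ z →
      ‖y z - y x - M (y x) (X z - X x)‖ ≤ 2 * L * κ / (1 - q) * Ω x z ^ (2 / ρ) := by
    intro κ hκ hyκ x hx z hz hxz
    refine le_mul_of_self_improvement (ι := ι)
      (a := fun i => ‖y i.1.2 - y i.1.1 - M (y i.1.1) (X i.1.2 - X i.1.1)‖)
      (b := fun i => Ω i.1.1 i.1.2 ^ (2 / ρ)) (fun i => by have := hι0 i; positivity) hq0.le hq1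
      (by positivity) ?_ ?_ ⟨(x, z), hx, hz, hxz⟩
    · obtain ⟨κ, h⟩ := hJ
      exact ⟨κ, fun i => h _ i.2.1 _ i.2.2.1 i.2.2.2⟩
    · rintro B' hB' hB'J ⟨⟨s, u⟩, hs, hu, hsu⟩
      dsimp only at hs hu hsu ⊢
      have hsub : Icc s u ⊆ Icc a b := Icc_subset_Icc hs.1 hu.2
      refine le_of_forall_pos_le_add fun ε hε => ?_
      obtain ⟨η₁, hη₁, hyη⟩ := Metric.uniformContinuousOn_iff.1
        (isCompact_Icc.uniformContinuousOn_of_continuous hyc) (ε / 2) (half_pos hε)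
      obtain ⟨η₂, hη₂, hXη⟩ := Metric.uniformContinuousOn_iff.1
        (isCompact_Icc.uniformContinuousOn_of_continuous hXc) (ε / (2 * (K + 1))) (by positivity)
      obtain ⟨m, hm, m', hm', hmm, h₁, h₂⟩ := exists_halving hsu
        (fun x hx z hz => h0 x (hsub hx) z (hsub hz))
        (fun x hx z hz => hΩ x (hsub hx) z (hsub hz))
        (show 0 < min η₁ η₂ / 2 by positivity)
      have hmab := hsub hm
      have hm'su : m' ∈ Icc s u := ⟨hm.1.trans hm'.1, hm'.2⟩
      have hm'ab := hsub hm'su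
      have hΩsu := h0 s hs u hu hsu
      have hdist : dist m' m < min η₁ η₂ := by
        rw [Real.dist_eq, abs_of_nonneg (by linarith [hm'.1])]
        have : 0 < min η₁ η₂ := by positivity
        linarith
      -- The middle interval is short, so uniform continuity of `y` and `X` makes its remainder
      -- arbitrarily small.
      have e₁ : ‖y m' - y m - M (y m) (X m' - X m)‖ ≤ ε := by
        have hy' := hyη m' hm'ab m hmab (hdist.trans_le (min_le_left _ _))
        have hX' := hXη m' hm'ab m hmab (hdist.trans_le (min_le_right _ _))
        rw [dist_eq_norm] at hy' hX'
        have : ‖M (y m) (X m' - X m)‖ ≤ K * (ε / (2 * (K + 1))) :=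
          ((M (y m)).le_opNorm _).trans (by gcongr; exact hMK _ (hyB hmab))
        have hle : K * (ε / (2 * (K + 1))) ≤ ε / 2 := by
          rw [mul_div_assoc', div_le_div_iff₀ (by positivity) (by norm_num)]
          nlinarith
        linarith [norm_sub_le (y m' - y m) (M (y m) (X m' - X m))]
      have key : ∀ {x x' z z' : ℝ}, x ∈ Icc s u → x' ∈ Icc s u → x ≤ x' → z ∈ Icc s u →
          z' ∈ Icc s u → z ≤ z' →
          ‖(M (y x') - M (y x)) (X z' - X z)‖ ≤ L * κ * Ω s u ^ (2 / ρ) := by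
        intro x x' z z' hx hx' hxx hz hz' hzz
        have hx0 := h0 x (hsub hx) x' (hsub hx') hxx
        have hz0 := h0 z (hsub hz) z' (hsub hz') hzz
        calc _ ≤ ‖M (y x') - M (y x)‖ * ‖X z' - X z‖ := ContinuousLinearMap.le_opNorm _ _
          _ ≤ (L * (κ * Ω x x' ^ (1 / ρ))) * Ω z z' ^ (1 / ρ) := by
            gcongr
            · refine (hML _ (hyB (hsub hx')) _ (hyB (hsub hx))).trans ?_
              gcongr
              exact hyκ _ (hsub hx) _ (hsub hx') hxx
            · exact hX _ (hsub hz) _ (hsub hz') hzz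
          _ ≤ (L * (κ * Ω s u ^ (1 / ρ))) * Ω s u ^ (1 / ρ) := by
            have i₁ := hmono s hs u hu hsu x hx x' hx' hxx
            have i₂ := hmono s hs u hu hsu z hz z' hz' hzz
            gcongr
          _ = _ := by rw [hsq hs hu hsu]; ring
      have hs' : s ∈ Icc s u := ⟨le_rfl, hsu⟩
      have hu' : u ∈ Icc s u := ⟨hsu, le_rfl⟩
      have k₁ := key hs' hm hm.1 hm hm'su hm'.1
      have k₂ := key hs' hm'su hm'su.1 hm'su hu' hm'.2
      have j₁ := hB'J ⟨(s, m), hs, hmab, hm.1⟩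
      have j₂ := hB'J ⟨(m', u), hm'ab, hu, hm'.2⟩
      dsimp only at j₁ j₂
      have half : ∀ {x}, 0 ≤ x → x ≤ Ω s u / 2 → B' * x ^ (2 / ρ) ≤ B' * (q / 2 * Ω s u ^ (2 / ρ)) := by
        intro x hx hxle
        gcongr
        calc x ^ (2 / ρ) ≤ (Ω s u / 2) ^ (2 / ρ) := by gcongr
          _ = _ := by
            rw [Real.div_rpow hΩsu (by norm_num), hq, Real.rpow_sub (by norm_num), Real.rpow_one]
            ring
      have g₁ := j₁.trans (half (h0 s hs m hmab hm.1) h₁)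
      have g₂ := j₂.trans (half (h0 m' hm'ab u hu hm'.2) h₂)
      have hdecomp : y u - y s - M (y s) (X u - X s) =
          (y m - y s - M (y s) (X m - X s)) + (y m' - y m - M (y m) (X m' - X m)) +
          (y u - y m' - M (y m') (X u - X m')) + (M (y m) - M (y s)) (X m' - X m) +
          (M (y m') - M (y s)) (X u - X m') := by
        simp only [map_sub, sub_apply]
        abel
      rw [hdecomp]
      refine (norm_add_le _ _).trans ((add_le_add_left norm_add₄_le _).trans ?_)
      nlinarith
  -- Second self-improvement. Under `hsmall` the remainder contributes at most `κ / 2` and the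
  -- linear term at most `K`, so `κ` becomes `κ / 2 + K`, with fixed point `2 * K`.
  have := le_mul_of_self_improvement (ι := ι) (a := fun i => ‖y i.1.2 - y i.1.1‖)
    (b := fun i => Ω i.1.1 i.1.2 ^ (1 / ρ)) (q := 1 / 2) (D := K)
    (fun i => by have := hι0 i; positivity) (by norm_num) (by norm_num) hK
    (by obtain ⟨κ, h⟩ := hy; exact ⟨κ, fun i => h _ i.2.1 _ i.2.2.1 i.2.2.2⟩) ?_
    ⟨(a, b), ha, hb, hab⟩
  · refine this.trans_eq ?_
    rw [show K / (1 - 1 / 2) = 2 * K by ring]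
  · rintro κ hκ hyκ ⟨⟨s, u⟩, hs, hu, hsu⟩
    dsimp only at hs hu hsu ⊢
    have hj := hJimp κ hκ (fun x hx z hz hxz => hyκ ⟨(x, z), hx, hz, hxz⟩) s hs u hu hsu
    have hΩsu := h0 s hs u hu hsu
    have hle : Ω s u ^ (1 / ρ) ≤ (1 - q) / (4 * (L + 1)) := by
      refine le_trans ?_ hsmall
      have := hmono a ha b hb hab s hs u hu hsu
      gcongr
    have hMX : ‖M (y s) (X u - X s)‖ ≤ K * Ω s u ^ (1 / ρ) :=
      ((M (y s)).le_opNorm _).trans (by gcongr; exacts [hMK _ (hyB hs), hX s hs u hu hsu])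
    have htri : ‖y u - y s‖ ≤ ‖y u - y s - M (y s) (X u - X s)‖ + ‖M (y s) (X u - X s)‖ := by
      simpa using norm_add_le (y u - y s - M (y s) (X u - X s)) (M (y s) (X u - X s))
    have hcoef : 2 * L * κ / (1 - q) * Ω s u ^ (1 / ρ) ≤ 1 / 2 * κ := by
      calc _ ≤ 2 * L * κ / (1 - q) * ((1 - q) / (4 * (L + 1))) := by
            have : 0 < 1 - q := by linarith
            gcongr
        _ = 1 / 2 * κ * (L / (L + 1)) := by
            have : 1 - q ≠ 0 := by linarith
            field_simp
            ring
        _ ≤ 1 / 2 * κ * 1 := by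
            gcongr
            rw [div_le_one (by positivity)]
            linarith
        _ = _ := mul_one _
    rw [hsq hs hu hsu, ← mul_assoc] at hj
    have : 0 ≤ Ω s u ^ (1 / ρ) := by positivity
    nlinarith

/-- Solutions of the controlled equation `dy = M(y) c dt` inherit the `ρ`-variation bounds of the
primitive of `c`, uniformly in `c`. -/
theorem norm_sub_le_of_controlled [CompleteSpace E] [CompleteSpace F] {ρ K L : ℝ} (hρ1 : 1 ≤ ρ) (hρ : ρ < 2) (hK : 0 ≤ K) (hL : 0 ≤ L)
    {y : ℝ → E} {c : ℝ → F} {M : E → F →L[ℝ] E} {B : Set E} {a b : ℝ} (hab : a ≤ b)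
    (hMK : ∀ x ∈ B, ‖M x‖ ≤ K) (hML : ∀ x ∈ B, ∀ x' ∈ B, ‖M x - M x'‖ ≤ L * ‖x - x'‖)
    (hyc : ContinuousOn y (Icc a b)) (hyB : MapsTo y (Icc a b) B)
    (hc : IntervalIntegrable c volume a b)
    (hMc : IntervalIntegrable (fun τ => M (y τ) (c τ)) volume a b)
    (hode : ∀ x ∈ Icc a b, ∀ z ∈ Icc a b, x ≤ z → y z - y x = ∫ τ in x..z, M (y τ) (c τ))
    {Ω : ℝ → ℝ → ℝ}
    (h0 : ∀ x ∈ Icc a b, ∀ z ∈ Icc a b, x ≤ z → 0 ≤ Ω x z)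
    (hΩ : ∀ x ∈ Icc a b, ∀ z ∈ Icc a b, ∀ m ∈ Icc x z, Ω x m + Ω m z ≤ Ω x z)
    (hX : ∀ x ∈ Icc a b, ∀ z ∈ Icc a b, x ≤ z → ‖∫ τ in x..z, c τ‖ ≤ Ω x z ^ (1 / ρ))
    (hsmall : Ω a b ^ (1 / ρ) < (1 - 2 ^ (1 - 2 / ρ)) / (4 * (L + 1))) :
    ‖y b - y a‖ ≤ 2 * K * Ω a b ^ (1 / ρ) := by
  have hρ0 : 0 < ρ := by linarith
  have ha : a ∈ Icc a b := ⟨le_rfl, hab⟩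
  have hb : b ∈ Icc a b := ⟨hab, le_rfl⟩
  have hci : ∀ {x z}, x ∈ Icc a b → z ∈ Icc a b → IntervalIntegrable c volume x z :=
    fun hx hz => hc.mono_set (by rw [uIcc_of_le hab]; exact uIcc_subset_Icc hx hz)
  have hMci : ∀ {x z}, x ∈ Icc a b → z ∈ Icc a b →
      IntervalIntegrable (fun τ => M (y τ) (c τ)) volume x z :=
    fun hx hz => hMc.mono_set (by rw [uIcc_of_le hab]; exact uIcc_subset_Icc hx hz)
  -- `T` is additive and bounds the increments of `y`, but it depends on the size of `c`; it serves
  -- only for a priori bounds.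
  set T : ℝ → ℝ → ℝ := fun x z => ∫ τ in x..z, ‖c τ‖ with hT
  have hT0 : ∀ {x z}, x ≤ z → 0 ≤ T x z := fun hxz =>
    intervalIntegral.integral_nonneg hxz fun _ _ => norm_nonneg _
  have hTadd : ∀ x ∈ Icc a b, ∀ z ∈ Icc a b, ∀ m ∈ Icc x z, T x m + T m z = T x z := by
    intro x hx z hz m hm
    have hm' : m ∈ Icc a b := ⟨hx.1.trans hm.1, hm.2.trans hz.2⟩
    exact intervalIntegral.integral_add_adjacent_intervals (hci hx hm').norm (hci hm' hz).norm
  have hTle : ∀ x ∈ Icc a b, ∀ z ∈ Icc a b, ∀ x' ∈ Icc x z, ∀ z' ∈ Icc x z, x' ≤ z' →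
      T x' z' ≤ T x z := by
    intro x hx z hz x' hx' z' hz' h
    have hx'' : x' ∈ Icc a b := ⟨hx.1.trans hx'.1, hx'.2.trans hz.2⟩
    have h₁ := hTadd x hx z hz x' hx'
    have h₂ := hTadd x' hx'' z hz z' ⟨h, hz'.2⟩
    have h₃ := hT0 hx'.1
    have h₄ := hT0 hz'.2
    linarith
  have hyT : ∀ x ∈ Icc a b, ∀ z ∈ Icc a b, x ≤ z → ‖y z - y x‖ ≤ K * T x z := by
    intro x hx z hz hxz
    rw [hode x hx z hz hxz, hT, ← intervalIntegral.integral_const_mul]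
    refine intervalIntegral.norm_integral_le_of_norm_le hxz (ae_of_all _ fun τ hτ => ?_)
      ((hci hx hz).norm.const_mul K)
    refine ((M (y τ)).le_opNorm _).trans ?_
    gcongr
    exact hMK _ (hyB ⟨hx.1.trans hτ.1.le, hτ.2.trans hz.2⟩)
  have hJT : ∀ x ∈ Icc a b, ∀ z ∈ Icc a b, x ≤ z →
      ‖y z - y x - M (y x) (∫ τ in x..z, c τ)‖ ≤ L * K * (T x z * T x z) := by
    intro x hx z hz hxz
    rw [hode x hx z hz hxz, ← ContinuousLinearMap.intervalIntegral_comp_comm _ (hci hx hz),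
      ← intervalIntegral.integral_sub (hMci hx hz) ⟨(M (y x)).integrable_comp (hci hx hz).1, (M (y x)).integrable_comp (hci hx hz).2⟩]
    have : L * K * (T x z * T x z) = ∫ τ in x..z, L * K * T x z * ‖c τ‖ := by
      rw [intervalIntegral.integral_const_mul]; ring
    rw [this]
    refine intervalIntegral.norm_integral_le_of_norm_le hxz (ae_of_all _ fun τ hτ => ?_)
      ((hci hx hz).norm.const_mul _)
    have hτ' : τ ∈ Icc a b := ⟨hx.1.trans hτ.1.le, hτ.2.trans hz.2⟩
    rw [← sub_apply]
    refine ((M (y τ) - M (y x)).le_opNorm _).trans ?_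
    gcongr
    refine (hML _ (hyB hτ') _ (hyB hx)).trans ?_
    rw [mul_assoc]
    gcongr
    refine (hyT x hx τ hτ' hτ.1.le).trans ?_
    gcongr
    exact hTle x hx z hz x ⟨le_rfl, hxz⟩ τ ⟨hτ.1.le, hτ.2⟩ hτ.1.le
  -- `norm_sub_le_of_young` asks for a priori bounds by powers of the control, which `Ω` alone need
  -- not provide. Adding `ε * T` provides them, with constants depending on `ε` that do not appear
  -- in its conclusion; then `ε` tends to 0.
  have main : ∀ ε : ℝ, 0 < ε →
      (Ω a b + ε * T a b) ^ (1 / ρ) ≤ (1 - 2 ^ (1 - 2 / ρ)) / (4 * (L + 1)) →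
      ‖y b - y a‖ ≤ 2 * K * (Ω a b + ε * T a b) ^ (1 / ρ) := by
    intro ε hε hsm
    set Λ : ℝ := T a b ^ (1 - 1 / ρ) * ε⁻¹ ^ (1 / ρ) with hΛ
    have hρle : 1 / ρ ≤ 1 := by rw [div_le_one hρ0]; exact hρ1
    have hΛ0 : 0 ≤ Λ := by have := hT0 hab; positivity
    have hTΛ : ∀ x ∈ Icc a b, ∀ z ∈ Icc a b, x ≤ z →
        T x z ≤ Λ * (Ω x z + ε * T x z) ^ (1 / ρ) := by
      intro x hx z hz hxz
      have ht := hT0 hxz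
      have hw := h0 x hx z hz hxz
      calc T x z = T x z ^ (1 - 1 / ρ) * T x z ^ (1 / ρ) := by
            rw [← Real.rpow_add_of_nonneg ht (by linarith) (by positivity)]
            simp
        _ = T x z ^ (1 - 1 / ρ) * (ε⁻¹ ^ (1 / ρ) * (ε * T x z) ^ (1 / ρ)) := by
            rw [← Real.mul_rpow (by positivity) (by positivity), inv_mul_cancel_left₀ hε.ne']
        _ ≤ T a b ^ (1 - 1 / ρ) * (ε⁻¹ ^ (1 / ρ) * (Ω x z + ε * T x z) ^ (1 / ρ)) := by
            have : T x z ≤ T a b := hTle a ha b hb x hx z hz hxz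
            have := hT0 hab
            gcongr
            linarith
        _ = _ := by rw [hΛ]; ring
    have hXsub : ∀ x ∈ Icc a b, ∀ z ∈ Icc a b,
        (∫ τ in a..z, c τ) - ∫ τ in a..x, c τ = ∫ τ in x..z, c τ := fun x hx z hz =>
      intervalIntegral.integral_interval_sub_left (hci ha hz) (hci ha hx)
    refine norm_sub_le_of_young (X := fun u => ∫ τ in a..u, c τ) (Ω := fun x z => Ω x z + ε * T x z)
      hρ0 hρ hK hL hab hMK hML hyc ?_ hyB ?_ ?_ ?_ ?_ ?_ hsm
    · simpa [uIcc_of_le hab] using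
        intervalIntegral.continuousOn_primitive_interval' hc left_mem_uIcc
    · intro x hx z hz hxz
      have := h0 x hx z hz hxz
      have := hT0 hxz
      positivity
    · intro x hx z hz m hm
      have h₁ := hΩ x hx z hz m hm
      have h₂ := hTadd x hx z hz m hm
      nlinarith
    · intro x hx z hz hxz
      rw [hXsub x hx z hz]
      refine (hX x hx z hz hxz).trans ?_
      have := h0 x hx z hz hxz
      have := hT0 hxz
      gcongr
      nlinarith
    · refine ⟨K * Λ, fun x hx z hz hxz => (hyT x hx z hz hxz).trans ?_⟩
      rw [mul_assoc]
      gcongr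
      exact hTΛ x hx z hz hxz
    · refine ⟨L * K * (Λ * Λ), fun x hx z hz hxz => ?_⟩
      rw [hXsub x hx z hz]
      refine (hJT x hx z hz hxz).trans ?_
      have hw : 0 ≤ Ω x z + ε * T x z := by
        have := h0 x hx z hz hxz
        have := hT0 hxz
        positivity
      have hsq : (Ω x z + ε * T x z) ^ (2 / ρ) =
          (Ω x z + ε * T x z) ^ (1 / ρ) * (Ω x z + ε * T x z) ^ (1 / ρ) := by
        rw [← Real.rpow_add_of_nonneg hw (by positivity) (by positivity)]
        ring_nf
      have := hT0 hxz
      have hle := hTΛ x hx z hz hxz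
      rw [hsq, mul_assoc (L * K), mul_mul_mul_comm Λ]
      exact mul_le_mul_of_nonneg_left (mul_le_mul hle hle this (this.trans hle)) (by positivity)
  have hlim : Tendsto (fun ε : ℝ => (Ω a b + ε * T a b) ^ (1 / ρ)) (𝓝[>] 0)
      (𝓝 (Ω a b ^ (1 / ρ))) := by
    have : ContinuousAt (fun ε : ℝ => (Ω a b + ε * T a b) ^ (1 / ρ)) 0 :=
      ContinuousAt.rpow_const (by fun_prop) (Or.inr (by positivity))
    simpa using this.tendsto.mono_left nhdsWithin_le_nhds
  refine ge_of_tendsto (hlim.const_mul (2 * K)) ?_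
  filter_upwards [self_mem_nhdsWithin, hlim.eventually_lt_const hsmall] with ε hε hε'
  exact main ε hε hε'.le

end Young

/-! ### Plancherel and Hausdorff–Young by real interpolation. -/

section HausdorffYoung

open FourierTransform SchwartzMap

/-- Plancherel's theorem for the Fourier integral of an integrable and square integrable function. -/
theorem eLpNorm_fourier_two {f : ℝ → ℂ} (hf : Integrable f) (hf2 : MemLp f 2 volume) :
    eLpNorm (𝓕 f) 2 volume = eLpNorm f 2 volume := by
  set g : Lp ℂ 2 (volume : Measure ℝ) := hf2.toLp f with hg
  have hcont : Continuous (𝓕 f) :=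
    VectorFourier.fourierIntegral_continuous Real.continuous_fourierChar
      (L := innerₗ ℝ) continuous_inner hf
  -- The Fourier integral and the abstract `L²` transform are identified by testing against smooth
  -- compactly supported `φ`: both pairings equal the integral of `𝓕 φ` against `f`.
  have hae : ∀ᵐ x, 𝓕 f x = (𝓕 g : Lp ℂ 2 (volume : Measure ℝ)) x := by
    refine ae_eq_of_integral_contDiff_smul_eq hcont.locallyIntegrable
      ((Lp.memLp (𝓕 g)).locallyIntegrable (by norm_num)) fun φ hφ hφc => ?_
    have hφ₁ : HasCompactSupport (Complex.ofRealCLM ∘ φ) := hφc.comp_left rfl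
    have hφ₂ : ContDiff ℝ ∞ (Complex.ofRealCLM ∘ φ) := by fun_prop
    set ψ : 𝓢(ℝ, ℂ) := hφ₁.toSchwartzMap hφ₂ with hψ
    have hψx : ∀ x, ψ x = φ x := fun x => rfl
    have h₁ : ∫ x, φ x • (𝓕 g : Lp ℂ 2 (volume : Measure ℝ)) x = ∫ x, (𝓕 ψ) x • g x := by
      have := congrArg (fun D => D ψ) (Lp.fourier_toTemperedDistribution_eq g)
      simp only [TemperedDistribution.fourier_apply, Lp.toTemperedDistribution_apply] at this
      rw [this]
      rfl
    have h₂ : ∫ x, φ x • 𝓕 f x = ∫ x, (𝓕 ψ) x • f x := by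
      have := VectorFourier.integral_fourierIntegral_smul_eq_flip (L := innerₗ ℝ) (μ := volume)
        (ν := volume) (f := ψ) (g := f) Real.continuous_fourierChar continuous_inner ψ.integrable hf
      rw [flip_innerₗ] at this
      exact this.symm
    rw [h₁, h₂]
    refine integral_congr_ae ?_
    filter_upwards [hf2.coeFn_toLp] with x hx
    rw [hx]
  rw [eLpNorm_congr_ae hae, ← eLpNorm_congr_ae hf2.coeFn_toLp,
    ← ENNReal.toReal_eq_toReal_iff' (Lp.eLpNorm_ne_top _) (Lp.eLpNorm_ne_top _)]
  exact Lp.norm_fourier_eq g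

theorem enorm_fourier_le (f : ℝ → ℂ) (k : ℝ) : ‖𝓕 f k‖ₑ ≤ ∫⁻ x, ‖f x‖ₑ := by
  rw [Real.fourier_eq]
  refine (enorm_integral_le_lintegral_enorm _).trans (lintegral_mono fun x => ?_)
  rw [Circle.smul_def, smul_eq_mul, enorm_mul, ← ofReal_norm (_ : ℂ), Circle.norm_coe]
  simp


theorem fourier_sub_of_integrable {f g : ℝ → ℂ} (hf : Integrable f) (hg : Integrable g) (k : ℝ) :
    𝓕 (f - g) k = 𝓕 f k - 𝓕 g k := by
  simp only [Real.fourier_eq, Pi.sub_apply, smul_sub]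
  exact integral_sub ((Real.fourierIntegral_convergent_iff k).2 hf)
    ((Real.fourierIntegral_convergent_iff k).2 hg)

/-- The distributional estimate behind the interpolation between `L¹ → L^∞` and `L² → L²`. -/
theorem volume_lt_norm_fourier_le {f : ℝ → ℂ} (hfm : Measurable f) (hf : Integrable f) {p A t : ℝ}
    (hp : 1 < p) (hA : 0 < A) (hfA : ∫⁻ x, ENNReal.ofReal (‖f x‖ ^ p) ≤ ENNReal.ofReal A)
    (ht : 0 < t) :
    volume {k | t < ‖𝓕 f k‖} ≤
      ∫⁻ x, {x | t * ‖f x‖ ^ (p - 1) ≤ 2 * A}.indicator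
        (fun x => ENNReal.ofReal (4 / t ^ 2) * ENNReal.ofReal (‖f x‖ ^ 2)) x := by
  -- Off `S` one has `‖f‖ ≤ t / (2 * A) * ‖f‖ ^ p`, so the tall part of `f` has L¹ norm at most `t /
  -- 2`, and its transform never exceeds `t / 2`. The level set is then governed by the bounded part
  -- `f₂`, through Chebyshev and Plancherel.
  set S : Set ℝ := {x | t * ‖f x‖ ^ (p - 1) ≤ 2 * A} with hS
  have hSm : MeasurableSet S := by
    apply measurableSet_le _ measurable_const
    fun_prop
  set f₂ := S.indicator f with hf₂
  have hf₂i : Integrable f₂ := hf.indicator hSm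
  have hf₂L : MemLp f₂ 2 volume := by
    rw [memLp_two_iff_integrable_sq_norm hf₂i.aestronglyMeasurable]
    refine (hf.norm.const_mul ((2 * A / t) ^ (1 / (p - 1)))).mono'
      (hf₂i.norm.aestronglyMeasurable.pow 2) (ae_of_all _ fun x => ?_)
    by_cases hx : x ∈ S
    · rw [hf₂, indicator_of_mem hx, Real.norm_of_nonneg (by positivity), sq]
      gcongr
      have h₁ : ‖f x‖ ^ (p - 1) ≤ 2 * A / t := by
        rw [le_div_iff₀ ht, mul_comm]; exact hx
      calc ‖f x‖ = (‖f x‖ ^ (p - 1)) ^ (1 / (p - 1)) := by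
            rw [← Real.rpow_mul (norm_nonneg _), mul_one_div_cancel (by linarith), Real.rpow_one]
        _ ≤ _ := Real.rpow_le_rpow (by positivity) h₁ (by apply div_nonneg <;> linarith)
    · rw [hf₂, indicator_of_notMem hx]
      simp
      positivity
  have hf₁ : ∀ k, ‖𝓕 (f - f₂) k‖ ≤ t / 2 := by
    intro k
    have h₁ : ‖𝓕 (f - f₂) k‖ₑ ≤ ENNReal.ofReal (t / 2) := by
      refine (enorm_fourier_le _ k).trans ?_
      calc ∫⁻ x, ‖(f - f₂) x‖ₑ ≤ ∫⁻ x, ENNReal.ofReal (t / (2 * A)) * ENNReal.ofReal (‖f x‖ ^ p) := by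
            refine lintegral_mono fun x => ?_
            by_cases hx : x ∈ S
            · simp [hf₂, hx]
            · have hx' : 2 * A < t * ‖f x‖ ^ (p - 1) := not_le.1 hx
              have hfx : 0 < ‖f x‖ := by
                rcases (norm_nonneg (f x)).eq_or_lt with h | h
                · rw [← h, Real.zero_rpow (by linarith), mul_zero] at hx'
                  linarith
                · exact h
              rw [Pi.sub_apply, hf₂, indicator_of_notMem hx, sub_zero, ← ofReal_norm,
                ← ENNReal.ofReal_mul (by positivity)]
              refine ENNReal.ofReal_le_ofReal ?_
              have : ‖f x‖ ^ p = ‖f x‖ ^ (p - 1) * ‖f x‖ := by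
                rw [← Real.rpow_add_one hfx.ne']; ring_nf
              rw [this, div_mul_eq_mul_div, le_div_iff₀ (by positivity)]
              nlinarith
        _ = ENNReal.ofReal (t / (2 * A)) * ∫⁻ x, ENNReal.ofReal (‖f x‖ ^ p) :=
            lintegral_const_mul' _ _ ENNReal.ofReal_ne_top
        _ ≤ ENNReal.ofReal (t / (2 * A)) * ENNReal.ofReal A := by gcongr
        _ = _ := by
            rw [← ENNReal.ofReal_mul (by positivity)]
            congr 1
            field_simp
    rwa [← ofReal_norm, ENNReal.ofReal_le_ofReal_iff (by positivity)] at h₁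
  have hsub : {k | t < ‖𝓕 f k‖} ⊆ {k | ENNReal.ofReal (t ^ 2 / 4) ≤ ‖𝓕 f₂ k‖ₑ ^ (2 : ℝ)} := by
    intro k hk
    have h₁ := hf₁ k
    rw [fourier_sub_of_integrable hf hf₂i] at h₁
    have h₂ : t / 2 ≤ ‖𝓕 f₂ k‖ := by
      have := norm_sub_norm_le (𝓕 f k) (𝓕 f₂ k)
      have hk' : t < ‖𝓕 f k‖ := hk
      linarith
    have h₃ : ‖𝓕 f₂ k‖ₑ ^ (2 : ℝ) = ENNReal.ofReal (‖𝓕 f₂ k‖ ^ 2) := by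
      rw [← ofReal_norm, ENNReal.ofReal_rpow_of_nonneg (norm_nonneg _) (by norm_num)]
      norm_num
    rw [mem_ofPred_eq, h₃]
    refine ENNReal.ofReal_le_ofReal ?_
    nlinarith
  have hcont : Continuous (𝓕 f₂) :=
    VectorFourier.fourierIntegral_continuous Real.continuous_fourierChar
      (L := innerₗ ℝ) continuous_inner hf₂i
  have hpl := eLpNorm_fourier_two hf₂i hf₂L
  have hpl' : ∫⁻ k, ‖𝓕 f₂ k‖ₑ ^ (2 : ℝ) = ∫⁻ x, ‖f₂ x‖ₑ ^ (2 : ℝ) := by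
    rw [eLpNorm_eq_lintegral_rpow_enorm_toReal (by norm_num) (by norm_num),
      eLpNorm_eq_lintegral_rpow_enorm_toReal (by norm_num) (by norm_num)] at hpl
    exact ENNReal.rpow_left_injective (x := 1 / 2) (by norm_num) (by simpa using hpl)
  calc volume {k | t < ‖𝓕 f k‖}
      ≤ volume {k | ENNReal.ofReal (t ^ 2 / 4) ≤ ‖𝓕 f₂ k‖ₑ ^ (2 : ℝ)} := measure_mono hsub
    _ ≤ (∫⁻ k, ‖𝓕 f₂ k‖ₑ ^ (2 : ℝ)) / ENNReal.ofReal (t ^ 2 / 4) :=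
        meas_ge_le_lintegral_div (by fun_prop)
          (by rw [ne_eq, ENNReal.ofReal_eq_zero, not_le]; positivity) ENNReal.ofReal_ne_top
    _ = ENNReal.ofReal (4 / t ^ 2) * ∫⁻ x, ‖f₂ x‖ₑ ^ (2 : ℝ) := by
        rw [hpl', ENNReal.div_eq_inv_mul, ← ENNReal.ofReal_inv_of_pos (by positivity), inv_div]
    _ = ∫⁻ x, ENNReal.ofReal (4 / t ^ 2) * ‖f₂ x‖ₑ ^ (2 : ℝ) :=
        (lintegral_const_mul' _ _ ENNReal.ofReal_ne_top).symm
    _ ≤ _ := by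
        refine lintegral_mono fun x => ?_
        by_cases hx : x ∈ S
        · rw [hf₂, indicator_of_mem hx, indicator_of_mem hx, ← ofReal_norm,
            ENNReal.ofReal_rpow_of_nonneg (norm_nonneg _) (by norm_num)]
          norm_num
        · rw [hf₂, indicator_of_notMem hx]
          simp

/-- Layer cake and Tonelli: for fixed `x` the distributional bound is active for `t ≤ 2 * A / ‖f x‖
^ (p - 1)`, and `t ^ (q - 3)` is integrable at 0 because `q > 2`. The identity `(p - 1) * (q - 2) =
2 - p` turns the outcome into a multiple of `‖f x‖ ^ p`. -/
theorem lintegral_norm_fourier_rpow_le {f : ℝ → ℂ} (hfm : Measurable f) (hf : Integrable f)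
    {p q A : ℝ} (hp : 1 < p) (hp2 : p < 2) (hq : q = p / (p - 1)) (hA : 0 < A)
    (hfA : ∫⁻ x, ENNReal.ofReal (‖f x‖ ^ p) = ENNReal.ofReal A) :
    ∫⁻ k, ENNReal.ofReal (‖𝓕 f k‖ ^ q) ≤
      ENNReal.ofReal (q * (4 * 2 ^ (q - 2) / (q - 2)) * A ^ (q - 1)) := by
  have hp1 : 0 < p - 1 := by linarith
  have hq2 : 2 < q := by rw [hq, lt_div_iff₀ hp1]; linarith
  have hq1 : (p - 1) * (q - 2) = 2 - p := by rw [hq]; field_simp; ring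
  have hcont : Continuous (𝓕 f) :=
    VectorFourier.fourierIntegral_continuous Real.continuous_fourierChar
      (L := innerₗ ℝ) continuous_inner hf
  rw [lintegral_rpow_eq_lintegral_meas_lt_mul volume (ae_of_all _ fun k => norm_nonneg _)
    (by fun_prop) (by linarith)]
  have hinner : ∀ x, ∫⁻ t in Ioi (0 : ℝ), {x | t * ‖f x‖ ^ (p - 1) ≤ 2 * A}.indicator
        (fun x => ENNReal.ofReal (4 / t ^ 2) * ENNReal.ofReal (‖f x‖ ^ 2)) x *
        ENNReal.ofReal (t ^ (q - 1)) ≤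
      ENNReal.ofReal (4 * (2 * A) ^ (q - 2) / (q - 2)) * ENNReal.ofReal (‖f x‖ ^ p) := by
    intro x
    rcases (norm_nonneg (f x)).eq_or_lt with hfx | hfx
    · simp [indicator, ← hfx]
    set T : ℝ := 2 * A / ‖f x‖ ^ (p - 1) with hT
    have hT0 : 0 < T := by positivity
    calc _ = ∫⁻ t in Ioi (0 : ℝ), (Iic T).indicator
          (fun t => ENNReal.ofReal (4 * ‖f x‖ ^ 2 * t ^ (q - 3))) t := by
          refine setLIntegral_congr_fun measurableSet_Ioi fun t (ht : 0 < t) => ?_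
          have hiff : x ∈ {x | t * ‖f x‖ ^ (p - 1) ≤ 2 * A} ↔ t ∈ Iic T := by
            rw [mem_ofPred_eq, mem_Iic, hT, le_div_iff₀ (by positivity)]
          by_cases h : t ∈ Iic T
          · rw [indicator_of_mem h, indicator_of_mem (hiff.2 h), ← ENNReal.ofReal_mul (by positivity),
              ← ENNReal.ofReal_mul (by positivity)]
            congr 1
            have : t ^ (q - 1) = t ^ (q - 3) * t ^ 2 := by
              rw [← Real.rpow_natCast t 2, ← Real.rpow_add ht]
              norm_num
              ring_nf
            rw [this]
            field_simp
          · rw [indicator_of_notMem h, indicator_of_notMem (fun h' => h (hiff.1 h')), zero_mul]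
      _ = ∫⁻ t in Ioc 0 T, ENNReal.ofReal (4 * ‖f x‖ ^ 2 * t ^ (q - 3)) := by
          rw [setLIntegral_indicator measurableSet_Iic, Iic_inter_Ioi]
      _ = ENNReal.ofReal (∫ t in (0 : ℝ)..T, 4 * ‖f x‖ ^ 2 * t ^ (q - 3)) := by
          rw [intervalIntegral.integral_of_le hT0.le, ofReal_integral_eq_lintegral_ofReal]
          · exact ((intervalIntegral.intervalIntegrable_rpow' (by linarith)).const_mul _).1
          · rw [EventuallyLE, ae_restrict_iff' measurableSet_Ioc]
            refine ae_of_all _ fun t ht => ?_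
            have := ht.1
            simp only [Pi.zero_apply]
            positivity
      _ = ENNReal.ofReal (4 * (2 * A) ^ (q - 2) / (q - 2) * ‖f x‖ ^ p) := by
          rw [intervalIntegral.integral_const_mul, integral_rpow (Or.inl (by linarith))]
          congr 1
          rw [Real.zero_rpow (by linarith), sub_zero, show q - 3 + 1 = q - 2 by ring, hT,
            Real.div_rpow (by positivity) (by positivity), ← Real.rpow_mul hfx.le, hq1,
            ← Real.rpow_natCast ‖f x‖ 2]
          have : ‖f x‖ ^ p = ‖f x‖ ^ ((2 : ℕ) : ℝ) / ‖f x‖ ^ (2 - p) := by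
            rw [← Real.rpow_sub hfx]
            norm_num
          rw [this]
          ring
      _ ≤ _ := by
          rw [ENNReal.ofReal_mul]
          have : 0 < q - 2 := by linarith
          positivity
  calc _ ≤ ENNReal.ofReal q * ∫⁻ t in Ioi (0 : ℝ), ∫⁻ x,
        {x | t * ‖f x‖ ^ (p - 1) ≤ 2 * A}.indicator
        (fun x => ENNReal.ofReal (4 / t ^ 2) * ENNReal.ofReal (‖f x‖ ^ 2)) x *
        ENNReal.ofReal (t ^ (q - 1)) := by
        gcongr 1
        refine setLIntegral_mono' measurableSet_Ioi fun t (ht : 0 < t) => ?_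
        rw [lintegral_mul_const' _ _ ENNReal.ofReal_ne_top]
        gcongr
        exact volume_lt_norm_fourier_le hfm hf hp hA hfA.le ht
    _ = ENNReal.ofReal q * ∫⁻ x, ∫⁻ t in Ioi (0 : ℝ),
        {x | t * ‖f x‖ ^ (p - 1) ≤ 2 * A}.indicator
        (fun x => ENNReal.ofReal (4 / t ^ 2) * ENNReal.ofReal (‖f x‖ ^ 2)) x *
        ENNReal.ofReal (t ^ (q - 1)) := by
        congr 1
        refine lintegral_lintegral_swap (Measurable.aemeasurable ?_)
        have hset : MeasurableSet {P : ℝ × ℝ | P.1 * ‖f P.2‖ ^ (p - 1) ≤ 2 * A} := by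
          apply measurableSet_le _ measurable_const
          fun_prop
        have : (Function.uncurry fun (t x : ℝ) => {x | t * ‖f x‖ ^ (p - 1) ≤ 2 * A}.indicator
            (fun x => ENNReal.ofReal (4 / t ^ 2) * ENNReal.ofReal (‖f x‖ ^ 2)) x *
            ENNReal.ofReal (t ^ (q - 1))) = fun P : ℝ × ℝ =>
            {P : ℝ × ℝ | P.1 * ‖f P.2‖ ^ (p - 1) ≤ 2 * A}.indicator (fun P => 
            ENNReal.ofReal (4 / P.1 ^ 2) * ENNReal.ofReal (‖f P.2‖ ^ 2)) P *
            ENNReal.ofReal (P.1 ^ (q - 1)) := by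
          ext ⟨t, x⟩
          simp [Function.uncurry, indicator]
        rw [this]
        refine (Measurable.indicator ?_ hset).mul ?_ <;> fun_prop
    _ ≤ ENNReal.ofReal q * ∫⁻ x, ENNReal.ofReal (4 * (2 * A) ^ (q - 2) / (q - 2)) *
          ENNReal.ofReal (‖f x‖ ^ p) := by
        gcongr 1
        exact lintegral_mono hinner
    _ = ENNReal.ofReal q * (ENNReal.ofReal (4 * (2 * A) ^ (q - 2) / (q - 2)) *
          ENNReal.ofReal A) := by
        rw [lintegral_const_mul' _ _ ENNReal.ofReal_ne_top, hfA]
    _ = _ := by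
        have : 0 < q - 2 := by linarith
        rw [← ENNReal.ofReal_mul (by positivity), ← ENNReal.ofReal_mul (by linarith)]
        congr 1
        have hA1 : A ^ (q - 1) = A ^ (q - 2) * A := by
          rw [← Real.rpow_add_one hA.ne']; ring_nf
        rw [Real.mul_rpow (by norm_num) hA.le, hA1]
        ring

end HausdorffYoung

section HausdorffYoungENNReal

open FourierTransform

/-- The Hausdorff–Young inequality, with an unspecified constant. -/
theorem exists_eLpNorm_fourier_le {p p' : ℝ≥0∞} (hp1 : 1 ≤ p) (hp2 : p < 2)
    (hpp' : p.HolderConjugate p') :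
    ∃ C : ℝ≥0, ∀ f : ℝ → ℂ, Integrable f → MemLp f p volume →
      eLpNorm (𝓕 f) p' volume ≤ C * eLpNorm f p volume := by
  have hptop : p ≠ ⊤ := (hp2.trans (by norm_num)).ne
  rcases hp1.eq_or_lt with h1 | h1
  · refine ⟨1, fun f hf _ => ?_⟩
    have hp' : p' = ⊤ := by
      rw [ENNReal.HolderConjugate.conj_eq (p := p) (q := p'), ← h1]
      simp
    rw [hp', ← h1, ENNReal.coe_one, one_mul, eLpNorm_one_eq_lintegral_enorm]
    exact eLpNormEssSup_le_of_ae_enorm_bound (ae_of_all _ (enorm_fourier_le f))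
  · set P := p.toReal with hP
    have hpP : p = ENNReal.ofReal P := (ENNReal.ofReal_toReal hptop).symm
    have hP1 : 1 < P := by
      rwa [hpP, ← ENNReal.ofReal_one, ENNReal.ofReal_lt_ofReal_iff_of_nonneg zero_le_one] at h1
    have hP2 : P < 2 := by
      rwa [hpP, show (2 : ℝ≥0∞) = ENNReal.ofReal 2 by norm_num,
        ENNReal.ofReal_lt_ofReal_iff (by norm_num)] at hp2
    have hconj := ENNReal.HolderConjugate.toReal (p := p) (q := p') hP1
    set Q := p'.toReal with hQ
    have hQeq : Q = P / (P - 1) := hconj.conjugate_eq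
    have hP1' : 0 < P - 1 := by linarith
    have hQ2 : 2 < Q := by rw [hQeq, lt_div_iff₀ hP1']; linarith
    have hp'0 : p' ≠ 0 := fun h => by rw [hQ, h] at hQ2; simp at hQ2; linarith
    have hp't : p' ≠ ⊤ := fun h => by rw [hQ, h] at hQ2; simp at hQ2; linarith
    have hp0 : p ≠ 0 := (zero_lt_one.trans h1).ne'
    refine ⟨((Q * (4 * 2 ^ (Q - 2) / (Q - 2))) ^ (1 / Q)).toNNReal, fun f hf hfp => ?_⟩
    obtain ⟨g, hg, hfg⟩ := hf.aestronglyMeasurable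
    have hgi : Integrable g := hf.congr hfg
    have hFg : 𝓕 f = 𝓕 g := by
      ext k
      rw [Real.fourier_eq, Real.fourier_eq]
      refine integral_congr_ae ?_
      filter_upwards [hfg] with x hx
      rw [hx]
    rw [hFg, eLpNorm_congr_ae hfg]
    have hgp : MemLp g p volume := hfp.ae_eq hfg
    rw [eLpNorm_eq_lintegral_rpow_enorm_toReal hp0 hptop,
      eLpNorm_eq_lintegral_rpow_enorm_toReal hp'0 hp't, ← hP, ← hQ]
    have conv : ∀ (u : ℝ → ℂ) {s : ℝ}, 0 ≤ s →
        ∫⁻ x, ‖u x‖ₑ ^ s = ∫⁻ x, ENNReal.ofReal (‖u x‖ ^ s) := fun u s hs => by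
      refine lintegral_congr fun x => ?_
      rw [← ofReal_norm, ENNReal.ofReal_rpow_of_nonneg (norm_nonneg _) hs]
    have hfin : ∫⁻ x, ‖g x‖ₑ ^ P ≠ ⊤ := by
      have := lintegral_rpow_enorm_lt_top_of_eLpNorm_lt_top hp0 hptop hgp.2
      exact this.ne
    rcases eq_or_ne (∫⁻ x, ‖g x‖ₑ ^ P) 0 with h0 | h0
    · have hg0 : ∀ᵐ x, g x = 0 := by
        rw [lintegral_eq_zero_iff (by have := hg.measurable; fun_prop)] at h0
        filter_upwards [h0] with x hx
        simpa [show ¬ P < 0 by linarith, show 0 < P by linarith] using hx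
      have : ∀ k, 𝓕 g k = 0 := fun k => by
        rw [Real.fourier_eq, integral_eq_zero_of_ae]
        filter_upwards [hg0] with x hx
        simp [hx]
      simp [this, show 0 < Q by linarith]
    · set A := (∫⁻ x, ‖g x‖ₑ ^ P).toReal with hAdef
      have hA : 0 < A := ENNReal.toReal_pos h0 hfin
      have hAeq : ∫⁻ x, ‖g x‖ₑ ^ P = ENNReal.ofReal A := (ENNReal.ofReal_toReal hfin).symm
      have key := lintegral_norm_fourier_rpow_le hg.measurable hgi hP1 hP2 hQeq hA
        (by rw [← conv g (by linarith), hAeq])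
      rw [← conv _ (by linarith)] at key
      have hc : 0 ≤ Q * (4 * 2 ^ (Q - 2) / (Q - 2)) := by
        have : 0 < Q - 2 := by linarith
        positivity
      calc _ ≤ ENNReal.ofReal (Q * (4 * 2 ^ (Q - 2) / (Q - 2)) * A ^ (Q - 1)) ^ (1 / Q) := by
            have : 0 ≤ 1 / Q := by positivity
            gcongr
        _ = ENNReal.ofReal ((Q * (4 * 2 ^ (Q - 2) / (Q - 2))) ^ (1 / Q) * A ^ (1 / P)) := by
            rw [ENNReal.ofReal_rpow_of_nonneg (by positivity) (by positivity),
              Real.mul_rpow hc (by positivity), ← Real.rpow_mul hA.le]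
            congr 3
            rw [hQeq]
            field_simp
            ring
        _ = _ := by
            rw [ENNReal.ofReal_mul (by positivity), hAeq,
              ENNReal.ofReal_rpow_of_nonneg hA.le (by positivity)]
            rfl

end HausdorffYoungENNReal

/-! ### The variation functional: superadditivity and ℓ^ρ inequalities. -/

section Variation

variable {G : Type*}

/-- The supremum of the sums `∑ d(γ(t_{j+1}), γ(t_j))^r`, that is, the `r`-th power of the
`r`-variation. -/
noncomputable def powVariationOn (d : G → G → ℝ≥0∞) (r : ℝ) (γ : ℝ → G) (S : Set ℝ) : ℝ≥0∞ :=
  ⨆ (n : ℕ) (t : ℕ → ℝ) (_ : Monotone t) (_ : ∀ j, t j ∈ S),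
    ∑ j ∈ Finset.range n, d (γ (t (j + 1))) (γ (t j)) ^ r

variable {d : G → G → ℝ≥0∞} {r : ℝ} {γ : ℝ → G} {S T : Set ℝ}

/-- The power `1 / r` is an order isomorphism of `ℝ≥0∞`, so it commutes with suprema. -/
theorem rVariationOn_eq_rpow (hr : 0 < r) :
    rVariationOn d r γ S = powVariationOn d r γ S ^ (1 / r) := by
  have h : ∀ x : ℝ≥0∞, x ^ (1 / r) = ENNReal.orderIsoRpow (1 / r) (by positivity) x := fun x => rfl
  simp only [rVariationOn, powVariationOn, h, OrderIso.map_iSup]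

theorem rVariationOn_rpow (hr : 0 < r) : rVariationOn d r γ S ^ r = powVariationOn d r γ S := by
  rw [rVariationOn_eq_rpow hr, ← ENNReal.rpow_mul, one_div_mul_cancel hr.ne', ENNReal.rpow_one]

theorem sum_le_powVariationOn {t : ℕ → ℝ} (ht : Monotone t) (htS : ∀ j, t j ∈ S) (n : ℕ) :
    ∑ j ∈ Finset.range n, d (γ (t (j + 1))) (γ (t j)) ^ r ≤ powVariationOn d r γ S :=
  le_iSup_of_le n (le_iSup_of_le t (le_iSup_of_le ht (le_iSup_of_le htS le_rfl)))

theorem powVariationOn_le {B : ℝ≥0∞}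
    (h : ∀ (n : ℕ) (t : ℕ → ℝ), Monotone t → (∀ j, t j ∈ S) →
      ∑ j ∈ Finset.range n, d (γ (t (j + 1))) (γ (t j)) ^ r ≤ B) : powVariationOn d r γ S ≤ B :=
  iSup_le fun n => iSup_le fun t => iSup_le fun ht => iSup_le fun htS => h n t ht htS

theorem rVariationOn_le {B : ℝ≥0∞}
    (h : ∀ (n : ℕ) (t : ℕ → ℝ), Monotone t → (∀ j, t j ∈ S) →
      (∑ j ∈ Finset.range n, d (γ (t (j + 1))) (γ (t j)) ^ r) ^ (1 / r) ≤ B) :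
    rVariationOn d r γ S ≤ B :=
  iSup_le fun n => iSup_le fun t => iSup_le fun ht => iSup_le fun htS => h n t ht htS

theorem le_rVariationOn {t : ℕ → ℝ} (ht : Monotone t) (htS : ∀ j, t j ∈ S) (n : ℕ) :
    (∑ j ∈ Finset.range n, d (γ (t (j + 1))) (γ (t j)) ^ r) ^ (1 / r) ≤ rVariationOn d r γ S :=
  le_iSup_of_le n (le_iSup_of_le t (le_iSup_of_le ht (le_iSup_of_le htS le_rfl)))

theorem powVariationOn_mono (h : S ⊆ T) : powVariationOn d r γ S ≤ powVariationOn d r γ T :=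
  powVariationOn_le fun n _ ht htS => sum_le_powVariationOn ht (fun j => h (htS j)) n

theorem rVariationOn_mono (h : S ⊆ T) : rVariationOn d r γ S ≤ rVariationOn d r γ T :=
  rVariationOn_le fun n _ ht htS => le_rVariationOn ht (fun j => h (htS j)) n

theorem rVariationOn_empty : rVariationOn d r γ ∅ = 0 :=
  le_antisymm (rVariationOn_le fun _ _ _ htS => (htS 0).elim) bot_le

theorem rpow_le_powVariationOn {s u : ℝ} (hsu : s ≤ u) (hs : s ∈ S) (hu : u ∈ S) :
    d (γ u) (γ s) ^ r ≤ powVariationOn d r γ S := by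
  have := sum_le_powVariationOn (d := d) (r := r) (γ := γ) (S := S)
    (t := fun j => if j = 0 then s else u)
    (by intro i j hij; dsimp only; split_ifs <;> first | exact le_rfl | exact hsu | omega)
    (by intro j; split_ifs <;> assumption) 1
  simpa using this

theorem powVariationOn_eq_iSup : powVariationOn d r γ S =
    ⨆ P : ℕ × {t : ℕ → ℝ // Monotone t ∧ ∀ j, t j ∈ S},
      ∑ j ∈ Finset.range P.1, d (γ (P.2.1 (j + 1))) (γ (P.2.1 j)) ^ r := by
  refine le_antisymm (powVariationOn_le fun n t ht htS => ?_)
    (iSup_le fun P => sum_le_powVariationOn P.2.2.1 P.2.2.2 P.1)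
  exact le_iSup (fun P : ℕ × {t : ℕ → ℝ // Monotone t ∧ ∀ j, t j ∈ S} =>
    ∑ j ∈ Finset.range P.1, d (γ (P.2.1 (j + 1))) (γ (P.2.1 j)) ^ r) ⟨n, t, ht, htS⟩

/-- Partitions of `S` and of `T` concatenate to one of the union. This superadditivity is what makes
the `r`-th power of the variation a control in the sense of Young. -/
theorem powVariationOn_add_le {m : ℝ} (hS : ∀ x ∈ S, x ≤ m) (hT : ∀ x ∈ T, m ≤ x)
    (hSne : S.Nonempty) (hTne : T.Nonempty) :
    powVariationOn d r γ S + powVariationOn d r γ T ≤ powVariationOn d r γ (S ∪ T) := by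
  have key : ∀ (n : ℕ) (t : ℕ → ℝ), Monotone t → (∀ j, t j ∈ S) → ∀ (n' : ℕ) (t' : ℕ → ℝ),
      Monotone t' → (∀ j, t' j ∈ T) →
      (∑ j ∈ Finset.range n, d (γ (t (j + 1))) (γ (t j)) ^ r) +
        ∑ j ∈ Finset.range n', d (γ (t' (j + 1))) (γ (t' j)) ^ r ≤
      powVariationOn d r γ (S ∪ T) := by
    intro n t ht htS n' t' ht' htT
    -- Entries `0` to `n` are those of `t`; the summand of index `n` is the jump from `t n` to `t'
    -- 0`, which is dropped.
    set τ : ℕ → ℝ := fun j => if j ≤ n then t j else t' (j - (n + 1)) with hτ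
    have hmono : Monotone τ := by
      intro i j hij
      simp only [hτ]
      split_ifs with h₁ h₂ h₂
      · exact ht hij
      · exact (hS _ (htS i)).trans (hT _ (htT _))
      · omega
      · exact ht' (by omega)
    have hmem : ∀ j, τ j ∈ S ∪ T := by
      intro j
      simp only [hτ]
      split_ifs
      · exact Or.inl (htS j)
      · exact Or.inr (htT _)
    refine le_trans ?_ (sum_le_powVariationOn hmono hmem (n + 1 + n'))
    rw [Finset.sum_range_add, Finset.sum_range_succ]
    refine add_le_add (le_add_right (Finset.sum_le_sum fun j hj => ?_))
      (Finset.sum_le_sum fun j hj => ?_)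
    · rw [Finset.mem_range] at hj
      simp [hτ, hj.le, Nat.succ_le_of_lt hj]
    · have e₁ : ¬ (n + 1 + j ≤ n) := by omega
      have e₂ : ¬ (n + 1 + j + 1 ≤ n) := by omega
      have e₃ : n + 1 + j + 1 - (n + 1) = j + 1 := by omega
      have e₄ : n + 1 + j - (n + 1) = j := by omega
      simp only [hτ, e₁, e₂, e₃, e₄, if_false]
      exact le_rfl
  obtain ⟨x₀, hx₀⟩ := hSne
  obtain ⟨z₀, hz₀⟩ := hTne
  have : Nonempty (ℕ × {t : ℕ → ℝ // Monotone t ∧ ∀ j, t j ∈ S}) :=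
    ⟨0, fun _ => x₀, monotone_const, fun _ => hx₀⟩
  have : Nonempty (ℕ × {t : ℕ → ℝ // Monotone t ∧ ∀ j, t j ∈ T}) :=
    ⟨0, fun _ => z₀, monotone_const, fun _ => hz₀⟩
  rw [powVariationOn_eq_iSup (S := S), powVariationOn_eq_iSup (S := T)]
  exact ENNReal.iSup_add_iSup_le fun P P' => key _ _ P.2.2.1 P.2.2.2 _ _ P'.2.2.1 P'.2.2.2

theorem sum_powVariationOn_Icc_le {t : ℕ → ℝ} (ht : Monotone t) (n : ℕ) :
    ∑ j ∈ Finset.range n, powVariationOn d r γ (Icc (t j) (t (j + 1))) ≤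
      powVariationOn d r γ (Icc (t 0) (t n)) := by
  induction n with
  | zero => simp
  | succ n ih =>
    rw [Finset.sum_range_succ]
    refine (add_le_add_left ih _).trans ?_
    rw [← Icc_union_Icc_eq_Icc (ht (Nat.zero_le n)) (ht n.le_succ)]
    exact powVariationOn_add_le (m := t n) (fun x hx => hx.2) (fun x hx => hx.1)
      ⟨t n, ht (Nat.zero_le n), le_rfl⟩ ⟨t n, le_rfl, ht n.le_succ⟩

/-- Each term is at most the ℓ^ρ norm `A`, so `a i ^ r ≤ a i ^ ρ * A ^ (r - ρ)`. -/
theorem rpow_sum_le_rpow_sum {ι : Type*} (s : Finset ι) (a : ι → ℝ≥0∞) {ρ r : ℝ} (hρ : 0 < ρ)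
    (hρr : ρ ≤ r) : (∑ i ∈ s, a i ^ r) ^ (1 / r) ≤ (∑ i ∈ s, a i ^ ρ) ^ (1 / ρ) := by
  set A := (∑ i ∈ s, a i ^ ρ) ^ (1 / ρ) with hA
  have hr : 0 < r := hρ.trans_le hρr
  have hAρ : ∑ i ∈ s, a i ^ ρ = A ^ ρ := by
    rw [hA, ← ENNReal.rpow_mul, one_div_mul_cancel hρ.ne', ENNReal.rpow_one]
  have hle : ∀ i ∈ s, a i ≤ A := fun i hi => by
    rw [← ENNReal.rpow_le_rpow_iff hρ, ← hAρ]
    exact Finset.single_le_sum (f := fun i => a i ^ ρ) (fun _ _ => bot_le) hi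
  calc (∑ i ∈ s, a i ^ r) ^ (1 / r) ≤ (∑ i ∈ s, a i ^ ρ * A ^ (r - ρ)) ^ (1 / r) := by
        gcongr with i hi
        calc a i ^ r = a i ^ ρ * a i ^ (r - ρ) := by
              rw [← ENNReal.rpow_add_of_nonneg _ _ hρ.le (by linarith)]; ring_nf
          _ ≤ _ := by
              gcongr
              exact hle i hi
    _ = A := by
        rw [← Finset.sum_mul, hAρ, ← ENNReal.rpow_add_of_nonneg _ _ hρ.le (by linarith),
          ← ENNReal.rpow_mul, show (ρ + (r - ρ)) * (1 / r) = 1 by field_simp; ring,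
          ENNReal.rpow_one]

/-- A function which factors monotonically through finitely many values has its variation bounded
by the `ℓ^ρ` norm of the values. -/
theorem rpow_sum_sub_le {ρ : ℝ} (hρ : 1 ≤ ρ) (h : ℕ → ℂ) {m : ℕ → ℕ} (hm : Monotone m) {M : ℕ}
    (hM : ∀ l, m l < M) (n : ℕ) :
    (∑ l ∈ Finset.range n, edist (h (m (l + 1))) (h (m l)) ^ ρ) ^ (1 / ρ) ≤
      2 * (∑ i ∈ Finset.range M, ‖h i‖ₑ ^ ρ) ^ (1 / ρ) := by
  have hρ0 : 0 < ρ := by linarith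
  -- Indices with `m l = m (l + 1)` contribute nothing. On the others `m l` and `m (l + 1)` are both
  -- strictly increasing in `l`, so each value of `h` occurs at most once as a left end and once as
  -- a right end; this is the factor 2.
  set I := (Finset.range n).filter fun l => m l ≠ m (l + 1) with hI
  have hIlt : ∀ l ∈ I, m l < m (l + 1) := fun l hl =>
    lt_of_le_of_ne (hm l.le_succ) (Finset.mem_filter.1 hl).2
  have hsum : ∑ l ∈ Finset.range n, edist (h (m (l + 1))) (h (m l)) ^ ρ =
      ∑ l ∈ I, edist (h (m (l + 1))) (h (m l)) ^ ρ := by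
    refine (Finset.sum_subset (Finset.filter_subset _ _) fun l hl hl' => ?_).symm
    have : m l = m (l + 1) := by
      by_contra hne
      exact hl' (Finset.mem_filter.2 ⟨hl, hne⟩)
    simp [this, hρ0]
  have hinj : ∀ e : ℕ → ℕ, (∀ l, e l < M) → InjOn e I →
      ∑ l ∈ I, ‖h (e l)‖ₑ ^ ρ ≤ ∑ i ∈ Finset.range M, ‖h i‖ₑ ^ ρ := by
    intro e he hinj
    rw [← Finset.sum_image (f := fun i => ‖h i‖ₑ ^ ρ) hinj]
    refine Finset.sum_le_sum_of_subset fun i hi => ?_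
    obtain ⟨l, _, rfl⟩ := Finset.mem_image.1 hi
    exact Finset.mem_range.2 (he l)
  have i₁ : InjOn (fun l => m (l + 1)) I := by
    have : StrictMonoOn (fun l => m (l + 1)) I := fun l _ l' hl' hll =>
      (hm (Nat.succ_le_of_lt hll)).trans_lt (hIlt l' hl')
    exact this.injOn
  have i₂ : InjOn m I := by
    have : StrictMonoOn m I := fun l hl l' _ hll =>
      (hIlt l hl).trans_le (hm (Nat.succ_le_of_lt hll))
    exact this.injOn
  rw [hsum]
  calc _ ≤ (∑ l ∈ I, (‖h (m (l + 1))‖ₑ + ‖h (m l)‖ₑ) ^ ρ) ^ (1 / ρ) := by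
        gcongr with l hl
        rw [edist_eq_enorm_sub]
        exact enorm_sub_le
    _ ≤ (∑ l ∈ I, ‖h (m (l + 1))‖ₑ ^ ρ) ^ (1 / ρ) + (∑ l ∈ I, ‖h (m l)‖ₑ ^ ρ) ^ (1 / ρ) :=
        ENNReal.Lp_add_le _ _ _ hρ
    _ ≤ _ := by
        rw [two_mul]
        gcongr
        · exact hinj _ (fun l => hM _) i₁
        · exact hinj _ hM i₂

end Variation

/-! ### L^q norms of suprema, series and ℓ^ρ sums. -/

section Integrals

variable {α : Type*} [MeasurableSpace α] {μ : Measure α}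

theorem eLpNorm_iSup_le {g : ℕ → α → ℝ≥0∞} (hg : ∀ n, AEMeasurable (g n) μ)
    (hmono : ∀ x, Monotone fun n => g n x) {q B : ℝ≥0∞} (hB : ∀ n, eLpNorm (g n) q μ ≤ B) :
    eLpNorm (fun x => ⨆ n, g n x) q μ ≤ B := by
  rcases eq_or_ne q 0 with rfl | hq0
  · simp
  rcases eq_or_ne q ⊤ with rfl | hqt
  · simp only [eLpNorm_exponent_top] at hB ⊢
    refine eLpNormEssSup_le_of_ae_enorm_bound ?_
    have : ∀ᵐ x ∂μ, ∀ n, ‖g n x‖ₑ ≤ B := ae_all_iff.2 fun n =>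
      (ae_le_eLpNormEssSup (f := g n)).mono fun x hx => hx.trans (hB n)
    filter_upwards [this] with x hx
    simpa [enorm_eq_self] using hx
  · have hq : 0 < q.toReal := ENNReal.toReal_pos hq0 hqt
    simp only [eLpNorm_eq_lintegral_rpow_enorm_toReal hq0 hqt, enorm_eq_self] at hB ⊢
    have h₁ : ∀ x, (⨆ n, g n x) ^ q.toReal = ⨆ n, g n x ^ q.toReal := fun x =>
      (ENNReal.orderIsoRpow q.toReal hq).map_iSup _
    simp only [h₁]
    rw [lintegral_iSup' (fun n => (hg n).pow_const _)
      (ae_of_all _ fun x i j hij => ENNReal.rpow_le_rpow (hmono x hij) hq.le)]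
    have h₂ : (⨆ n, ∫⁻ x, g n x ^ q.toReal ∂μ) ^ (1 / q.toReal) =
        ⨆ n, (∫⁻ x, g n x ^ q.toReal ∂μ) ^ (1 / q.toReal) :=
      (ENNReal.orderIsoRpow (1 / q.toReal) (by positivity)).map_iSup _
    rw [h₂]
    exact iSup_le hB

theorem eLpNorm_tsum_le {g : ℕ → α → ℝ≥0∞} (hg : ∀ n, AEMeasurable (g n) μ) {q : ℝ≥0∞}
    (hq : 1 ≤ q) : eLpNorm (fun x => ∑' n, g n x) q μ ≤ ∑' n, eLpNorm (g n) q μ := by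
  simp only [ENNReal.tsum_eq_iSup_nat (f := fun n => g n _)]
  refine eLpNorm_iSup_le (fun n => Finset.aemeasurable_fun_sum _ fun i _ => hg i)
    (fun x i j hij => Finset.sum_le_sum_of_subset (Finset.range_subset_range.2 hij)) fun n => ?_
  have := eLpNorm_sum_le (f := g) (s := Finset.range n) (μ := μ) (p := q)
    (fun i _ => (hg i).aestronglyMeasurable) hq
  refine le_trans (le_of_eq ?_) (this.trans (ENNReal.sum_le_tsum _))
  congr 1
  ext x
  simp

theorem eLpNorm_rpow_of_pos (u : α → ℝ≥0∞) {s : ℝ} (hs : 0 < s) (q : ℝ≥0∞) :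
    eLpNorm (fun x => u x ^ s) q μ = eLpNorm u (q * ENNReal.ofReal s) μ ^ s := by
  simpa [enorm_eq_self] using eLpNorm_enorm_rpow (μ := μ) (p := q) u hs

/-- Minkowski's inequality for mixed norms. -/
theorem eLpNorm_rpow_sum_le {ι : Type*} (s : Finset ι) {u : ι → α → ℝ≥0∞}
    (hu : ∀ i ∈ s, AEMeasurable (u i) μ) {ρ : ℝ} (hρ : 0 < ρ) {q : ℝ≥0∞}
    (hq : ENNReal.ofReal ρ ≤ q) :
    eLpNorm (fun x => (∑ i ∈ s, u i x ^ ρ) ^ (1 / ρ)) q μ ≤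
      (∑ i ∈ s, eLpNorm (u i) q μ ^ ρ) ^ (1 / ρ) := by
  have hρ' : ENNReal.ofReal ρ ≠ 0 := by simpa using hρ
  have hmul : q * ENNReal.ofReal (1 / ρ) * ENNReal.ofReal ρ = q := by
    rw [mul_assoc, ← ENNReal.ofReal_mul (by positivity), one_div_mul_cancel hρ.ne']
    simp
  rw [eLpNorm_rpow_of_pos _ (by positivity)]
  gcongr
  -- As ρ ≤ `q`, the exponent `q`/ρ is at least 1, and the claim is the triangle inequality in that
  -- space for the functions `u i ^ ρ`.
  have hone : 1 ≤ q * ENNReal.ofReal (1 / ρ) := by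
    rw [one_div, ENNReal.ofReal_inv_of_pos hρ, ← div_eq_mul_inv,
      ENNReal.le_div_iff_mul_le (Or.inl hρ') (Or.inl ENNReal.ofReal_ne_top), one_mul]
    exact hq
  have := eLpNorm_sum_le (f := fun i x => u i x ^ ρ) (s := s) (μ := μ)
    (fun i hi => ((hu i hi).pow_const ρ).aestronglyMeasurable) hone
  refine le_trans (le_of_eq ?_) (this.trans (Finset.sum_le_sum fun i _ => ?_))
  · congr 1
    ext x
    simp
  · rw [eLpNorm_rpow_of_pos _ hρ, hmul]

end Integrals

/-! ### The linear variational Christ–Kiselev estimate. -/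

section ChristKiselev

/-- The increments of `Y` between consecutive dyadic points, at scale `n`. -/
noncomputable def dyadicIncr (Y : ℝ → ℂ) : ℕ → ℕ → ℂ
  | 0, m => Y m - Y 0
  | n + 1, m => Y (m / 2 ^ (n + 1)) - Y ((m / 2 : ℕ) / 2 ^ n)

/-- Integer division of `⌊2 ^ (N + 1) * θ⌋₊` by 2 gives `⌊2 ^ N * θ⌋₊`: each dyadic truncation of
`θ` is the parent of the next. -/
theorem dyadic_telescope (Y : ℝ → ℂ) (θ : ℝ) (N : ℕ) :
    Y ((⌊2 ^ N * θ⌋₊ : ℝ) / 2 ^ N) =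
      Y 0 + ∑ n ∈ Finset.range (N + 1), dyadicIncr Y n ⌊2 ^ n * θ⌋₊ := by
  induction N with
  | zero => simp [dyadicIncr]
  | succ N ih =>
    rw [Finset.sum_range_succ, ← add_assoc, ← ih, dyadicIncr]
    have : ⌊(2 : ℝ) ^ (N + 1) * θ⌋₊ / 2 = ⌊(2 : ℝ) ^ N * θ⌋₊ := by
      rw [← Nat.floor_div_ofNat]
      congr 1
      rw [pow_succ]
      ring
    rw [this]
    ring

/-- The `ρ`-variation is controlled by the dyadic increments along a monotone change of variable. -/
theorem rVariationOn_le_tsum_dyadic {ρ : ℝ} (hρ : 1 ≤ ρ) {X : ℝ → ℂ} {F Q : ℝ → ℝ}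
    (hF : Monotone F) (hF0 : ∀ x, 0 ≤ F x) (hF1 : ∀ x, F x ≤ 1)
    (hlim : ∀ x, Tendsto (fun N : ℕ => X (Q ((⌊2 ^ N * F x⌋₊ : ℝ) / 2 ^ N))) atTop (𝓝 (X x))) :
    rVariationOn edist ρ X univ ≤ ∑' n, 2 * (∑ m ∈ Finset.range (2 ^ n + 1),
      ‖dyadicIncr (X ∘ Q) n m‖ₑ ^ ρ) ^ (1 / ρ) := by
  have hρ0 : 0 < ρ := by linarith
  refine rVariationOn_le fun l t ht _ => ?_
  -- At finite depth the values telescope over the scales and Minkowski separates the scales. At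
  -- each scale the dyadic index is monotone along the partition, so `rpow_sum_sub_le` applies.
  have hfin : ∀ N : ℕ, (∑ j ∈ Finset.range l,
      edist (X (Q ((⌊2 ^ N * F (t (j + 1))⌋₊ : ℝ) / 2 ^ N)))
        (X (Q ((⌊2 ^ N * F (t j)⌋₊ : ℝ) / 2 ^ N))) ^ ρ) ^ (1 / ρ) ≤
      ∑' n, 2 * (∑ m ∈ Finset.range (2 ^ n + 1), ‖dyadicIncr (X ∘ Q) n m‖ₑ ^ ρ) ^ (1 / ρ) := by
    intro N
    refine le_trans ?_ (ENNReal.sum_le_tsum (Finset.range (N + 1)))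
    have htel : ∀ x, X (Q ((⌊2 ^ N * F x⌋₊ : ℝ) / 2 ^ N)) = (X ∘ Q) 0 +
        ∑ n ∈ Finset.range (N + 1), dyadicIncr (X ∘ Q) n ⌊2 ^ n * F x⌋₊ :=
      fun x => dyadic_telescope (X ∘ Q) (F x) N
    simp only [htel, edist_add_left]
    generalize N + 1 = K
    induction K with
    | zero => simp [hρ0]
    | succ K ih =>
      simp only [Finset.sum_range_succ (fun n => dyadicIncr (X ∘ Q) n _)]
      rw [Finset.sum_range_succ _ K]
      calc _ ≤ (∑ j ∈ Finset.range l,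
            (edist (∑ n ∈ Finset.range K, dyadicIncr (X ∘ Q) n ⌊2 ^ n * F (t (j + 1))⌋₊)
              (∑ n ∈ Finset.range K, dyadicIncr (X ∘ Q) n ⌊2 ^ n * F (t j)⌋₊) +
            edist (dyadicIncr (X ∘ Q) K ⌊2 ^ K * F (t (j + 1))⌋₊)
              (dyadicIncr (X ∘ Q) K ⌊2 ^ K * F (t j)⌋₊)) ^ ρ) ^ (1 / ρ) := by
            gcongr with j _
            exact edist_add_add_le _ _ _ _
        _ ≤ _ := ENNReal.Lp_add_le _ _ _ hρ
        _ ≤ _ := by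
            refine add_le_add ih ?_
            refine rpow_sum_sub_le hρ _ (m := fun j => ⌊2 ^ K * F (t j)⌋₊) ?_ (fun j => ?_) l
            · intro i j hij
              exact Nat.floor_mono (by gcongr; exact hF (ht hij))
            -- `F` may equal 1, which gives the index `2 ^ K`; hence ranges of length `2 ^ K + 1`.
            · refine Nat.lt_succ_of_le (Nat.floor_le_of_le ?_)
              push_cast
              exact mul_le_of_le_one_right (by positivity) (hF1 _)
  refine le_of_tendsto (x := atTop) ?_ (Eventually.of_forall hfin)
  refine (ENNReal.continuous_rpow_const.tendsto _).comp (tendsto_finsetSum _ fun j _ => ?_)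
  exact (ENNReal.continuous_rpow_const.tendsto _).comp ((hlim _).edist (hlim _))

open FourierTransform

/-- The modulation `e^{-2πikx} f(x)`. -/
noncomputable def modulate (f : ℝ → ℂ) (k x : ℝ) : ℂ :=
  Complex.exp (-(2 * Real.pi * k * x : ℝ) * Complex.I) * f x

theorem norm_modulate (f : ℝ → ℂ) (k x : ℝ) : ‖modulate f k x‖ = ‖f x‖ := by
  rw [modulate, norm_mul, ← Complex.ofReal_neg, Complex.norm_exp_ofReal_mul_I, one_mul]

theorem continuous_modulate_left (f : ℝ → ℂ) (x : ℝ) : Continuous fun k => modulate f k x := by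
  unfold modulate
  fun_prop

theorem aestronglyMeasurable_modulate {f : ℝ → ℂ} {μ : Measure ℝ} (hf : AEStronglyMeasurable f μ)
    (k : ℝ) : AEStronglyMeasurable (modulate f k) μ := by
  refine AEStronglyMeasurable.mul ?_ hf
  exact Continuous.aestronglyMeasurable (by fun_prop)

theorem integrable_modulate {f : ℝ → ℂ} {μ : Measure ℝ} (hf : Integrable f μ) (k : ℝ) :
    Integrable (modulate f k) μ :=
  hf.mono (aestronglyMeasurable_modulate hf.1 k) (ae_of_all _ fun x => (norm_modulate f k x).le)

theorem modulate_indicator (f : ℝ → ℂ) (S : Set ℝ) (k : ℝ) :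
    modulate (S.indicator f) k = S.indicator (modulate f k) := by
  ext x
  by_cases hx : x ∈ S <;> simp [modulate, hx]

theorem integral_modulate (f : ℝ → ℂ) (k : ℝ) : ∫ x, modulate f k x = 𝓕 f k := by
  rw [Real.fourier_eq']
  refine integral_congr_ae (ae_of_all _ fun x => ?_)
  simp only [modulate, smul_eq_mul, RCLike.inner_apply, conj_trivial]
  congr 2
  push_cast
  ring

/-- The primitive of the modulated function. -/
noncomputable def partialFourier (f : ℝ → ℂ) (k x : ℝ) : ℂ := ∫ t in (0 : ℝ)..x, modulate f k t

theorem continuous_partialFourier {f : ℝ → ℂ} (hf : ∀ a b, IntervalIntegrable f volume a b) :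
    Continuous fun P : ℝ × ℝ => partialFourier f P.1 P.2 := by
  rw [continuous_iff_continuousAt]
  rintro ⟨k₀, x₀⟩
  refine intervalIntegral.continuousAt_parametric_primitive_of_dominated (fun t => ‖f t‖)
    (-(|x₀| + 1)) (|x₀| + 1) (fun k => ?_) ?_ (hf _ _).norm ?_ ?_ ?_ (by simp)
  · exact aestronglyMeasurable_modulate (hf _ _).aestronglyMeasurable_restrict_uIoc k
  · exact Eventually.of_forall fun k => ae_of_all _ fun t => (norm_modulate f k t).le
  · exact ae_of_all _ fun t => (continuous_modulate_left f t).continuousAt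
  · constructor <;> linarith [abs_nonneg x₀]
  · constructor <;> linarith [neg_abs_le x₀, le_abs_self x₀]

theorem intervalIntegrable_modulate {f : ℝ → ℂ} (hf : ∀ a b, IntervalIntegrable f volume a b)
    (k a b : ℝ) : IntervalIntegrable (modulate f k) volume a b :=
  ⟨integrable_modulate (hf a b).1 k, integrable_modulate (hf a b).2 k⟩

theorem partialFourier_sub {f : ℝ → ℂ} (hf : ∀ a b, IntervalIntegrable f volume a b) (k a b : ℝ) :
    partialFourier f k b - partialFourier f k a = ∫ t in a..b, modulate f k t :=
  intervalIntegral.integral_interval_sub_left (intervalIntegrable_modulate hf k _ _)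
    (intervalIntegrable_modulate hf k _ _)

theorem enorm_partialFourier_sub_le {f : ℝ → ℂ} (hf : ∀ a b, IntervalIntegrable f volume a b)
    (k a b : ℝ) :
    ‖partialFourier f k b - partialFourier f k a‖ₑ ≤ ∫⁻ t in uIoc a b, ‖f t‖ₑ := by
  rw [partialFourier_sub hf]
  calc ‖∫ t in a..b, modulate f k t‖ₑ = ‖∫ t in uIoc a b, modulate f k t‖ₑ := by
        rw [← ofReal_norm, ← ofReal_norm, intervalIntegral.norm_intervalIntegral_eq]
    _ ≤ ∫⁻ t in uIoc a b, ‖modulate f k t‖ₑ := enorm_integral_le_lintegral_enorm _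
    _ = _ := by
        refine lintegral_congr fun t => ?_
        rw [← ofReal_norm, norm_modulate, ofReal_norm]

/-- Each partition sum is continuous in `k`, and the variation is their supremum. This supplies
measurability in `k`. -/
theorem lowerSemicontinuous_rVariationOn {f : ℝ → ℂ} (hf : ∀ a b, IntervalIntegrable f volume a b)
    (ρ : ℝ) (S : Set ℝ) :
    LowerSemicontinuous fun k => rVariationOn edist ρ (partialFourier f k) S := by
  have hc : ∀ x, Continuous fun k => partialFourier f k x := fun x =>
    (continuous_partialFourier hf).comp (by fun_prop : Continuous fun k : ℝ => (k, x))
  unfold rVariationOn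
  refine lowerSemicontinuous_iSup fun n => lowerSemicontinuous_iSup fun t =>
    lowerSemicontinuous_iSup fun _ => lowerSemicontinuous_iSup fun _ => Continuous.lowerSemicontinuous ?_
  refine ENNReal.continuous_rpow_const.comp (continuous_finsetSum _ fun j _ => ?_)
  exact ENNReal.continuous_rpow_const.comp ((hc _).edist (hc _))

/-- The variational Christ–Kiselev estimate for functions of bounded support, with an explicit
constant in terms of the constant `C₀` of the Hausdorff–Young inequality. -/
theorem eLpNorm_rVariationOn_le_of_support {p p' : ℝ≥0∞} (hp1 : 1 ≤ p) (hp2 : p < 2) {ρ : ℝ}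
    (hρ : 1 ≤ ρ) (hρ' : ENNReal.ofReal ρ ≤ p') {C₀ : ℝ≥0}
    (hC₀ : ∀ f : ℝ → ℂ, Integrable f → MemLp f p volume →
      eLpNorm (𝓕 f) p' volume ≤ C₀ * eLpNorm f p volume)
    {f : ℝ → ℂ} (hf : Integrable f) (hfp : MemLp f p volume) {R : ℝ} (hR : 0 ≤ R)
    (hfR : ∀ x, x ∉ Icc (-R) R → f x = 0) :
    eLpNorm (fun k => rVariationOn edist ρ (partialFourier f k) univ) p' volume ≤
      ∑' n : ℕ, 4 * (C₀ * ((2 : ℝ≥0∞) ^ (1 / ρ - 1 / p.toReal)) ^ n * eLpNorm f p volume) := by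
  have hρ0 : 0 < ρ := by linarith
  have hptop : p ≠ ⊤ := (hp2.trans (by norm_num)).ne
  have hp0 : p ≠ 0 := (zero_lt_one.trans_le hp1).ne'
  set P := p.toReal with hP
  have hP1 : 1 ≤ P := by
    rw [hP, ← ENNReal.toReal_one]; exact ENNReal.toReal_mono hptop hp1
  have hfi : ∀ a b, IntervalIntegrable f volume a b := fun a b => hf.intervalIntegrable
  set φ : ℝ → ℝ := fun x => ‖f x‖ ^ P with hφ
  have hφi : Integrable φ := hfp.integrable_norm_rpow hp0 hptop
  have hφ0 : ∀ x, 0 ≤ φ x := fun x => by positivity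
  have hφR : ∀ x, x ∉ Icc (-R) R → φ x = 0 := fun x hx => by
    simp [hφ, hfR x hx, show P ≠ 0 by linarith]
  set A : ℝ := ∫ t in (-R)..R, φ t with hA
  have hA0 : 0 ≤ A := intervalIntegral.integral_nonneg (by linarith) fun x _ => hφ0 x
  have hlin : ∀ {a b}, a ≤ b → ∫⁻ t in Ioc a b, ‖f t‖ₑ ^ P = ENNReal.ofReal (∫ t in a..b, φ t) := by
    intro a b hab
    rw [intervalIntegral.integral_of_le hab, ofReal_integral_eq_lintegral_ofReal hφi.integrableOn
      (ae_of_all _ hφ0)]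
    refine lintegral_congr fun t => ?_
    rw [hφ, ← ENNReal.ofReal_rpow_of_nonneg (norm_nonneg _) (by linarith), ofReal_norm]
  have hnorm : eLpNorm f p volume = ENNReal.ofReal A ^ (1 / P) := by
    rw [eLpNorm_eq_lintegral_rpow_enorm_toReal hp0 hptop, ← hP, hA, ← hlin (by linarith),
      setLIntegral_congr Ioc_ae_eq_Icc]
    congr 1
    refine (setLIntegral_eq_of_support_subset fun x hx => ?_).symm
    by_contra hx'
    simp [hfR x hx', show 0 < P by linarith] at hx
  -- If `f` vanishes almost everywhere, the normalisation by `A` below is not available.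
  rcases hA0.eq_or_lt with hA0 | hA0
  · have hz : ∀ᵐ x, f x = 0 := by
      have : eLpNorm f p volume = 0 := by rw [hnorm, ← hA0]; simp; linarith
      exact (eLpNorm_eq_zero_iff hf.1 hp0).1 this
    have : ∀ k x, partialFourier f k x = 0 := fun k x => by
      refine intervalIntegral.integral_zero_ae ?_
      filter_upwards [hz] with t ht _
      simp [modulate, ht]
    have h0 : ∀ k, rVariationOn edist ρ (partialFourier f k) univ = 0 := fun k =>
      le_antisymm (rVariationOn_le fun n t _ _ => by simp [this, hρ0]) bot_le
    simp [h0]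
  -- `F` is the normalised distribution function of `‖f‖ ^ P`; with its right inverse `Q` on `[0,
  -- 1]`, equal lengths in the new variable carry equal shares of the mass.
  set F : ℝ → ℝ := fun x => (∫ t in (-R)..x, φ t) / A with hFdef
  have hφii : ∀ a b, IntervalIntegrable φ volume a b := fun a b => hφi.intervalIntegrable
  have hFsub : ∀ a b, F b - F a = (∫ t in a..b, φ t) / A := fun a b => by
    rw [hFdef]
    dsimp only
    rw [← sub_div, intervalIntegral.integral_interval_sub_left (hφii _ _) (hφii _ _)]
  have hFmono : Monotone F := fun a b hab => by
    rw [← sub_nonneg, hFsub]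
    exact div_nonneg (intervalIntegral.integral_nonneg hab fun x _ => hφ0 x) hA0.le
  have hFl : F (-R) = 0 := by simp [hFdef]
  have hFr : F R = 1 := by simp only [hFdef, ← hA]; exact div_self hA0.ne'
  have hF0 : ∀ x, 0 ≤ F x := fun x => by
    rcases le_total (-R) x with h | h
    · rw [← hFl]; exact hFmono h
    · refine le_of_eq ?_
      have : F (-R) - F x = 0 := by
        rw [hFsub, intervalIntegral.integral_of_le h, integral_Ioc_eq_integral_Ioo,
          setIntegral_eq_zero_of_forall_eq_zero (fun t ht => hφR t fun h' => ?_), zero_div]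
        exact absurd h'.1 (not_le.2 ht.2)
      linarith
  have hF1 : ∀ x, F x ≤ 1 := fun x => by
    rcases le_total x R with h | h
    · rw [← hFr]; exact hFmono h
    · refine le_of_eq ?_
      have : F x - F R = 0 := by
        rw [hFsub, intervalIntegral.integral_of_le h,
          setIntegral_eq_zero_of_forall_eq_zero (fun t ht => hφR t fun h' => ?_), zero_div]
        exact absurd h'.2 (not_le.2 ht.1)
      linarith
  have hFc : Continuous F := by
    have : Continuous fun x => ∫ t in (-R)..x, φ t :=
      intervalIntegral.continuous_primitive hφii (-R)
    exact this.div_const A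
  have hQex : ∀ θ ∈ Icc (0 : ℝ) 1, ∃ x, F x = θ := fun θ hθ => by
    obtain ⟨x, _, hx⟩ := intermediate_value_Icc (by linarith : -R ≤ R) hFc.continuousOn
      (show θ ∈ Icc (F (-R)) (F R) by rwa [hFl, hFr])
    exact ⟨x, hx⟩
  choose! Q hQ using hQex
  -- Hausdorff–Young for `f` restricted to an interval that carries the fraction `b - a` of the
  -- mass.
  have hincr : ∀ a ∈ Icc (0 : ℝ) 1, ∀ b ∈ Icc (0 : ℝ) 1, a ≤ b →
      eLpNorm (fun k => partialFourier f k (Q b) - partialFourier f k (Q a)) p' volume ≤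
        C₀ * (ENNReal.ofReal (b - a) ^ (1 / P) * eLpNorm f p volume) := by
    intro a ha b hb hab
    rcases hab.eq_or_lt with rfl | hlt
    · simp
    have hQab : Q a ≤ Q b := by
      by_contra hcon
      have := hFmono (not_le.1 hcon).le
      rw [hQ a ha, hQ b hb] at this
      linarith
    have h₁ : ∀ k, partialFourier f k (Q b) - partialFourier f k (Q a) =
        𝓕 ((Ioc (Q a) (Q b)).indicator f) k := fun k => by
      rw [partialFourier_sub hfi, intervalIntegral.integral_of_le hQab, ← integral_modulate,
        modulate_indicator, integral_indicator measurableSet_Ioc]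
    simp only [h₁]
    refine (hC₀ _ (hf.indicator measurableSet_Ioc) (hfp.indicator measurableSet_Ioc)).trans ?_
    gcongr
    rw [eLpNorm_indicator_eq_eLpNorm_restrict measurableSet_Ioc,
      eLpNorm_eq_lintegral_rpow_enorm_toReal hp0 hptop, ← hP, hlin hQab, hnorm,
      ← ENNReal.mul_rpow_of_nonneg _ _ (by positivity), ← ENNReal.ofReal_mul (by linarith)]
    refine le_of_eq ?_
    congr 2
    have := hFsub (Q a) (Q b)
    rw [hQ a ha, hQ b hb] at this
    rw [this]
    field_simp
  have hlim : ∀ k x, Tendsto (fun N : ℕ => partialFourier f k (Q ((⌊2 ^ N * F x⌋₊ : ℝ) / 2 ^ N)))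
      atTop (𝓝 (partialFourier f k x)) := by
    intro k x
    have hθ : Tendsto (fun N : ℕ => (⌊2 ^ N * F x⌋₊ : ℝ) / 2 ^ N) atTop (𝓝 (F x)) := by
      have := (tendsto_nat_floor_mul_div_atTop (hF0 x)).comp
        (tendsto_pow_atTop_atTop_of_one_lt (one_lt_two : (1 : ℝ) < 2))
      refine this.congr fun N => ?_
      simp [mul_comm]
    have hθmem : ∀ N : ℕ, (⌊2 ^ N * F x⌋₊ : ℝ) / 2 ^ N ∈ Icc (0 : ℝ) 1 := fun N => by
      refine ⟨by positivity, ?_⟩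
      rw [div_le_one (by positivity)]
      refine (Nat.floor_le (mul_nonneg (by positivity) (hF0 x))).trans ?_
      exact mul_le_of_le_one_right (by positivity) (hF1 x)
    rw [tendsto_iff_edist_tendsto_0]
    -- `Q (F x)` need not be `x`. Hölder's inequality on the bounded support shows that the partial
    -- integral depends on `x` only through `F x`, with Hölder exponent `1 / P`, which gives the
    -- limit.
    have hbound : ∀ z, edist (partialFourier f k z) (partialFourier f k x) ≤
        ENNReal.ofReal (A * |F z - F x|) ^ (1 / P) *
          volume (Icc (-R) R) ^ (1 - 1 / P) := by
      intro z
      rw [edist_eq_enorm_sub]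
      refine (enorm_partialFourier_sub_le hfi k x z).trans ?_
      have hsupp : ∫⁻ t in uIoc x z, ‖f t‖ₑ = ∫⁻ t in uIoc x z ∩ Icc (-R) R, ‖f t‖ₑ := by
        rw [inter_comm, ← setLIntegral_indicator measurableSet_Icc]
        refine lintegral_congr fun t => ?_
        by_cases ht : t ∈ Icc (-R) R <;> simp [ht, hfR]
      rw [hsupp, ← eLpNorm_one_eq_lintegral_enorm]
      have hH := eLpNorm_le_eLpNorm_mul_rpow_measure_univ (p := 1) (q := p)
        (μ := volume.restrict (uIoc x z ∩ Icc (-R) R)) (f := f) hp1 hf.1.restrict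
      refine hH.trans ?_
      rw [Measure.restrict_apply_univ, ENNReal.toReal_one, ← hP, div_one]
      have : 1 / P ≤ 1 := by rw [div_le_one (by linarith)]; exact hP1
      gcongr
      · refine (eLpNorm_mono_measure f (Measure.restrict_mono inter_subset_left le_rfl)).trans ?_
        rw [eLpNorm_eq_lintegral_rpow_enorm_toReal hp0 hptop, ← hP]
        gcongr
        rcases le_total x z with h | h
        · rw [uIoc_of_le h, hlin h, abs_of_nonneg (sub_nonneg.2 (hFmono h)), hFsub,
            mul_div_cancel₀ _ hA0.ne']
        · rw [uIoc_of_ge h, hlin h, abs_sub_comm, abs_of_nonneg (sub_nonneg.2 (hFmono h)), hFsub,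
            mul_div_cancel₀ _ hA0.ne']
      · exact inter_subset_right
    refine tendsto_of_tendsto_of_tendsto_of_le_of_le tendsto_const_nhds ?_ (fun _ => bot_le)
      (fun N => hbound _)
    have h₁ : Tendsto (fun N : ℕ => ENNReal.ofReal
        (A * |F (Q ((⌊2 ^ N * F x⌋₊ : ℝ) / 2 ^ N)) - F x|)) atTop (𝓝 0) := by
      rw [← ENNReal.ofReal_zero]
      refine ENNReal.tendsto_ofReal ?_
      have := ((hθ.sub_const (F x)).abs).const_mul A
      rw [sub_self, abs_zero, mul_zero] at this
      refine this.congr fun N => ?_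
      rw [hQ _ (hθmem N)]
    have h₂ := ((ENNReal.continuous_rpow_const (y := 1 / P)).tendsto _).comp h₁
    rw [ENNReal.zero_rpow_of_pos (by positivity)] at h₂
    have h₃ := ENNReal.Tendsto.mul_const (b := volume (Icc (-R) R) ^ (1 - 1 / P)) h₂
      (Or.inr (by
        refine ENNReal.rpow_ne_top_of_nonneg ?_ (by simp)
        have : 1 / P ≤ 1 := by rw [div_le_one (by linarith)]; exact hP1
        linarith))
    rw [zero_mul] at h₃
    exact h₃
  have hpt : ∀ k, rVariationOn edist ρ (partialFourier f k) univ ≤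
      ∑' n, 2 * (∑ m ∈ Finset.range (2 ^ n + 1),
        ‖dyadicIncr (partialFourier f k ∘ Q) n m‖ₑ ^ ρ) ^ (1 / ρ) := fun k =>
    rVariationOn_le_tsum_dyadic hρ hFmono hF0 hF1 (hlim k)
  have hcont : ∀ n m, Continuous fun k => dyadicIncr (partialFourier f k ∘ Q) n m := by
    have hc : ∀ x, Continuous fun k => partialFourier f k x := fun x =>
      (continuous_partialFourier hfi).comp (by fun_prop : Continuous fun k : ℝ => (k, x))
    intro n m
    cases n with
    | zero => exact (hc _).sub (hc _)
    | succ n => exact (hc _).sub (hc _)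
  have hdy : ∀ n, ∀ m ∈ Finset.range (2 ^ n + 1),
      eLpNorm (fun k => dyadicIncr (partialFourier f k ∘ Q) n m) p' volume ≤
        C₀ * (((2 : ℝ≥0∞) ^ (-(n : ℝ) / P)) * eLpNorm f p volume) := by
    have hpow : ∀ n : ℕ, ENNReal.ofReal ((2 ^ n : ℝ)⁻¹) ^ (1 / P) = (2 : ℝ≥0∞) ^ (-(n : ℝ) / P) := by
      intro n
      rw [ENNReal.ofReal_inv_of_pos (by positivity), ENNReal.ofReal_pow (by norm_num),
        ENNReal.ofReal_ofNat, ← ENNReal.rpow_natCast, ← ENNReal.rpow_neg, ← ENNReal.rpow_mul]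
      congr 1
      ring
    intro n m hm
    have hm' : m ≤ 2 ^ n := Nat.lt_succ_iff.1 (Finset.mem_range.1 hm)
    cases n with
    | zero =>
      refine (hincr 0 ⟨le_rfl, zero_le_one⟩ m ⟨by positivity, by exact_mod_cast hm'⟩
        (by positivity)).trans ?_
      rw [← hpow]
      gcongr
      simp only [pow_zero, inv_one, sub_zero]
      exact_mod_cast hm'
    | succ n =>
      have h2 : m ≤ 2 * (m / 2) + 1 := by omega
      have h3 : 2 * (m / 2) ≤ m := by omega
      have h2' : (m : ℝ) ≤ 2 * ((m / 2 : ℕ) : ℝ) + 1 := by exact_mod_cast h2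
      have h3' : 2 * ((m / 2 : ℕ) : ℝ) ≤ m := by exact_mod_cast h3
      have hm'' : (m : ℝ) ≤ 2 ^ (n + 1) := by exact_mod_cast hm'
      have hle : ((m / 2 : ℕ) : ℝ) / 2 ^ n ≤ m / 2 ^ (n + 1) := by
        rw [div_le_div_iff₀ (by positivity) (by positivity), pow_succ]
        nlinarith [show (0 : ℝ) < 2 ^ n by positivity]
      have hmem : (m : ℝ) / 2 ^ (n + 1) ∈ Icc (0 : ℝ) 1 :=
        ⟨by positivity, by rwa [div_le_one (by positivity)]⟩
      refine (hincr _ ⟨by positivity, hle.trans hmem.2⟩ _ hmem hle).trans ?_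
      rw [← hpow]
      gcongr
      rw [sub_le_iff_le_add, inv_eq_one_div, pow_succ, div_add_div _ _ (by positivity) (by positivity),
        div_le_div_iff₀ (by positivity) (by positivity)]
      nlinarith [show (0 : ℝ) < 2 ^ n * 2 ^ n * 2 ^ n by positivity]
  have hp'1 : 1 ≤ p' := by
    refine le_trans ?_ hρ'
    rw [← ENNReal.ofReal_one]
    exact ENNReal.ofReal_le_ofReal hρ
  have hmeas : ∀ n : ℕ, Measurable fun k => (∑ m ∈ Finset.range (2 ^ n + 1),
      ‖dyadicIncr (partialFourier f k ∘ Q) n m‖ₑ ^ ρ) ^ (1 / ρ) := fun n => by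
    refine (Finset.measurable_fun_sum _ fun m _ => ?_).pow_const _
    exact (hcont n m).measurable.enorm.pow_const _
  calc _ ≤ eLpNorm (fun k => ∑' n, 2 * (∑ m ∈ Finset.range (2 ^ n + 1),
        ‖dyadicIncr (partialFourier f k ∘ Q) n m‖ₑ ^ ρ) ^ (1 / ρ)) p' volume :=
        eLpNorm_mono_enorm fun k => by simpa [enorm_eq_self] using hpt k
    _ ≤ ∑' n, eLpNorm (fun k => 2 * (∑ m ∈ Finset.range (2 ^ n + 1),
        ‖dyadicIncr (partialFourier f k ∘ Q) n m‖ₑ ^ ρ) ^ (1 / ρ)) p' volume :=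
        eLpNorm_tsum_le (fun n => ((hmeas n).const_mul 2).aemeasurable) hp'1
    _ ≤ _ := by
        refine ENNReal.tsum_le_tsum fun n => ?_
        set B := C₀ * (((2 : ℝ≥0∞) ^ (-(n : ℝ) / P)) * eLpNorm f p volume) with hB
        -- Scale `n` has `2 ^ n + 1 ≤ 2 * 2 ^ n` increments, each of norm at most `B`.
        have h₁ : eLpNorm (fun k => (∑ m ∈ Finset.range (2 ^ n + 1),
            ‖dyadicIncr (partialFourier f k ∘ Q) n m‖ₑ ^ ρ) ^ (1 / ρ)) p' volume ≤
            2 * (2 : ℝ≥0∞) ^ ((n : ℝ) / ρ) * B := by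
          refine (eLpNorm_rpow_sum_le _ (fun m _ => (hcont n m).measurable.enorm.aemeasurable)
            hρ0 hρ').trans ?_
          simp only [eLpNorm_enorm]
          calc _ ≤ (∑ m ∈ Finset.range (2 ^ n + 1), B ^ ρ) ^ (1 / ρ) := by
                gcongr with m hm
                exact hdy n m hm
            _ = ((2 ^ n + 1 : ℕ) : ℝ≥0∞) ^ (1 / ρ) * B := by
                rw [Finset.sum_const, Finset.card_range, nsmul_eq_mul,
                  ENNReal.mul_rpow_of_nonneg _ _ (by positivity), ← ENNReal.rpow_mul,
                  mul_one_div_cancel hρ0.ne', ENNReal.rpow_one]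
            _ ≤ _ := by
                gcongr
                calc ((2 ^ n + 1 : ℕ) : ℝ≥0∞) ^ (1 / ρ) ≤ (2 * 2 ^ n : ℝ≥0∞) ^ (1 / ρ) := by
                      gcongr
                      have : 2 ^ n + 1 ≤ 2 * 2 ^ n := by have := Nat.one_le_two_pow (n := n); omega
                      exact_mod_cast this
                  _ = 2 ^ (1 / ρ) * 2 ^ ((n : ℝ) / ρ) := by
                      rw [ENNReal.mul_rpow_of_nonneg _ _ (by positivity), ← ENNReal.rpow_natCast,
                        ← ENNReal.rpow_mul, mul_one_div]
                  _ ≤ _ := by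
                      gcongr
                      calc (2 : ℝ≥0∞) ^ (1 / ρ) ≤ 2 ^ (1 : ℝ) :=
                            ENNReal.rpow_le_rpow_of_exponent_le (by norm_num)
                              (by rwa [div_le_one hρ0])
                        _ = 2 := ENNReal.rpow_one 2
        refine (eLpNorm_le_nnreal_smul_eLpNorm_of_ae_le_mul' (c := 2)
          (g := fun k => (∑ m ∈ Finset.range (2 ^ n + 1),
            ‖dyadicIncr (partialFourier f k ∘ Q) n m‖ₑ ^ ρ) ^ (1 / ρ))
          (ae_of_all _ fun k => ?_) p').trans ?_
        · simp [enorm_eq_self]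
        · rw [ENNReal.smul_def, smul_eq_mul]
          refine (mul_le_mul_right h₁ _).trans (le_of_eq ?_)
          have hθ : ((2 : ℝ≥0∞) ^ (1 / ρ - 1 / P)) ^ n = 2 ^ ((n : ℝ) / ρ) * 2 ^ (-(n : ℝ) / P) := by
            rw [← ENNReal.rpow_natCast, ← ENNReal.rpow_mul,
              ← ENNReal.rpow_add _ _ (by norm_num) (by norm_num)]
            congr 1
            ring
          rw [hθ, hB]
          push_cast
          ring

/-- The linear variational estimate: the `ρ`-variation of the partial Fourier integrals is bounded
from `L^p` to `L^{p'}` for `ρ > p`. -/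
theorem exists_eLpNorm_rVariationOn_partialFourier_le {p p' : ℝ≥0∞} (hp1 : 1 ≤ p) (hp2 : p < 2)
    (hpp' : p.HolderConjugate p') {ρ : ℝ} (hρ : p < ENNReal.ofReal ρ) (hρ2 : ρ < 2) :
    ∃ C : ℝ≥0, ∀ f : ℝ → ℂ, MemLp f p volume →
      eLpNorm (fun k => rVariationOn edist ρ (partialFourier f k) univ) p' volume ≤
        C * eLpNorm f p volume := by
  obtain ⟨C₀, hC₀⟩ := exists_eLpNorm_fourier_le hp1 hp2 hpp'
  have hptop : p ≠ ⊤ := (hp2.trans (by norm_num)).ne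
  set P := p.toReal with hP
  have hpP : p = ENNReal.ofReal P := (ENNReal.ofReal_toReal hptop).symm
  have hP1 : 1 ≤ P := by
    rw [hP, ← ENNReal.toReal_one]; exact ENNReal.toReal_mono hptop hp1
  have hPρ : P < ρ := by
    rwa [hpP, ENNReal.ofReal_lt_ofReal_iff_of_nonneg (by linarith)] at hρ
  have hρ1 : 1 ≤ ρ := by linarith
  have hρ0 : 0 < ρ := by linarith
  -- `p < 2` forces `p' ≥ 2`, as required by Minkowski's inequality with exponent `ρ`.
  have hρ' : ENNReal.ofReal ρ ≤ p' := by
    refine (ENNReal.ofReal_le_ofReal hρ2.le).trans ?_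
    rw [ENNReal.HolderConjugate.conj_eq (p := p) (q := p'), ENNReal.ofReal_ofNat,
      ← one_add_one_eq_two]
    gcongr
    rw [ENNReal.one_le_inv, tsub_le_iff_right, one_add_one_eq_two]
    exact hp2.le
  set θ : ℝ≥0∞ := (2 : ℝ≥0∞) ^ (1 / ρ - 1 / P) with hθ
  -- `θ` is the ratio of the geometric series over scales; its exponent is negative because `ρ > p`.
  have hθ1 : θ < 1 := by
    refine ENNReal.rpow_lt_one_of_one_lt_of_neg (by norm_num) ?_
    rw [sub_neg]
    exact one_div_lt_one_div_of_lt (by linarith) hPρ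
  have hfinite : 4 * (C₀ * (1 - θ)⁻¹) ≠ ⊤ := by
    refine ENNReal.mul_ne_top (by norm_num) (ENNReal.mul_ne_top ENNReal.coe_ne_top ?_)
    rw [ENNReal.inv_ne_top]
    exact (tsub_pos_of_lt hθ1).ne'
  refine ⟨(4 * (C₀ * (1 - θ)⁻¹)).toNNReal, fun f hf => ?_⟩
  have hfi : ∀ a b, IntervalIntegrable f volume a b := fun a b =>
    ((hf.locallyIntegrable hp1).integrableOn_isCompact isCompact_uIcc).intervalIntegrable
  rw [ENNReal.coe_toNNReal hfinite]
  -- A partition sum sees finitely many points, so bounded windows exhaust the line; on a window `f`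
  -- may be replaced by its restriction. The partition is frozen after `t n` to stay in the window.
  have hsup : ∀ k, rVariationOn edist ρ (partialFourier f k) univ =
      ⨆ N : ℕ, rVariationOn edist ρ (partialFourier f k) (Icc (-(N : ℝ)) N) := by
    intro k
    refine le_antisymm (rVariationOn_le fun n t ht _ => ?_)
      (iSup_le fun N => rVariationOn_mono (subset_univ _))
    obtain ⟨N, hN⟩ := exists_nat_ge (max |t 0| |t n|)
    have hmem : ∀ j, t (min j n) ∈ Icc (-(N : ℝ)) N := fun j => by
      have h₁ := ht (Nat.zero_le (min j n))
      have h₂ := ht (min_le_right j n)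
      have h₃ := (le_max_left _ _).trans hN
      have h₄ := (le_max_right _ _).trans hN
      exact ⟨by linarith [neg_abs_le (t 0)], by linarith [le_abs_self (t n)]⟩
    refine le_trans (le_of_eq ?_) ((le_rVariationOn (t := fun j => t (min j n))
      (fun i j hij => ht (min_le_min_right n hij)) hmem n).trans
      (le_iSup (fun N : ℕ => rVariationOn edist ρ (partialFourier f k) (Icc (-(N : ℝ)) N)) N))
    congr 1
    refine Finset.sum_congr rfl fun j hj => ?_
    rw [Finset.mem_range] at hj
    rw [min_eq_left hj.le, min_eq_left (Nat.succ_le_of_lt hj)]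
  simp only [hsup]
  refine eLpNorm_iSup_le (fun N => (lowerSemicontinuous_rVariationOn hfi ρ _).measurable.aemeasurable)
    (fun k i j hij => rVariationOn_mono (Icc_subset_Icc (by simpa using hij) (by simpa using hij)))
    fun N => ?_
  set g := (Icc (-(N : ℝ)) N).indicator f with hg
  have hgp : MemLp g p volume := hf.indicator measurableSet_Icc
  have hgi : Integrable g := by
    rw [hg, integrable_indicator_iff measurableSet_Icc]
    exact (hf.locallyIntegrable hp1).integrableOn_isCompact isCompact_Icc
  have hle := eLpNorm_rVariationOn_le_of_support hp1 hp2 hρ1 hρ' hC₀ hgi hgp (Nat.cast_nonneg N)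
    (fun x hx => indicator_of_notMem hx f)
  have hgle : eLpNorm g p volume ≤ eLpNorm f p volume := eLpNorm_indicator_le f
  have heq : ∀ k, ∀ x ∈ Icc (-(N : ℝ)) N, partialFourier f k x = partialFourier g k x := by
    intro k x hx
    refine intervalIntegral.integral_congr fun t ht => ?_
    have ht' : t ∈ Icc (-(N : ℝ)) N := uIcc_subset_Icc ⟨by simp, by simp⟩ hx ht
    rw [hg, modulate_indicator, indicator_of_mem ht']
  calc _ ≤ eLpNorm (fun k => rVariationOn edist ρ (partialFourier g k) univ) p' volume := by
        refine eLpNorm_mono_enorm fun k => ?_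
        simp only [enorm_eq_self]
        refine rVariationOn_le fun n t ht htS => ?_
        simp only [heq k _ (htS _)]
        exact le_rVariationOn ht (fun _ => mem_univ _) n
    _ ≤ _ := hle
    _ = 4 * (C₀ * (1 - θ)⁻¹) * eLpNorm g p volume := by
        rw [ENNReal.tsum_mul_left, ENNReal.tsum_mul_right, ENNReal.tsum_mul_left,
          ENNReal.tsum_geometric]
        ring
    _ ≤ _ := by gcongr

end ChristKiselev

/-! ### The left-invariant distance. -/

section Metric

variable {E : Type*} [NormedAddCommGroup E] [NormedSpace ℝ E]
  {G : Type*} [TopologicalSpace G] [ChartedSpace E G] [Group G]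

/-- Homogeneity of the length element is what the general facts on `riemannianEDist` rely on. -/
lemma enormSMulClass_leftENorm (N : Seminorm ℝ (GroupLieAlgebra 𝓘(ℝ, E) G)) (g : G) :
    letI := leftENorm N g
    ENormSMulClass ℝ (TangentSpace 𝓘(ℝ, E) g) := by
  letI := leftENorm N g
  refine ⟨fun c x => ?_⟩
  change ENNReal.ofReal (N (mfderiv 𝓘(ℝ, E) 𝓘(ℝ, E) (fun h : G => g⁻¹ * h) g (c • x))) =
    ‖c‖ₑ * ENNReal.ofReal (N (mfderiv 𝓘(ℝ, E) 𝓘(ℝ, E) (fun h : G => g⁻¹ * h) g x))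
  rw [map_smul]
  have : ∀ z : TangentSpace 𝓘(ℝ, E) (g⁻¹ * g), N (c • z : E) = ‖c‖ * N (z : E) :=
    fun z => map_smul_eq_mul N c z
  rw [← ofReal_norm, ← ENNReal.ofReal_mul (norm_nonneg c)]
  congr 1
  exact this _

lemma leftEDist_self (N : Seminorm ℝ (GroupLieAlgebra 𝓘(ℝ, E) G)) (g : G) :
    leftEDist N g g = 0 := by
  letI : ∀ x : G, ENorm (TangentSpace 𝓘(ℝ, E) x) := leftENorm N
  haveI : ∀ x : G, ENormSMulClass ℝ (TangentSpace 𝓘(ℝ, E) x) := enormSMulClass_leftENorm N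
  exact Manifold.riemannianEDist_self

lemma leftEDist_comm (N : Seminorm ℝ (GroupLieAlgebra 𝓘(ℝ, E) G)) (g h : G) :
    leftEDist N g h = leftEDist N h g := by
  letI : ∀ x : G, ENorm (TangentSpace 𝓘(ℝ, E) x) := leftENorm N
  haveI : ∀ x : G, ENormSMulClass ℝ (TangentSpace 𝓘(ℝ, E) x) := enormSMulClass_leftENorm N
  exact Manifold.riemannianEDist_comm

lemma leftEDist_triangle (N : Seminorm ℝ (GroupLieAlgebra 𝓘(ℝ, E) G)) (g h k : G) :
    leftEDist N g k ≤ leftEDist N g h + leftEDist N h k := by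
  letI : ∀ x : G, ENorm (TangentSpace 𝓘(ℝ, E) x) := leftENorm N
  haveI : ∀ x : G, ENormSMulClass ℝ (TangentSpace 𝓘(ℝ, E) x) := enormSMulClass_leftENorm N
  exact Manifold.riemannianEDist_triangle

variable [LieGroup 𝓘(ℝ, E) ∞ G]

lemma isManifold_of_lieGroup : IsManifold 𝓘(ℝ, E) ∞ G :=
  (LieGroup.toContMDiffMul (I := 𝓘(ℝ, E)) (n := ∞) (G := G)).toIsManifold

lemma contMDiff_mul_left_one (g : G) :
    ContMDiff 𝓘(ℝ, E) 𝓘(ℝ, E) 1 (fun h : G => g * h) :=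
  (contMDiff_mul_left (I := 𝓘(ℝ, E)) (n := ∞) (a := g)).of_le (by simp)

lemma mdifferentiableAt_mul_left (g h : G) :
    MDifferentiableAt 𝓘(ℝ, E) 𝓘(ℝ, E) (fun x : G => g * x) h :=
  ((contMDiff_mul_left_one g).mdifferentiable (by simp)) h

/-- The length element of a path is the norm of the velocity of the path translated to `1`. -/
lemma leftENorm_mfderiv (N : Seminorm ℝ (GroupLieAlgebra 𝓘(ℝ, E) G)) {γ : ℝ → G} {t : ℝ}
    (hγ : MDifferentiableAt 𝓘(ℝ, ℝ) 𝓘(ℝ, E) γ t) :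
    (leftENorm N (γ t)).enorm (mfderiv 𝓘(ℝ, ℝ) 𝓘(ℝ, E) γ t (1 : ℝ)) =
      ENNReal.ofReal (N (fderiv ℝ (fun s => extChartAt 𝓘(ℝ, E) (1 : G) ((γ t)⁻¹ * γ s)) t 1 : E)) := by
  change ENNReal.ofReal (N (mfderiv 𝓘(ℝ, E) 𝓘(ℝ, E) (fun h : G => (γ t)⁻¹ * h) (γ t)
    (mfderiv 𝓘(ℝ, ℝ) 𝓘(ℝ, E) γ t (1 : ℝ)) : E)) = _
  have h1 := mfderiv_comp_apply (I := 𝓘(ℝ, ℝ)) (I' := 𝓘(ℝ, E)) (I'' := 𝓘(ℝ, E)) t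
    (mdifferentiableAt_mul_left (γ t)⁻¹ (γ t)) hγ (1 : ℝ)
  have h2 : MDifferentiableAt 𝓘(ℝ, ℝ) 𝓘(ℝ, E) ((fun h : G => (γ t)⁻¹ * h) ∘ γ) t :=
    (mdifferentiableAt_mul_left (γ t)⁻¹ (γ t)).comp t hγ
  have h3 : (mfderiv 𝓘(ℝ, ℝ) 𝓘(ℝ, E) ((fun h : G => (γ t)⁻¹ * h) ∘ γ) t (1 : ℝ) : E) =
      fderiv ℝ (fun s => extChartAt 𝓘(ℝ, E) (1 : G) ((γ t)⁻¹ * γ s)) t 1 := by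
    have h4 := h2.hasMFDerivAt.2
    simp only [writtenInExtChartAt, extChartAt_model_space_eq_id, Function.comp_def,
      inv_mul_cancel, modelWithCornersSelf_coe, range_id] at h4
    obtain ⟨A, hA⟩ : ∃ A : ℝ →L[ℝ] E,
        A = mfderiv 𝓘(ℝ, ℝ) 𝓘(ℝ, E) ((fun h : G => (γ t)⁻¹ * h) ∘ γ) t := ⟨_, rfl⟩
    have h5 : HasFDerivAt (fun s => extChartAt 𝓘(ℝ, E) (1 : G) ((γ t)⁻¹ * γ s)) A t := by
      rw [hA]
      exact hasFDerivWithinAt_univ.1 h4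
    rw [h5.fderiv, hA]
    rfl
  rw [← h3]
  congr 2
  exact h1.symm

/-- By `leftENorm_mfderiv` the length element depends only on `(γ t)⁻¹ * γ s`, which a left
translation does not change; so lengths are preserved. -/
lemma leftEDist_mul_left_le (N : Seminorm ℝ (GroupLieAlgebra 𝓘(ℝ, E) G)) (g h k : G) :
    leftEDist N (g * h) (g * k) ≤ leftEDist N h k := by
  refine le_of_forall_gt fun r hr => ?_
  letI : ∀ x : G, ENorm (TangentSpace 𝓘(ℝ, E) x) := leftENorm N
  haveI : ∀ x : G, ENormSMulClass ℝ (TangentSpace 𝓘(ℝ, E) x) := enormSMulClass_leftENorm N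
  obtain ⟨γ, h0, h1, hγ, hlt⟩ := Manifold.exists_lt_of_riemannianEDist_lt hr
  have hgγ : ContMDiffOn 𝓘(ℝ, ℝ) 𝓘(ℝ, E) 1 (fun t => g * γ t) (Icc 0 1) :=
    (contMDiff_mul_left_one g).comp_contMDiffOn hγ
  refine (Manifold.riemannianEDist_le_pathELength (I := 𝓘(ℝ, E)) hgγ (by rw [h0]) (by rw [h1])
    zero_le_one).trans_lt (lt_of_eq_of_lt ?_ hlt)
  simp only [Manifold.pathELength_eq_lintegral_mfderiv_Ioo]
  refine setLIntegral_congr_fun measurableSet_Ioo fun t ht => ?_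
  have hn : Icc (0 : ℝ) 1 ∈ 𝓝 t := Icc_mem_nhds ht.1 ht.2
  have e1 := leftENorm_mfderiv N ((hγ.contMDiffAt hn).mdifferentiableAt (by simp))
  have e2 := leftENorm_mfderiv N ((hgγ.contMDiffAt hn).mdifferentiableAt (by simp))
  refine e2.trans (Eq.trans ?_ e1.symm)
  simp only [mul_inv_rev, mul_assoc, inv_mul_cancel_left]

lemma leftEDist_mul_left (N : Seminorm ℝ (GroupLieAlgebra 𝓘(ℝ, E) G)) (g h k : G) :
    leftEDist N (g * h) (g * k) = leftEDist N h k := by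
  refine (leftEDist_mul_left_le N g h k).antisymm ?_
  simpa using leftEDist_mul_left_le N g⁻¹ (g * h) (g * k)

lemma leftEDist_eq_one_inv_mul (N : Seminorm ℝ (GroupLieAlgebra 𝓘(ℝ, E) G)) (g h : G) :
    leftEDist N g h = leftEDist N 1 (g⁻¹ * h) := by
  rw [← leftEDist_mul_left N g⁻¹, inv_mul_cancel]

variable (E G) in
/-- The chart of `G` at `1`. -/
noncomputable abbrev oneChart : PartialEquiv G E := extChartAt 𝓘(ℝ, E) (1 : G)

lemma isOpen_oneChart_target : IsOpen (oneChart E G).target := isOpen_extChartAt_target 1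

lemma contMDiffOn_oneChart_symm : ContMDiffOn 𝓘(ℝ, E) 𝓘(ℝ, E) ∞ (oneChart E G).symm
    (oneChart E G).target :=
  haveI := isManifold_of_lieGroup (E := E) (G := G)
  contMDiffOn_extChartAt_symm 1

lemma contMDiffOn_oneChart : ContMDiffOn 𝓘(ℝ, E) 𝓘(ℝ, E) ∞ (oneChart E G)
    (oneChart E G).source := by
  haveI := isManifold_of_lieGroup (E := E) (G := G)
  rw [extChartAt_source]
  exact contMDiffOn_extChartAt

/-- The map `(y, z) ↦ ψ(y)⁻¹ ψ(z)` in the chart at `1`. -/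
noncomputable def chartDiv (G : Type*) [TopologicalSpace G] [ChartedSpace E G] [Group G]
    (q : E × E) : E :=
  oneChart E G (((oneChart E G).symm q.1)⁻¹ * (oneChart E G).symm q.2)

/-- The group multiplication in the chart at `1`. -/
noncomputable def chartMul (G : Type*) [TopologicalSpace G] [ChartedSpace E G] [Group G]
    (q : E × E) : E :=
  oneChart E G ((oneChart E G).symm q.1 * (oneChart E G).symm q.2)

lemma contDiffAt_chartDiv {q : E × E} (h1 : q.1 ∈ (oneChart E G).target)
    (h2 : q.2 ∈ (oneChart E G).target)
    (h : ((oneChart E G).symm q.1)⁻¹ * (oneChart E G).symm q.2 ∈ (oneChart E G).source) :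
    ContDiffAt ℝ ∞ (chartDiv G) q := by
  haveI := isManifold_of_lieGroup (E := E) (G := G)
  rw [← contMDiffAt_iff_contDiffAt]
  have a1 : ContMDiffAt 𝓘(ℝ, E) 𝓘(ℝ, E) ∞ (oneChart E G).symm q.1 :=
    contMDiffOn_oneChart_symm.contMDiffAt (isOpen_oneChart_target.mem_nhds h1)
  have a2 : ContMDiffAt 𝓘(ℝ, E) 𝓘(ℝ, E) ∞ (oneChart E G).symm q.2 :=
    contMDiffOn_oneChart_symm.contMDiffAt (isOpen_oneChart_target.mem_nhds h2)
  have b1 : ContMDiffAt 𝓘(ℝ, E × E) 𝓘(ℝ, E) ∞ (fun q : E × E => (oneChart E G).symm q.1) q :=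
    ContMDiffAt.comp q a1 (contMDiffAt_iff_contDiffAt.2 contDiffAt_fst)
  have b2 : ContMDiffAt 𝓘(ℝ, E × E) 𝓘(ℝ, E) ∞ (fun q : E × E => (oneChart E G).symm q.2) q :=
    ContMDiffAt.comp q a2 (contMDiffAt_iff_contDiffAt.2 contDiffAt_snd)
  have c : ContMDiffAt 𝓘(ℝ, E) 𝓘(ℝ, E) ∞ (oneChart E G)
      (((oneChart E G).symm q.1)⁻¹ * (oneChart E G).symm q.2) :=
    contMDiffOn_oneChart.contMDiffAt ((isOpen_extChartAt_source 1).mem_nhds h)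
  exact ContMDiffAt.comp q c (b1.inv.mul b2)

lemma contDiffAt_chartMul {q : E × E} (h1 : q.1 ∈ (oneChart E G).target)
    (h2 : q.2 ∈ (oneChart E G).target)
    (h : (oneChart E G).symm q.1 * (oneChart E G).symm q.2 ∈ (oneChart E G).source) :
    ContDiffAt ℝ ∞ (chartMul G) q := by
  haveI := isManifold_of_lieGroup (E := E) (G := G)
  rw [← contMDiffAt_iff_contDiffAt]
  have a1 : ContMDiffAt 𝓘(ℝ, E) 𝓘(ℝ, E) ∞ (oneChart E G).symm q.1 :=
    contMDiffOn_oneChart_symm.contMDiffAt (isOpen_oneChart_target.mem_nhds h1)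
  have a2 : ContMDiffAt 𝓘(ℝ, E) 𝓘(ℝ, E) ∞ (oneChart E G).symm q.2 :=
    contMDiffOn_oneChart_symm.contMDiffAt (isOpen_oneChart_target.mem_nhds h2)
  have b1 : ContMDiffAt 𝓘(ℝ, E × E) 𝓘(ℝ, E) ∞ (fun q : E × E => (oneChart E G).symm q.1) q :=
    ContMDiffAt.comp q a1 (contMDiffAt_iff_contDiffAt.2 contDiffAt_fst)
  have b2 : ContMDiffAt 𝓘(ℝ, E × E) 𝓘(ℝ, E) ∞ (fun q : E × E => (oneChart E G).symm q.2) q :=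
    ContMDiffAt.comp q a2 (contMDiffAt_iff_contDiffAt.2 contDiffAt_snd)
  have c : ContMDiffAt 𝓘(ℝ, E) 𝓘(ℝ, E) ∞ (oneChart E G)
      ((oneChart E G).symm q.1 * (oneChart E G).symm q.2) :=
    contMDiffOn_oneChart.contMDiffAt ((isOpen_extChartAt_source 1).mem_nhds h)
  exact ContMDiffAt.comp q c (b1.mul b2)

lemma exists_seminorm_le [FiniteDimensional ℝ E] (N : Seminorm ℝ (GroupLieAlgebra 𝓘(ℝ, E) G)) :
    ∃ K : ℝ, 0 ≤ K ∧ ∀ X : E, N X ≤ K * ‖X‖ := by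
  let N' : Seminorm ℝ E := N
  have hc : Continuous N' := continuousOn_univ.1 (N'.convexOn.continuousOn isOpen_univ)
  obtain ⟨C, hC, h⟩ := Seminorm.bound_of_continuous_normedSpace N' hc
  exact ⟨C, hC.le, h⟩

/-- Near `1`, the left-invariant distance to `1` is bounded by the distance in the chart. -/
theorem exists_leftEDist_one_le [FiniteDimensional ℝ E]
    (N : Seminorm ℝ (GroupLieAlgebra 𝓘(ℝ, E) G)) :
    ∃ (C : ℝ≥0) (R : ℝ), 0 < R ∧ ∀ y ∈ Metric.ball (oneChart E G 1) R,
      leftEDist N 1 ((oneChart E G).symm y) ≤ C * ‖y - oneChart E G 1‖ₑ := by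
  haveI := isManifold_of_lieGroup (E := E) (G := G)
  set e := oneChart E G 1 with he
  have he1 : e ∈ (oneChart E G).target := mem_extChartAt_target 1
  have hs1 : (1 : G) ∈ (oneChart E G).source := mem_extChartAt_source 1
  obtain ⟨K, hK, hNK⟩ := exists_seminorm_le N
  have hdiag : ∀ z ∈ (oneChart E G).target, ContDiffAt ℝ ∞ (chartDiv G) ((z, z) : E × E) :=
    fun z hz => contDiffAt_chartDiv hz hz (by rw [inv_mul_cancel]; exact hs1)
  -- For a straight segment in the chart, the translated velocity is the derivative of `chartDiv` on
  -- the diagonal, continuous and hence bounded near `e`.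
  have hcont : ContinuousAt (fun z : E => fderiv ℝ (chartDiv G) ((z, z) : E × E)) e := by
    have h : ContinuousAt (fderiv ℝ (chartDiv (E := E) G)) ((e, e) : E × E) :=
      ((hdiag e he1).fderiv_right (m := 0) (by simp)).continuousAt
    exact ContinuousAt.comp (f := fun z : E => (z, z)) h (by fun_prop)
  set K₁ := ‖fderiv ℝ (chartDiv G) ((e, e) : E × E)‖ + 1 with hK₁
  have hK₁0 : 0 ≤ K₁ := by positivity
  have hev : ∀ᶠ z in 𝓝 e, z ∈ (oneChart E G).target ∧
      ‖fderiv ℝ (chartDiv G) ((z, z) : E × E)‖ ≤ K₁ := by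
    have := (hcont.norm).eventually (gt_mem_nhds (lt_add_one _))
    filter_upwards [isOpen_oneChart_target.mem_nhds he1, this] with z hz hz' using ⟨hz, hz'.le⟩
  obtain ⟨R, hR, hball⟩ := Metric.eventually_nhds_iff_ball.1 hev
  obtain ⟨C, hC⟩ : ∃ C : ℝ≥0, (C : ℝ) = K * K₁ := ⟨⟨K * K₁, by positivity⟩, rfl⟩
  refine ⟨C, R, hR, fun y hy => ?_⟩
  letI : ∀ x : G, ENorm (TangentSpace 𝓘(ℝ, E) x) := leftENorm N
  haveI : ∀ x : G, ENormSMulClass ℝ (TangentSpace 𝓘(ℝ, E) x) := enormSMulClass_leftENorm N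
  set ℓ : ℝ → E := fun t => e + t • (y - e) with hℓ
  have hℓd : ∀ t, HasDerivAt ℓ (y - e) t := fun t => by
    simpa only [hℓ, one_smul, id] using ((hasDerivAt_id t).smul_const (y - e)).const_add e
  have hℓb : ∀ t ∈ Icc (0 : ℝ) 1, ℓ t ∈ Metric.ball e R := by
    intro t ht
    rw [Metric.mem_ball, dist_eq_norm] at hy ⊢
    simp only [hℓ, add_sub_cancel_left, norm_smul, Real.norm_eq_abs, abs_of_nonneg ht.1]
    exact (mul_le_of_le_one_left (norm_nonneg _) ht.2).trans_lt hy
  set γ : ℝ → G := fun t => (oneChart E G).symm (ℓ t) with hγ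
  have hℓc : ContDiff ℝ ∞ ℓ := by fun_prop
  have hγc : ContMDiffOn 𝓘(ℝ, ℝ) 𝓘(ℝ, E) 1 γ (Icc 0 1) := by
    refine ContMDiffOn.comp (t := (oneChart E G).target) (contMDiffOn_oneChart_symm.of_le (by simp))
      (contMDiffOn_iff_contDiffOn.2 (hℓc.of_le (by simp)).contDiffOn) fun t ht => ?_
    exact (hball _ (hℓb t ht)).1
  refine (Manifold.riemannianEDist_le_pathELength (I := 𝓘(ℝ, E)) hγc ?_ ?_ zero_le_one).trans ?_
  · simp only [hγ, hℓ, zero_smul, add_zero, he]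
    exact (oneChart E G).left_inv hs1
  · simp [hγ, hℓ]
  rw [Manifold.pathELength_eq_lintegral_mfderiv_Ioo]
  calc ∫⁻ t in Ioo (0 : ℝ) 1, _ ≤ ∫⁻ t in Ioo (0 : ℝ) 1,
        (C : ℝ≥0∞) * ‖y - e‖ₑ := by
        refine setLIntegral_mono measurable_const fun t ht => ?_
        have hn : Icc (0 : ℝ) 1 ∈ 𝓝 t := Icc_mem_nhds ht.1 ht.2
        have htb := hball _ (hℓb t (Ioo_subset_Icc_self ht))
        refine (leftENorm_mfderiv N ((hγc.contMDiffAt hn).mdifferentiableAt (by simp))).le.trans ?_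
        have hd : HasDerivAt (fun s => oneChart E G ((γ t)⁻¹ * γ s))
            (fderiv ℝ (chartDiv G) ((ℓ t, ℓ t) : E × E) (0, y - e)) t := by
          have h1 := ((hdiag _ htb.1).differentiableAt (by simp)).hasFDerivAt
          have h2 : HasDerivAt (fun s => (ℓ t, ℓ s)) ((0 : E), y - e) t :=
            (hasDerivAt_const t (ℓ t)).prodMk (hℓd t)
          exact h1.comp_hasDerivAt t h2
        rw [fderiv_apply_one_eq_deriv, hd.deriv]
        rw [← ofReal_norm, ← ENNReal.ofReal_coe_nnreal, ← ENNReal.ofReal_mul (by positivity)]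
        refine ENNReal.ofReal_le_ofReal ((hNK _).trans ?_)
        rw [hC, mul_assoc]
        gcongr
        refine (ContinuousLinearMap.le_opNorm _ _).trans ?_
        gcongr
        · exact htb.2
        · simp [Prod.norm_def]
    _ = _ := by simp

lemma tendsto_leftEDist_one [FiniteDimensional ℝ E]
    (N : Seminorm ℝ (GroupLieAlgebra 𝓘(ℝ, E) G)) :
    Tendsto (fun g : G => leftEDist N 1 g) (𝓝 1) (𝓝 0) := by
  obtain ⟨C, R, hR, h⟩ := exists_leftEDist_one_le N
  have hc : ContinuousAt (oneChart E G) 1 := continuousAt_extChartAt (I := 𝓘(ℝ, E)) (1 : G)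
  have h0 : Tendsto (fun g : G => (C : ℝ≥0∞) * ‖oneChart E G g - oneChart E G 1‖ₑ) (𝓝 1) (𝓝 0) := by
    have : Tendsto (fun g : G => ‖oneChart E G g - oneChart E G 1‖ₑ) (𝓝 1) (𝓝 0) := by
      have := (hc.sub_const (oneChart E G 1)).enorm
      simpa [ContinuousAt] using this
    simpa using ENNReal.Tendsto.const_mul this (Or.inr ENNReal.coe_ne_top)
  refine tendsto_of_tendsto_of_tendsto_of_le_of_le' tendsto_const_nhds h0
    (Eventually.of_forall fun _ => zero_le) ?_
  filter_upwards [hc.preimage_mem_nhds (Metric.ball_mem_nhds _ hR), extChartAt_source_mem_nhds (I := 𝓘(ℝ, E)) (1 : G)]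
    with g hg hg'
  have := h _ hg
  rwa [(oneChart E G).left_inv hg'] at this

/-- Left invariance and smallness near 1 make the identity continuous from the topology of `G` to
that of the distance; a pseudo-distance is jointly continuous for its own topology. -/
lemma continuous_leftEDist [FiniteDimensional ℝ E]
    (N : Seminorm ℝ (GroupLieAlgebra 𝓘(ℝ, E) G)) :
    Continuous fun q : G × G => leftEDist N q.1 q.2 := by
  haveI : IsTopologicalGroup G := topologicalGroup_of_lieGroup 𝓘(ℝ, E) ∞
  have hloc : ∀ g : G, Tendsto (fun h : G => leftEDist N g h) (𝓝 g) (𝓝 0) := by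
    intro g
    simp_rw [leftEDist_eq_one_inv_mul N g]
    refine (tendsto_leftEDist_one N).comp ?_
    have : ContinuousAt (fun h : G => g⁻¹ * h) g := by fun_prop
    simpa [ContinuousAt] using this
  let P : PseudoEMetricSpace G :=
    { edist := leftEDist N
      edist_self := leftEDist_self N
      edist_comm := leftEDist_comm N
      edist_triangle := leftEDist_triangle N }
  have hid : @Continuous G G _ P.toUniformSpace.toTopologicalSpace id := by
    rw [@continuous_iff_continuousAt G G _ P.toUniformSpace.toTopologicalSpace]
    intro g
    rw [@ContinuousAt.eq_1 G G _ P.toUniformSpace.toTopologicalSpace]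
    rw [@tendsto_iff_edist_tendsto_0 G G P]
    refine (hloc g).congr fun h => leftEDist_comm N _ _
  have hc := @continuous_edist G P
  have hq : @Continuous (G × G) (G × G) _ (@instTopologicalSpaceProd G G
      P.toUniformSpace.toTopologicalSpace P.toUniformSpace.toTopologicalSpace) id :=
    @Continuous.prodMap G G G G P.toUniformSpace.toTopologicalSpace
      P.toUniformSpace.toTopologicalSpace _ _ _ _ hid hid
  exact @Continuous.comp (G × G) (G × G) ℝ≥0∞ _ (@instTopologicalSpaceProd G G
      P.toUniformSpace.toTopologicalSpace P.toUniformSpace.toTopologicalSpace) _ _ _ hc hq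

end Metric

/-- A C¹ map is locally Lipschitz, hence Lipschitz on the compact image of the interval. -/
theorem AbsolutelyContinuousOnInterval.comp_contDiffOn {E E' : Type*} [NormedAddCommGroup E]
    [NormedSpace ℝ E] [NormedAddCommGroup E'] [NormedSpace ℝ E'] {y : ℝ → E} {F : E → E'}
    {O : Set E} {a b : ℝ} (hy : AbsolutelyContinuousOnInterval y a b) (hO : IsOpen O)
    (hF : ContDiffOn ℝ 1 F O) (hyO : MapsTo y (uIcc a b) O) :
    AbsolutelyContinuousOnInterval (fun t => F (y t)) a b := by
  have hcomp : IsCompact (y '' uIcc a b) := isCompact_uIcc.image_of_continuousOn hy.continuousOn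
  have hloc : LocallyLipschitzOn (y '' uIcc a b) F := by
    rintro x hx
    have hxO : x ∈ O := by
      obtain ⟨t, ht, rfl⟩ := hx
      exact hyO ht
    obtain ⟨K, t, ht, hK⟩ := (hF.contDiffAt (hO.mem_nhds hxO)).exists_lipschitzOnWith
    exact ⟨K, t, mem_nhdsWithin_of_mem_nhds ht, hK⟩
  obtain ⟨K, hK⟩ := hloc.exists_lipschitzOnWith_of_compact hcomp
  exact absolutelyContinuousOnInterval_of_dist_le (K := K) hy fun s hs t ht =>
    hK.dist_le_mul _ (mem_image_of_mem y hs) _ (mem_image_of_mem y ht)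

/-! ### Left-invariant vector fields in the chart at 1. -/

section Field

variable {E : Type*} [NormedAddCommGroup E] [NormedSpace ℝ E]
  {G : Type*} [TopologicalSpace G] [ChartedSpace E G] [Group G] [LieGroup 𝓘(ℝ, E) ∞ G]

lemma one_mem_oneChart_source : (1 : G) ∈ (oneChart E G).source := mem_extChartAt_source 1

lemma oneChart_one_mem_target : oneChart E G 1 ∈ (oneChart E G).target := mem_extChartAt_target 1

lemma oneChart_symm_oneChart_one : (oneChart E G).symm (oneChart E G 1) = 1 :=
  (oneChart E G).left_inv one_mem_oneChart_source

lemma HasMFDerivAt.hasFDerivAt_oneChart {F : G → E} {A : E →L[ℝ] E}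
    (h : HasMFDerivAt 𝓘(ℝ, E) 𝓘(ℝ, E) F (1 : G) A) :
    HasFDerivAt (fun z => F ((oneChart E G).symm z)) A (oneChart E G 1) := by
  have h2 := h.2
  simp only [writtenInExtChartAt, extChartAt_model_space_eq_id, Function.comp_def,
    modelWithCornersSelf_coe, range_id] at h2
  exact hasFDerivWithinAt_univ.1 h2

variable (G) in
/-- The left-invariant vector field with value `X` at `1`, in the chart at `1`. -/
noncomputable def chartField (y X : E) : E :=
  fderiv ℝ (chartMul G) ((y, oneChart E G 1) : E × E) (0, X)

lemma contDiffAt_chartMul_one {y : E} (hy : y ∈ (oneChart E G).target) :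
    ContDiffAt ℝ ∞ (chartMul G) ((y, oneChart E G 1) : E × E) := by
  refine contDiffAt_chartMul hy oneChart_one_mem_target ?_
  rw [oneChart_symm_oneChart_one, mul_one]
  exact (oneChart E G).map_target hy

/-- The derivative at `1` of left multiplication, in the chart at `1`. -/
lemma hasMFDerivAt_oneChart_mul {y : E} (hy : y ∈ (oneChart E G).target) :
    ∃ A : E →L[ℝ] E, HasMFDerivAt 𝓘(ℝ, E) 𝓘(ℝ, E)
      (fun h : G => oneChart E G ((oneChart E G).symm y * h)) 1 A ∧ ∀ X, A X = chartField G y X := by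
  have hm : MDifferentiableAt 𝓘(ℝ, E) 𝓘(ℝ, E)
      (fun h : G => oneChart E G ((oneChart E G).symm y * h)) 1 := by
    refine MDifferentiableAt.comp (1 : G) (g := oneChart E G) ?_ (mdifferentiableAt_mul_left _ 1)
    rw [mul_one]
    exact (contMDiffOn_oneChart.contMDiffAt ((isOpen_extChartAt_source 1).mem_nhds
      ((oneChart E G).map_target hy))).mdifferentiableAt (by simp)
  obtain ⟨A, hA⟩ : ∃ A : E →L[ℝ] E, HasMFDerivAt 𝓘(ℝ, E) 𝓘(ℝ, E)
      (fun h : G => oneChart E G ((oneChart E G).symm y * h)) 1 A := ⟨_, hm.hasMFDerivAt⟩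
  refine ⟨A, hA, fun X => ?_⟩
  have h1 : HasFDerivAt (fun z => chartMul G ((y, z) : E × E)) A (oneChart E G 1) :=
    HasMFDerivAt.hasFDerivAt_oneChart hA
  have h2 : HasFDerivAt (fun z => chartMul G ((y, z) : E × E))
      ((fderiv ℝ (chartMul G) ((y, oneChart E G 1) : E × E)).comp (ContinuousLinearMap.inr ℝ E E))
      (oneChart E G 1) :=
    (((contDiffAt_chartMul_one hy).differentiableAt (by simp)).hasFDerivAt).comp (oneChart E G 1)
      (hasFDerivAt_prodMk_right y (oneChart E G 1))
  rw [h1.unique h2]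
  rfl

/-- A curve with velocity `Γ X` has velocity `chartField (y, X)` in the chart translated by `g`. -/
lemma hasDerivAt_oneChart_of_hasMFDerivAt {Γ : ℝ → G} {x : ℝ} {X : GroupLieAlgebra 𝓘(ℝ, E) G}
    (h : HasMFDerivAt 𝓘(ℝ, ℝ) 𝓘(ℝ, E) Γ x
      ((1 : ℝ →L[ℝ] ℝ).smulRight (mulInvariantVectorField X (Γ x)))) {g : G}
    (hg : g⁻¹ * Γ x ∈ (oneChart E G).source) :
    HasDerivAt (fun s => oneChart E G (g⁻¹ * Γ s))
      (chartField G (oneChart E G (g⁻¹ * Γ x)) X) x := by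
  have hF : MDifferentiableAt 𝓘(ℝ, E) 𝓘(ℝ, E) (fun h : G => oneChart E G (g⁻¹ * h)) (Γ x) := by
    refine MDifferentiableAt.comp (Γ x) (g := oneChart E G) ?_ (mdifferentiableAt_mul_left _ _)
    exact (contMDiffOn_oneChart.contMDiffAt ((isOpen_extChartAt_source 1).mem_nhds
      hg)).mdifferentiableAt (by simp)
  obtain ⟨D, hD⟩ : ∃ D : E →L[ℝ] E, HasMFDerivAt 𝓘(ℝ, E) 𝓘(ℝ, E)
      (fun h : G => oneChart E G (g⁻¹ * h)) (Γ x) D := ⟨_, hF.hasMFDerivAt⟩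
  obtain ⟨B, hB⟩ : ∃ B : E →L[ℝ] E, HasMFDerivAt 𝓘(ℝ, E) 𝓘(ℝ, E)
      (fun h : G => Γ x * h) 1 B ∧ B X = mulInvariantVectorField X (Γ x) :=
    ⟨mfderiv 𝓘(ℝ, E) 𝓘(ℝ, E) (fun h : G => Γ x * h) 1,
      (mdifferentiableAt_mul_left (Γ x) 1).hasMFDerivAt, rfl⟩
  have hD' : HasMFDerivAt 𝓘(ℝ, E) 𝓘(ℝ, E)
      (fun h : G => oneChart E G (g⁻¹ * h)) (Γ x * 1) D := by rw [mul_one]; exact hD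
  have hDB : HasMFDerivAt 𝓘(ℝ, E) 𝓘(ℝ, E)
      (fun h : G => oneChart E G (g⁻¹ * (Γ x * h))) 1 (D.comp B) := hD'.comp (1 : G) hB.1
  obtain ⟨A, hA, hAX⟩ := hasMFDerivAt_oneChart_mul ((oneChart E G).map_source hg)
  rw [(oneChart E G).left_inv hg] at hA
  -- The map `h ↦ oneChart E G (g⁻¹ * Γ x * h)` is differentiated at 1 in two ways; the equality
  -- expresses the left invariance of the field.
  have hAeq : D.comp B = A := hasMFDerivAt_unique hDB
    (hA.congr_of_eventuallyEq (Eventually.of_forall fun h => by simp only [mul_assoc]))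
  have hcomp := hD.comp x h
  have hfd : HasFDerivAt (fun s => oneChart E G (g⁻¹ * Γ s))
      (D.comp ((1 : ℝ →L[ℝ] ℝ).smulRight (mulInvariantVectorField X (Γ x) : E))) x :=
    hasMFDerivAt_iff_hasFDerivAt.1 hcomp
  have hd := hfd.hasDerivAt
  convert hd using 1
  rw [← hAX X, ← hAeq]
  change D (B X) = D ((1 : ℝ) • (mulInvariantVectorField X (Γ x) : E))
  rw [one_smul]
  exact congrArg D hB.2

/-- A curve that solves the equation in the chart translated by `g` solves the equation in `G`. -/
lemma hasMFDerivAt_of_hasDerivAt_oneChart {y : ℝ → E} {x : ℝ} {X : GroupLieAlgebra 𝓘(ℝ, E) G}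
    (h : HasDerivAt y (chartField G (y x) X) x) (hy : y x ∈ (oneChart E G).target) (g : G) :
    HasMFDerivAt 𝓘(ℝ, ℝ) 𝓘(ℝ, E) (fun s => g * (oneChart E G).symm (y s)) x
      ((1 : ℝ →L[ℝ] ℝ).smulRight
        (mulInvariantVectorField X (g * (oneChart E G).symm (y x)))) := by
  have hF : MDifferentiableAt 𝓘(ℝ, E) 𝓘(ℝ, E) (fun z : E => g * (oneChart E G).symm z) (y x) := by
    refine MDifferentiableAt.comp (y x) (g := fun h : G => g * h) (mdifferentiableAt_mul_left _ _) ?_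
    exact (contMDiffOn_oneChart_symm.contMDiffAt
      (isOpen_oneChart_target.mem_nhds hy)).mdifferentiableAt (by simp)
  obtain ⟨D, hD⟩ : ∃ D : E →L[ℝ] E, HasMFDerivAt 𝓘(ℝ, E) 𝓘(ℝ, E)
      (fun z : E => g * (oneChart E G).symm z) (y x) D := ⟨_, hF.hasMFDerivAt⟩
  obtain ⟨A, hA, hAX⟩ := hasMFDerivAt_oneChart_mul (G := G) hy
  have hQ : oneChart E G ((oneChart E G).symm (y x) * 1) = y x := by
    rw [mul_one, (oneChart E G).right_inv hy]
  have hD' : HasMFDerivAt 𝓘(ℝ, E) 𝓘(ℝ, E) (fun z : E => g * (oneChart E G).symm z)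
      (oneChart E G ((oneChart E G).symm (y x) * 1)) D := by rw [hQ]; exact hD
  have hDA : HasMFDerivAt 𝓘(ℝ, E) 𝓘(ℝ, E) (fun h : G => g * (oneChart E G).symm
      (oneChart E G ((oneChart E G).symm (y x) * h))) 1 (D.comp A) :=
    HasMFDerivAt.comp (f := fun h : G => oneChart E G ((oneChart E G).symm (y x) * h))
      (g := fun z : E => g * (oneChart E G).symm z) (1 : G) hD' hA
  haveI : IsTopologicalGroup G := topologicalGroup_of_lieGroup 𝓘(ℝ, E) ∞
  have hev : (fun h : G => g * (oneChart E G).symm (y x) * h) =ᶠ[𝓝 1]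
      fun h : G => g * (oneChart E G).symm (oneChart E G ((oneChart E G).symm (y x) * h)) := by
    have hc : ContinuousAt (fun h : G => (oneChart E G).symm (y x) * h) 1 := by fun_prop
    have hmem : (oneChart E G).source ∈ 𝓝 ((oneChart E G).symm (y x) * 1) :=
      (isOpen_extChartAt_source 1).mem_nhds (by rw [mul_one]; exact (oneChart E G).map_target hy)
    filter_upwards [hc.preimage_mem_nhds hmem] with h hh
    rw [(oneChart E G).left_inv hh, mul_assoc]
  have hB := hDA.congr_of_eventuallyEq hev
  have hBX : (mulInvariantVectorField X (g * (oneChart E G).symm (y x)) : E) = D (A X) := by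
    have := hB.mfderiv
    exact congrArg (fun T : E →L[ℝ] E => T X) this
  rw [hAX X] at hBX
  obtain ⟨S, hS⟩ : ∃ S : ℝ →L[ℝ] E, ∀ t, S t = t • chartField G (y x) X :=
    ⟨(1 : ℝ →L[ℝ] ℝ).smulRight (chartField G (y x) X), fun _ => rfl⟩
  have hy' : HasMFDerivAt 𝓘(ℝ, ℝ) 𝓘(ℝ, E) y x S := by
    refine hasMFDerivAt_iff_hasFDerivAt.2 ?_
    have : S = ContinuousLinearMap.toSpanSingleton ℝ (chartField G (y x) X) := by
      ext
      simp [hS]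
    rw [this]
    exact h.hasFDerivAt
  have hfin := HasMFDerivAt.comp (f := y) (g := fun z : E => g * (oneChart E G).symm z) x hD hy'
  refine HasMFDerivAt.congr_mfderiv hfin ?_
  have key : ∀ t : ℝ, D (S t) =
      t • (mulInvariantVectorField X (g * (oneChart E G).symm (y x)) : E) := fun t => by
    rw [hS, map_smul, ← hBX]
    rfl
  exact ContinuousLinearMap.ext key

/-- The left-invariant vector fields generated by `w` and `v` in the chart at `1`, cut off to all
of `E`. -/
theorem exists_chartField_extension [FiniteDimensional ℝ E] (w v : E) :
    ∃ (M : E → ℂ →L[ℝ] E) (R : ℝ) (K L : ℝ≥0), 0 < R ∧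
      Metric.ball (oneChart E G 1) R ⊆ (oneChart E G).target ∧ (∀ y, ‖M y‖ ≤ K) ∧
      LipschitzWith L M ∧ ∀ y ∈ Metric.ball (oneChart E G 1) R, ∀ c : ℂ,
        M y c = chartField G y (c.re • w + c.im • v) := by
  set e := oneChart E G 1 with he
  let T : ℂ →L[ℝ] E := Complex.reCLM.smulRight w + Complex.imCLM.smulRight v
  let A : E → ℂ →L[ℝ] E := fun y =>
    ((fderiv ℝ (chartMul G) ((y, e) : E × E)).comp (ContinuousLinearMap.inr ℝ E E)).comp T
  have hA : ∀ y ∈ (oneChart E G).target, ContDiffAt ℝ 1 A y := by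
    intro y hy
    have h1 : ContDiffAt ℝ 1 (fderiv ℝ (chartMul (E := E) G)) ((y, e) : E × E) :=
      (contDiffAt_chartMul_one hy).fderiv_right (by norm_cast)
    have h2 : ContDiffAt ℝ 1 (fun y : E => fderiv ℝ (chartMul G) ((y, e) : E × E)) y :=
      ContDiffAt.comp y (f := fun y : E => ((y, e) : E × E)) h1 (by fun_prop)
    exact (h2.clm_comp contDiffAt_const).clm_comp contDiffAt_const
  obtain ⟨R, hR, hball⟩ := Metric.isOpen_iff.1 (isOpen_oneChart_target (E := E) (G := G)) e
    oneChart_one_mem_target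
  -- The bump makes the field globally bounded and Lipschitz, so that Picard iteration runs in all
  -- of `E`, and leaves it unchanged on the ball of radius `R / 3`.
  let χ : ContDiffBump e := ⟨R / 3, R / 2, by positivity, by linarith⟩
  let M : E → ℂ →L[ℝ] E := fun y => χ y • A y
  have hts : tsupport M ⊆ Metric.closedBall e (R / 2) := by
    have : tsupport M ⊆ tsupport χ := closure_mono (Function.support_smul_subset_left χ A)
    rwa [χ.tsupport_eq] at this
  have hM : ContDiff ℝ 1 M := by
    refine contDiff_iff_contDiffAt.2 fun y => ?_
    by_cases hy : y ∈ tsupport M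
    · exact χ.contDiffAt.smul (hA y (hball
        (Metric.closedBall_subset_ball (by linarith) (hts hy))))
    · exact contDiffAt_const.congr_of_eventuallyEq (notMem_tsupport_iff_eventuallyEq.1 hy)
  have hMc : HasCompactSupport M := HasCompactSupport.of_support_subset_isCompact
    (isCompact_closedBall e (R / 2)) ((subset_tsupport M).trans hts)
  obtain ⟨L, hL⟩ := hM.lipschitzWith_of_hasCompactSupport hMc (by simp)
  obtain ⟨K, hK⟩ := hMc.exists_bound_of_continuous hM.continuous
  refine ⟨M, R / 3, K.toNNReal, L, by positivity,
    (Metric.ball_subset_ball (by linarith)).trans hball,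
    fun y => (hK y).trans (Real.le_coe_toNNReal K), hL, fun y hy c => ?_⟩
  have hχ : χ y = 1 := χ.one_of_mem_closedBall (Metric.ball_subset_closedBall hy)
  simp only [M, hχ, one_smul]
  rfl

end Field

theorem AbsolutelyContinuousOnInterval.congr {X : Type*} [PseudoMetricSpace X] {f g : ℝ → X}
    {a b : ℝ} (hf : AbsolutelyContinuousOnInterval f a b) (h : EqOn f g (uIcc a b)) :
    AbsolutelyContinuousOnInterval g a b :=
  absolutelyContinuousOnInterval_of_dist_le (K := 1) hf fun x hx y hy => by
    rw [← h hx, ← h hy, one_mul]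

lemma integrableOn_field {E : Type*} [NormedAddCommGroup E] [NormedSpace ℝ E]
    [FiniteDimensional ℝ E] {M : E → ℂ →L[ℝ] E} {K : ℝ} (hMK : ∀ y, ‖M y‖ ≤ K) (hM : Continuous M)
    {y : ℝ → E} {c : ℝ → ℂ} {S : Set ℝ} (hS : MeasurableSet S) (hy : ContinuousOn y S)
    (hc : IntegrableOn c S) : IntegrableOn (fun τ => M (y τ) (c τ)) S := by
  refine Integrable.mono' (hc.norm.const_mul K) ?_ (ae_of_all _ fun τ => ?_)
  · have h1 : AEStronglyMeasurable (fun τ => M (y τ)) (volume.restrict S) :=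
      (hM.comp_continuousOn hy).aestronglyMeasurable hS
    exact (ContinuousLinearMap.id ℝ (ℂ →L[ℝ] E)).aestronglyMeasurable_comp₂ h1
      hc.aestronglyMeasurable
  · exact ((M (y τ)).le_opNorm _).trans (by gcongr; exact hMK _)

/-! ### Carathéodory solutions on intervals, in the group and in the chart. -/

section Solutions

variable {E : Type*} [NormedAddCommGroup E] [NormedSpace ℝ E]
  {G : Type*} [TopologicalSpace G] [ChartedSpace E G] [Group G]

/-- The curve `Γ` is a Carathéodory solution of `Γ' = Γ (Re c w + Im c v)` on `[a, b]`. Absolute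
continuity is expressed through all `C¹` functions on `G`. -/
structure IsSolOn (w v : GroupLieAlgebra 𝓘(ℝ, E) G) (c : ℝ → ℂ) (Γ : ℝ → G) (a b : ℝ) :
    Prop where
  continuousOn : ContinuousOn Γ (Icc a b)
  ac : ∀ (F : G → E) (O : Set G), IsOpen O → ContMDiffOn 𝓘(ℝ, E) 𝓘(ℝ, E) 1 F O →
    ∀ a' b', a' ≤ b' → Icc a' b' ⊆ Icc a b → MapsTo Γ (Icc a' b') O →
      AbsolutelyContinuousOnInterval (fun t => F (Γ t)) a' b'
  ode : ∀ᵐ x : ℝ, x ∈ Ioo a b → HasMFDerivAt 𝓘(ℝ, ℝ) 𝓘(ℝ, E) Γ x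
    ((1 : ℝ →L[ℝ] ℝ).smulRight (mulInvariantVectorField ((c x).re • w + (c x).im • v) (Γ x)))

variable {w v : GroupLieAlgebra 𝓘(ℝ, E) G} {c : ℝ → ℂ} {Γ : ℝ → G} {a b : ℝ}

lemma IsSolOn.mono (h : IsSolOn w v c Γ a b) {a' b' : ℝ} (ha : a ≤ a') (hb : b' ≤ b) :
    IsSolOn w v c Γ a' b' where
  continuousOn := h.continuousOn.mono (Icc_subset_Icc ha hb)
  ac F O hO hF a'' b'' hab hs hm := h.ac F O hO hF a'' b'' hab (hs.trans (Icc_subset_Icc ha hb)) hm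
  ode := by
    filter_upwards [h.ode] with x hx hx'
    exact hx (Ioo_subset_Ioo ha hb hx')

lemma IsSolOn.congr (h : IsSolOn w v c Γ a b) {Γ' : ℝ → G} {c' : ℝ → ℂ}
    (hΓ : EqOn Γ Γ' (Icc a b)) (hc : ∀ᵐ x, x ∈ Ioo a b → c x = c' x) :
    IsSolOn w v c' Γ' a b where
  continuousOn := h.continuousOn.congr hΓ.symm
  ac F O hO hF a' b' hab hs hm :=
    AbsolutelyContinuousOnInterval.congr (h.ac F O hO hF a' b' hab hs fun x hx => by
      rw [hΓ (hs hx)]; exact hm hx) fun x hx => by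
        rw [uIcc_of_le hab] at hx
        simp only [hΓ (hs hx)]
  ode := by
    filter_upwards [h.ode, hc] with x hx hcx hx'
    have hev : Γ' =ᶠ[𝓝 x] Γ := by
      filter_upwards [Ioo_mem_nhds hx'.1 hx'.2] with z hz using (hΓ (Ioo_subset_Icc_self hz)).symm
    have := (hx hx').congr_of_eventuallyEq hev
    rw [hcx hx', hΓ (Ioo_subset_Icc_self hx')] at this
    exact this

lemma IsSolOn.trans {d : ℝ} (hab : a ≤ b) (hbd : b ≤ d) (h : IsSolOn w v c Γ a b)
    (h' : IsSolOn w v c Γ b d) : IsSolOn w v c Γ a d where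
  continuousOn := by
    rw [← Icc_union_Icc_eq_Icc hab hbd]
    exact h.continuousOn.union_of_isClosed h'.continuousOn isClosed_Icc isClosed_Icc
  ac F O hO hF a' b' hab' hs hm := by
    have ha' := (hs (left_mem_Icc.2 hab')).1
    have hb' := (hs (right_mem_Icc.2 hab')).2
    rcases le_total b' b with hb | hb
    · exact h.ac F O hO hF a' b' hab' (Icc_subset_Icc ha' hb) hm
    rcases le_total b a' with ha | ha
    · exact h'.ac F O hO hF a' b' hab' (Icc_subset_Icc ha hb') hm
    exact absolutelyContinuousOnInterval_trans ha hb
      (h.ac F O hO hF a' b ha (Icc_subset_Icc ha' le_rfl) (hm.mono_left (Icc_subset_Icc le_rfl hb)))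
      (h'.ac F O hO hF b b' hb (Icc_subset_Icc le_rfl hb') (hm.mono_left (Icc_subset_Icc ha le_rfl)))
  ode := by
    have hb : ∀ᵐ x : ℝ, x ≠ b := by simp [ae_iff, measure_singleton]
    filter_upwards [h.ode, h'.ode, hb] with x hx hx' hxb hxI
    rcases lt_or_gt_of_ne hxb with h1 | h1
    · exact hx ⟨hxI.1, h1⟩
    · exact hx' ⟨h1, hxI.2⟩

variable [LieGroup 𝓘(ℝ, E) ∞ G]

/-- Near each time, `F ∘ Γ` is a C¹ map applied to the curve read in one chart, which is absolutely
continuous; locality of absolute continuity does the rest. -/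
lemma isSolOn_of_isLocallyAC (hΓ : IsLocallyAC E Γ)
    (hode : ∀ᵐ x : ℝ, HasMFDerivAt 𝓘(ℝ, ℝ) 𝓘(ℝ, E) Γ x ((1 : ℝ →L[ℝ] ℝ).smulRight
      (mulInvariantVectorField ((c x).re • w + (c x).im • v) (Γ x)))) (a b : ℝ) :
    IsSolOn w v c Γ a b where
  continuousOn := hΓ.continuous.continuousOn
  ac F O hO hF a' b' hab' hs hm := by
    haveI := isManifold_of_lieGroup (E := E) (G := G)
    refine absolutelyContinuousOnInterval_of_local hab' fun u hu => ?_
    set φ := extChartAt 𝓘(ℝ, E) (Γ u) with hφ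
    have hnhds : Γ ⁻¹' (φ.source ∩ O) ∈ 𝓝 u :=
      hΓ.continuous.continuousAt.preimage_mem_nhds (((isOpen_extChartAt_source (Γ u)).inter
        hO).mem_nhds ⟨mem_extChartAt_source (Γ u), hm hu⟩)
    obtain ⟨ε, hε, hball⟩ := Metric.mem_nhds_iff.1 hnhds
    refine ⟨ε, hε, fun p q hpq _ hpb => ?_⟩
    have hsrc : ∀ t ∈ Icc p q, Γ t ∈ φ.source ∩ O := fun t ht => hball (hpb ht)
    have h1 := hΓ.absolutelyContinuous (Γ u) p q hpq fun t ht => by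
      have := (hsrc t ht).1
      rwa [hφ, extChartAt_source] at this
    have hopen : IsOpen (φ.target ∩ φ.symm ⁻¹' O) :=
      (continuousOn_extChartAt_symm (Γ u)).isOpen_inter_preimage (isOpen_extChartAt_target (Γ u)) hO
    have hcd : ContDiffOn ℝ 1 (fun z => F (φ.symm z)) (φ.target ∩ φ.symm ⁻¹' O) := by
      rw [← contMDiffOn_iff_contDiffOn]
      refine hF.comp ?_ fun z hz => hz.2
      exact ((contMDiffOn_extChartAt_symm (n := ∞) (Γ u)).of_le (by simp)).mono inter_subset_left
    have h2 := AbsolutelyContinuousOnInterval.comp_contDiffOn h1 hopen hcd (fun t ht => by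
      rw [uIcc_of_le hpq] at ht
      refine ⟨φ.map_source (hsrc t ht).1, ?_⟩
      rw [mem_preimage, φ.left_inv (hsrc t ht).1]
      exact (hsrc t ht).2)
    refine AbsolutelyContinuousOnInterval.congr h2 fun t ht => ?_
    rw [uIcc_of_le hpq] at ht
    exact congrArg F (φ.left_inv (hsrc t ht).1)
  ode := by
    filter_upwards [hode] with x hx _ using hx

/-- The charts themselves are among the C¹ test functions of `IsSolOn`. -/
lemma isLocallyAC_of_isSolOn (h : ∀ n : ℕ, IsSolOn w v c Γ (-n) n) : IsLocallyAC E Γ where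
  continuous := by
    rw [continuous_iff_continuousAt]
    intro x
    obtain ⟨n, hn⟩ := exists_nat_gt |x|
    exact (h n).continuousOn.continuousAt (Icc_mem_nhds (neg_lt_of_abs_lt hn) (lt_of_abs_lt hn))
  absolutelyContinuous g a b hab hs := by
    haveI := isManifold_of_lieGroup (E := E) (G := G)
    obtain ⟨n, hn⟩ := exists_nat_ge (max |a| |b|)
    refine (h n).ac (extChartAt 𝓘(ℝ, E) g) (chartAt E g).source (chartAt E g).open_source
      ((contMDiffOn_extChartAt (n := ∞)).of_le (by simp)) a b hab (Icc_subset_Icc ?_ ?_) hs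
    · exact neg_le_of_abs_le ((le_max_left _ _).trans hn)
    · exact le_of_abs_le ((le_max_right _ _).trans hn)

lemma ae_hasMFDerivAt_of_isSolOn (h : ∀ n : ℕ, IsSolOn w v c Γ (-n) n) :
    ∀ᵐ x : ℝ, HasMFDerivAt 𝓘(ℝ, ℝ) 𝓘(ℝ, E) Γ x ((1 : ℝ →L[ℝ] ℝ).smulRight
      (mulInvariantVectorField ((c x).re • w + (c x).im • v) (Γ x))) := by
  filter_upwards [ae_all_iff.2 fun n => (h n).ode] with x hx
  obtain ⟨n, hn⟩ := exists_nat_gt |x|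
  exact hx n ⟨neg_lt_of_abs_lt hn, lt_of_abs_lt hn⟩

section Chart

variable [FiniteDimensional ℝ E] {M : E → ℂ →L[ℝ] E} {R K : ℝ}

/-- A curve that solves the integral equation in the chart at `1` is a solution in `G`. -/
theorem isSolOn_of_chart (hR : Metric.ball (oneChart E G 1) R ⊆ (oneChart E G).target)
    (hM : Continuous M) (hMK : ∀ y, ‖M y‖ ≤ K)
    (hMf : ∀ y ∈ Metric.ball (oneChart E G 1) R, ∀ c : ℂ,
      M y c = chartField G y (c.re • w + c.im • v))
    (hab : a ≤ b) (hc : IntervalIntegrable c volume a b) {y : ℝ → E}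
    (hy : ContinuousOn y (Icc a b)) (hyR : MapsTo y (Icc a b) (Metric.ball (oneChart E G 1) R))
    (heq : ∀ x ∈ Icc a b, y x = y a + ∫ τ in a..x, M (y τ) (c τ)) (g : G) :
    IsSolOn w v c (fun x => g * (oneChart E G).symm (y x)) a b := by
  haveI : IsTopologicalGroup G := topologicalGroup_of_lieGroup 𝓘(ℝ, E) ∞
  have hint : IntervalIntegrable (fun τ => M (y τ) (c τ)) volume a b := by
    rw [intervalIntegrable_iff_integrableOn_Icc_of_le hab] at hc ⊢
    exact integrableOn_field hMK hM measurableSet_Icc hy hc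
  have hyac : ∀ a' b', a' ≤ b' → Icc a' b' ⊆ Icc a b → AbsolutelyContinuousOnInterval y a' b' := by
    intro a' b' hab' hs
    have h1 : AbsolutelyContinuousOnInterval y a b := by
      refine absolutelyContinuousOnInterval_of_dist_le (K := 1)
        (absolutelyContinuousOnInterval_integral hint left_mem_uIcc) fun s hs t ht => ?_
      rw [uIcc_of_le hab] at hs ht
      rw [heq s hs, heq t ht, dist_add_left, one_mul]
    exact h1.mono (by rwa [uIcc_of_le hab, uIcc_of_le hab'])
  refine ⟨?_, fun F O hO hF a' b' hab' hs hm => ?_, ?_⟩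
  · refine ContinuousOn.mul continuousOn_const ?_
    exact (continuousOn_extChartAt_symm (1 : G)).comp hy fun x hx => hR (hyR hx)
  · have hct : ContinuousOn (fun z : E => g * (oneChart E G).symm z) (oneChart E G).target :=
      continuousOn_const.mul (continuousOn_extChartAt_symm (1 : G))
    have hopen := hct.isOpen_inter_preimage isOpen_oneChart_target hO
    refine AbsolutelyContinuousOnInterval.comp_contDiffOn
      (F := fun z => F (g * (oneChart E G).symm z)) (hyac a' b' hab' hs) hopen ?_ fun t ht => ?_
    · rw [← contMDiffOn_iff_contDiffOn]
      refine hF.comp ?_ fun z hz => hz.2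
      refine (contMDiff_mul_left_one g).comp_contMDiffOn ?_
      exact (contMDiffOn_oneChart_symm.of_le (by simp)).mono inter_subset_left
    · rw [uIcc_of_le hab'] at ht
      exact ⟨hR (hyR (hs ht)), hm ht⟩
  · filter_upwards [hint.ae_hasDerivAt_integral] with x hx hxI
    have hxI' : x ∈ Icc a b := Ioo_subset_Icc_self hxI
    have hd := hx (by rwa [uIcc_of_le hab]) a left_mem_uIcc
    have hd' : HasDerivAt y (M (y x) (c x)) x := by
      refine (hd.const_add (y a)).congr_of_eventuallyEq ?_
      filter_upwards [Ioo_mem_nhds hxI.1 hxI.2] with z hz using heq z (Ioo_subset_Icc_self hz)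
    rw [hMf _ (hyR hxI')] at hd'
    exact hasMFDerivAt_of_hasDerivAt_oneChart hd' (hR (hyR hxI')) g

/-- A solution in `G` that stays in a translate of the chart at `1` solves the integral equation
in that chart. -/
theorem IsSolOn.chart_eq_integral (hM : Continuous M) (hMK : ∀ y, ‖M y‖ ≤ K)
    (hMf : ∀ y ∈ Metric.ball (oneChart E G 1) R, ∀ c : ℂ,
      M y c = chartField G y (c.re • w + c.im • v))
    (h : IsSolOn w v c Γ a b) (hc : IntervalIntegrable c volume a b) {g : G}
    (hsrc : ∀ x ∈ Icc a b, g⁻¹ * Γ x ∈ (oneChart E G).source)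
    (hyR : ∀ x ∈ Icc a b, oneChart E G (g⁻¹ * Γ x) ∈ Metric.ball (oneChart E G 1) R)
    (hab : a ≤ b) :
    ContinuousOn (fun x => oneChart E G (g⁻¹ * Γ x)) (Icc a b) ∧
    IntervalIntegrable (fun τ => M (oneChart E G (g⁻¹ * Γ τ)) (c τ)) volume a b ∧
    ∀ x ∈ Icc a b, ∀ z ∈ Icc a b, x ≤ z →
      oneChart E G (g⁻¹ * Γ z) - oneChart E G (g⁻¹ * Γ x) =
        ∫ τ in x..z, M (oneChart E G (g⁻¹ * Γ τ)) (c τ) := by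
  haveI : IsTopologicalGroup G := topologicalGroup_of_lieGroup 𝓘(ℝ, E) ∞
  have hcont : ContinuousOn (fun x => oneChart E G (g⁻¹ * Γ x)) (Icc a b) :=
    (continuousOn_extChartAt (1 : G)).comp (continuousOn_const.mul h.continuousOn) hsrc
  have hint : IntervalIntegrable (fun τ => M (oneChart E G (g⁻¹ * Γ τ)) (c τ)) volume a b := by
    rw [intervalIntegrable_iff_integrableOn_Icc_of_le hab] at hc ⊢
    exact integrableOn_field hMK hM measurableSet_Icc hcont hc
  refine ⟨hcont, hint, fun x hx z hz hxz => ?_⟩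
  have hsub : Icc x z ⊆ Icc a b := Icc_subset_Icc hx.1 hz.2
  have hopen : IsOpen ((fun h : G => g⁻¹ * h) ⁻¹' (oneChart E G).source) :=
    (isOpen_extChartAt_source (1 : G)).preimage (by fun_prop)
  have hac := h.ac (fun h => oneChart E G (g⁻¹ * h)) _ hopen
    ((contMDiffOn_oneChart.of_le (by simp)).comp (contMDiff_mul_left_one g⁻¹).contMDiffOn
      fun z hz => hz) x z hxz hsub fun t ht => hsrc t (hsub ht)
  refine (integral_eq_sub_of_absolutelyContinuous hac ?_
    (hint.mono_set (by rwa [uIcc_of_le hab, uIcc_of_le hxz]))).symm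
  have hx' : ∀ᵐ t : ℝ, t ≠ x := by simp [ae_iff, measure_singleton]
  have hz' : ∀ᵐ t : ℝ, t ≠ z := by simp [ae_iff, measure_singleton]
  filter_upwards [h.ode, hx', hz'] with t ht htx htz htI
  rw [uIcc_of_le hxz] at htI
  have htab := hsub htI
  have := hasDerivAt_oneChart_of_hasMFDerivAt (ht ⟨hx.1.trans_lt (lt_of_le_of_ne htI.1 htx.symm),
    (lt_of_le_of_ne htI.2 htz).trans_le hz.2⟩) (hsrc t htab)
  rwa [hMf _ (hyR t htab)]

end Chart

end Solutions

lemma norm_intervalIntegral_le_integral {E : Type*} [NormedAddCommGroup E] [NormedSpace ℝ E]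
    {F : ℝ → E} {g : ℝ → ℝ} (hg : Integrable g) (h : ∀ t, ‖F t‖ ≤ g t) (a b : ℝ) :
    ‖∫ t in a..b, F t‖ ≤ ∫ t, g t := by
  have hg0 : ∀ t, 0 ≤ g t := fun t => (norm_nonneg _).trans (h t)
  refine (intervalIntegral.norm_integral_le_abs_of_norm_le (ae_of_all _ h)
    hg.intervalIntegrable).trans ?_
  rw [intervalIntegral.abs_integral_eq_abs_integral_uIoc,
    abs_of_nonneg (integral_nonneg hg0)]
  exact setIntegral_le_integral hg (ae_of_all _ hg0)

/-! ### Picard iteration and dependence on the coefficient. -/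

section Picard

open BoundedContinuousFunction

variable {E : Type*} [NormedAddCommGroup E] [NormedSpace ℝ E] [FiniteDimensional ℝ E]
  {M : E → ℂ →L[ℝ] E} {K L : ℝ≥0}

lemma integrable_field (hMK : ∀ y, ‖M y‖ ≤ K) (hM : LipschitzWith L M) (y : ℝ →ᵇ E) {c : ℝ → ℂ}
    (hc : Integrable c) : Integrable (fun τ => M (y τ) (c τ)) := by
  rw [← integrableOn_univ] at hc ⊢
  exact integrableOn_field hMK hM.continuous MeasurableSet.univ y.continuous.continuousOn hc

/-- The integrand splits as `(M y - M z) c + M z (c - c')`. With `c = c'` this is the contraction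
estimate; in general it gives continuous dependence on the coefficient. -/
lemma norm_integral_field_sub_le (hMK : ∀ y, ‖M y‖ ≤ K) (hM : LipschitzWith L M)
    {c c' : ℝ → ℂ} (hc : Integrable c) (hc' : Integrable c') (y z : ℝ →ᵇ E) (a b : ℝ) :
    ‖(∫ τ in a..b, M (y τ) (c τ)) - ∫ τ in a..b, M (z τ) (c' τ)‖ ≤
      L * (∫ τ, ‖c τ‖) * ‖y - z‖ + K * ∫ τ, ‖c τ - c' τ‖ := by
  rw [← intervalIntegral.integral_sub (integrable_field hMK hM y hc).intervalIntegrable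
    (integrable_field hMK hM z hc').intervalIntegrable]
  have hg : Integrable fun τ => L * ‖y - z‖ * ‖c τ‖ + K * ‖c τ - c' τ‖ :=
    (hc.norm.const_mul _).add ((hc.sub hc').norm.const_mul _)
  refine (norm_intervalIntegral_le_integral hg (fun τ => ?_) a b).trans (le_of_eq ?_)
  · have h1 : M (y τ) (c τ) - M (z τ) (c' τ) = (M (y τ) - M (z τ)) (c τ) + M (z τ) (c τ - c' τ) := by
      simp
    rw [h1]
    refine (norm_add_le _ _).trans (add_le_add ?_ ?_)
    · refine ((M (y τ) - M (z τ)).le_opNorm _).trans ?_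
      gcongr
      refine (hM.norm_sub_le _ _).trans ?_
      gcongr
      exact (y - z).norm_coe_le_norm τ
    · refine ((M (z τ)).le_opNorm _).trans ?_
      gcongr
      exact hMK _
  · have h2 : Integrable fun τ => K * ‖c τ - c' τ‖ := (hc.sub hc').norm.const_mul _
    rw [integral_add (hc.norm.const_mul _) h2, integral_const_mul, integral_const_mul]
    ring

/-- Picard iteration for a small integrable coefficient. -/
theorem exists_picard (hMK : ∀ y, ‖M y‖ ≤ K) (hM : LipschitzWith L M) {c : ℝ → ℂ}
    (hc : Integrable c) (hsmall : L * ∫ τ, ‖c τ‖ ≤ 1 / 2) (e : E) :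
    ∃ y : ℝ →ᵇ E, ∀ x, y x = e + ∫ τ in (0 : ℝ)..x, M (y τ) (c τ) := by
  let Φ : (ℝ →ᵇ E) → (ℝ →ᵇ E) := fun y =>
    ofNormedAddCommGroup (fun x => e + ∫ τ in (0 : ℝ)..x, M (y τ) (c τ))
      (continuous_const.add (intervalIntegral.continuous_primitive
        (fun _ _ => (integrable_field hMK hM y hc).intervalIntegrable) 0))
      (‖e‖ + ∫ τ, K * ‖c τ‖) (fun x => (norm_add_le _ _).trans (by
        gcongr
        exact norm_intervalIntegral_le_integral (hc.norm.const_mul _)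
          (fun t => ((M (y t)).le_opNorm _).trans (by gcongr; exact hMK _)) 0 x))
  have hΦ : ContractingWith (1 / 2) Φ := by
    refine ⟨by rw [← NNReal.coe_lt_coe]; norm_num, LipschitzWith.of_dist_le_mul fun y z => ?_⟩
    refine (dist_le (by positivity)).2 fun x => ?_
    change dist (e + ∫ τ in (0 : ℝ)..x, M (y τ) (c τ)) (e + ∫ τ in (0 : ℝ)..x, M (z τ) (c τ)) ≤ _
    rw [dist_add_left, dist_eq_norm]
    refine (norm_integral_field_sub_le hMK hM hc hc y z 0 x).trans ?_
    simp only [sub_self, norm_zero, integral_zero, mul_zero, add_zero]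
    rw [dist_eq_norm]
    gcongr
    simpa using hsmall
  refine ⟨hΦ.fixedPoint, fun x => ?_⟩
  have := hΦ.fixedPoint_isFixedPt
  exact congrArg (fun y : ℝ →ᵇ E => y x) this.symm

/-- The smallness of `c` absorbs half of `‖y - z‖`. Applied to two frequencies, it gives continuity
in `k` uniformly in time. -/
lemma norm_picard_sub_le (hMK : ∀ y, ‖M y‖ ≤ K) (hM : LipschitzWith L M) {c c' : ℝ → ℂ}
    (hc : Integrable c) (hc' : Integrable c') (hsmall : L * ∫ τ, ‖c τ‖ ≤ 1 / 2) {e : E}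
    {y z : ℝ →ᵇ E} (hy : ∀ x, y x = e + ∫ τ in (0 : ℝ)..x, M (y τ) (c τ))
    (hz : ∀ x, z x = e + ∫ τ in (0 : ℝ)..x, M (z τ) (c' τ)) :
    ‖y - z‖ ≤ 2 * (K * ∫ τ, ‖c τ - c' τ‖) := by
  have h0 : 0 ≤ ∫ τ, ‖c τ - c' τ‖ := integral_nonneg fun _ => norm_nonneg _
  have h1 : 0 ≤ ∫ τ, ‖c τ‖ := integral_nonneg fun _ => norm_nonneg _
  have : ‖y - z‖ ≤ L * (∫ τ, ‖c τ‖) * ‖y - z‖ + K * ∫ τ, ‖c τ - c' τ‖ := by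
    refine (norm_le (by positivity)).2 fun x => ?_
    rw [BoundedContinuousFunction.sub_apply, hy x, hz x, add_sub_add_left_eq_sub]
    exact norm_integral_field_sub_le hMK hM hc hc' y z 0 x
  nlinarith [norm_nonneg (y - z), mul_le_mul_of_nonneg_right hsmall (norm_nonneg (y - z))]

lemma norm_picard_sub_init_le (hMK : ∀ y, ‖M y‖ ≤ K) {c : ℝ → ℂ}
    (hc : Integrable c) {e : E} {y : ℝ → E}
    (hy : ∀ x, y x = e + ∫ τ in (0 : ℝ)..x, M (y τ) (c τ)) (x : ℝ) :
    ‖y x - e‖ ≤ K * ∫ τ, ‖c τ‖ := by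
  rw [hy x, add_sub_cancel_left, ← integral_const_mul]
  exact norm_intervalIntegral_le_integral (hc.norm.const_mul _)
    (fun t => ((M (y t)).le_opNorm _).trans (by gcongr; exact hMK _)) 0 x

end Picard

lemma continuous_integral_norm_modulate_sub {f : ℝ → ℂ} (hf : Integrable f) (k₀ : ℝ) :
    Continuous fun k => ∫ τ, ‖modulate f k τ - modulate f k₀ τ‖ := by
  refine continuous_of_dominated (bound := fun τ => ‖f τ‖ + ‖f τ‖)
    (fun k => ((integrable_modulate hf k).sub (integrable_modulate hf k₀)).norm.aestronglyMeasurable)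
    (fun k => ae_of_all _ fun τ => ?_) (hf.norm.add hf.norm) (ae_of_all _ fun τ => ?_)
  · rw [norm_norm]
    exact (norm_sub_le _ _).trans (by rw [norm_modulate, norm_modulate])
  · exact ((continuous_modulate_left f τ).sub continuous_const).norm

/-! ### Uniqueness of solutions. -/

section Uniqueness

variable {E : Type*} [NormedAddCommGroup E] [NormedSpace ℝ E] [FiniteDimensional ℝ E]
  {G : Type*} [TopologicalSpace G] [ChartedSpace E G] [Group G] [LieGroup 𝓘(ℝ, E) ∞ G]
  {w v : GroupLieAlgebra 𝓘(ℝ, E) G} {c : ℝ → ℂ}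

/-- Near each time, a continuous curve stays in a translate of a given ball of the chart at `1`. -/
lemma eventually_mem_oneChart {Γ : ℝ → G} (hΓ : Continuous Γ) (x₀ : ℝ) {R : ℝ} (hR : 0 < R) :
    ∀ᶠ x in 𝓝 x₀, (Γ x₀)⁻¹ * Γ x ∈ (oneChart E G).source ∧
      oneChart E G ((Γ x₀)⁻¹ * Γ x) ∈ Metric.ball (oneChart E G 1) R := by
  haveI : IsTopologicalGroup G := topologicalGroup_of_lieGroup 𝓘(ℝ, E) ∞
  have hc : ContinuousAt (fun x => (Γ x₀)⁻¹ * Γ x) x₀ :=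
    (continuous_const.mul hΓ).continuousAt
  have h1 : (oneChart E G).source ∩ (oneChart E G) ⁻¹' Metric.ball (oneChart E G 1) R ∈
      𝓝 ((Γ x₀)⁻¹ * Γ x₀) := by
    rw [inv_mul_cancel]
    exact inter_mem (extChartAt_source_mem_nhds (I := 𝓘(ℝ, E)) (1 : G))
      ((continuousAt_extChartAt (I := 𝓘(ℝ, E)) (1 : G)).preimage_mem_nhds
        (Metric.ball_mem_nhds _ hR))
  exact hc.preimage_mem_nhds h1

/-- The agreement set is closed since `G` is Hausdorff. It is open because near a point of agreement
both curves solve one integral equation in a common translated chart, and on a short interval the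
maximum of their difference is at most half of itself. Connectedness of ℝ concludes. -/
theorem IsSolOn.unique [T2Space G] (hc : ∀ a b, IntervalIntegrable c volume a b) {Γ Γ' : ℝ → G}
    (h : ∀ a b, IsSolOn w v c Γ a b) (h' : ∀ a b, IsSolOn w v c Γ' a b) (h0 : Γ 0 = Γ' 0) :
    Γ = Γ' := by
  have cont : ∀ {Γ : ℝ → G}, (∀ a b, IsSolOn w v c Γ a b) → Continuous Γ := fun h =>
    continuous_iff_continuousAt.2 fun x => (h (x - 1) (x + 1)).continuousOn.continuousAt
      (Icc_mem_nhds (by linarith) (by linarith))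
  have hΓ := cont h
  have hΓ' := cont h'
  obtain ⟨M, R, K, L, hR, hRt, hMK, hML, hMf⟩ := exists_chartField_extension (E := E) (G := G) w v
  suffices hcl : IsClopen {x | Γ x = Γ' x} by
    funext x
    have : x ∈ {x | Γ x = Γ' x} := by
      rw [hcl.eq_univ ⟨0, h0⟩]
      trivial
    exact this
  refine ⟨isClosed_eq hΓ hΓ', isOpen_iff_mem_nhds.2 fun x₀ hx₀ => ?_⟩
  have hx₀ : Γ x₀ = Γ' x₀ := hx₀
  have ev1 := eventually_mem_oneChart (E := E) hΓ x₀ hR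
  have ev2 := eventually_mem_oneChart (E := E) hΓ' x₀ hR
  rw [← hx₀] at ev2
  have ev3 : ∀ᶠ x in 𝓝 x₀, L * |∫ τ in x₀..x, ‖c τ‖| < 1 / 2 := by
    have hct : Continuous fun x => L * |∫ τ in x₀..x, ‖c τ‖| :=
      continuous_const.mul (intervalIntegral.continuous_primitive (fun a b => (hc a b).norm) x₀).abs
    refine hct.continuousAt.eventually (gt_mem_nhds ?_)
    simp
  obtain ⟨ε, hε, hball⟩ := Metric.eventually_nhds_iff_ball.1 (ev1.and (ev2.and ev3))
  have hsub : Icc (x₀ - ε / 2) (x₀ + ε / 2) ⊆ Metric.ball x₀ ε := by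
    rw [← Real.closedBall_eq_Icc]
    exact Metric.closedBall_subset_ball (by linarith)
  set a := x₀ - ε / 2
  set b := x₀ + ε / 2
  have hab : a ≤ b := by simp only [a, b]; linarith
  have hx₀I : x₀ ∈ Icc a b := by constructor <;> simp only [a, b] <;> linarith
  set g := Γ x₀
  obtain ⟨yc, yi, ye⟩ := (h a b).chart_eq_integral hML.continuous hMK hMf (hc a b) (g := g)
    (fun x hx => (hball x (hsub hx)).1.1) (fun x hx => (hball x (hsub hx)).1.2) hab
  obtain ⟨yc', yi', ye'⟩ := (h' a b).chart_eq_integral hML.continuous hMK hMf (hc a b) (g := g)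
    (fun x hx => (hball x (hsub hx)).2.1.1) (fun x hx => (hball x (hsub hx)).2.1.2) hab
  set y := fun x => oneChart E G (g⁻¹ * Γ x) with hy
  set y' := fun x => oneChart E G (g⁻¹ * Γ' x) with hy'
  have ye2 : ∀ x ∈ Icc a b, y x = y x₀ + ∫ τ in x₀..x, M (y τ) (c τ) := by
    intro x hx
    rcases le_total x₀ x with hle | hle
    · rw [← ye x₀ hx₀I x hx hle]; simp [hy]
    · rw [intervalIntegral.integral_symm, ← ye x hx x₀ hx₀I hle]; simp [hy]
  have ye2' : ∀ x ∈ Icc a b, y' x = y' x₀ + ∫ τ in x₀..x, M (y' τ) (c τ) := by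
    intro x hx
    rcases le_total x₀ x with hle | hle
    · rw [← ye' x₀ hx₀I x hx hle]; simp [hy']
    · rw [intervalIntegral.integral_symm, ← ye' x hx x₀ hx₀I hle]; simp [hy']
  have hy0 : y x₀ = y' x₀ := by simp only [hy, hy', ← hx₀, g]
  obtain ⟨m, hmI, hm⟩ := isCompact_Icc.exists_isMaxOn ⟨x₀, hx₀I⟩ (yc.sub yc').norm
  have hm' : ∀ x ∈ Icc a b, ‖y x - y' x‖ ≤ ‖y m - y' m‖ := fun x hx => hm hx
  have hsubI : ∀ {x}, x ∈ Icc a b → uIcc x₀ x ⊆ uIcc a b := fun hx => by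
    rw [uIcc_of_le hab]; exact uIcc_subset_Icc hx₀I hx
  have hest : ‖y m - y' m‖ ≤ L * |∫ τ in x₀..m, ‖c τ‖| * ‖y m - y' m‖ := by
    conv_lhs => rw [ye2 m hmI, ye2' m hmI, hy0, add_sub_add_left_eq_sub,
      ← intervalIntegral.integral_sub (yi.mono_set (hsubI hmI)) (yi'.mono_set (hsubI hmI))]
    have hgi : IntervalIntegrable (fun τ => L * ‖y m - y' m‖ * ‖c τ‖) volume x₀ m :=
      (hc x₀ m).norm.const_mul _
    refine (intervalIntegral.norm_integral_le_abs_of_norm_le (ae_restrict_of_forall_mem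
      measurableSet_uIoc fun τ hτ => ?_) hgi).trans (le_of_eq ?_)
    · have hτI : τ ∈ Icc a b := by
        have := hsubI hmI (uIoc_subset_uIcc hτ)
        rwa [uIcc_of_le hab] at this
      rw [← sub_apply]
      refine ((M (y τ) - M (y' τ)).le_opNorm _).trans ?_
      gcongr
      refine (hML.norm_sub_le _ _).trans ?_
      gcongr
      exact hm' τ hτI
    · rw [intervalIntegral.integral_const_mul, abs_mul, abs_of_nonneg (by positivity)]
      ring
  have hsm := (hball m (hsub hmI)).2.2
  have hzero : ‖y m - y' m‖ = 0 := by
    nlinarith [norm_nonneg (y m - y' m)]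
  refine mem_of_superset (Icc_mem_nhds (a := a) (b := b) ?_ ?_) fun x hx => ?_
  · simp only [a]; linarith
  · simp only [b]; linarith
  have hxy : y x = y' x := by
    have := hm' x hx
    rw [hzero] at this
    exact sub_eq_zero.1 (norm_le_zero_iff.1 this)
  have := (oneChart E G).injOn (hball x (hsub hx)).1.1 (hball x (hsub hx)).2.1.1 hxy
  exact mul_left_cancel this

end Uniqueness

/-! ### Global existence by gluing over shells. -/

/-- The two-sided shell `n h ≤ |x| < (n + 1) h`. -/
def shell (h : ℝ) (n : ℕ) : Set ℝ := {x | n * h ≤ |x| ∧ |x| < (n + 1) * h}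

lemma measurableSet_shell (h : ℝ) (n : ℕ) : MeasurableSet (shell h n) :=
  (measurableSet_le measurable_const measurable_id.abs).inter
    (measurableSet_lt measurable_id.abs measurable_const)

lemma volume_shell_le {h : ℝ} (n : ℕ) : volume (shell h n) ≤ ENNReal.ofReal (2 * h) := by
  have hsub : shell h n ⊆ Icc (n * h) ((n + 1) * h) ∪ Icc (-((n + 1) * h)) (-(n * h)) := by
    rintro x ⟨h1, h2⟩
    rcases le_total 0 x with hx | hx
    · rw [abs_of_nonneg hx] at h1 h2
      exact Or.inl ⟨h1, h2.le⟩
    · rw [abs_of_nonpos hx] at h1 h2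
      exact Or.inr ⟨by linarith, by linarith⟩
  refine (measure_mono hsub).trans ((measure_union_le _ _).trans ?_)
  rw [Real.volume_Icc, Real.volume_Icc]
  have e1 : (n + 1) * h - n * h = h := by ring
  have e2 : -(n * h) - -((n + 1) * h) = h := by ring
  rw [e1, e2]
  rcases le_total 0 h with hh | hh
  · rw [← ENNReal.ofReal_add hh hh, two_mul]
  · simp [ENNReal.ofReal_of_nonpos hh]

/-- Sets of small measure carry small L^p norm of `f` and, as their measure is at most 1, no larger
L¹ norm. One width serves all shells and all frequencies. -/
lemma exists_integral_shell_le {f : ℝ → ℂ} {p : ℝ≥0∞} (hp1 : 1 ≤ p) (hp : p ≠ ⊤)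
    (hf : MemLp f p volume) {η : ℝ} (hη : 0 < η) :
    ∃ h > 0, ∀ n, IntegrableOn f (shell h n) ∧ ∫ τ in shell h n, ‖f τ‖ ≤ η := by
  obtain ⟨δ, hδ, H⟩ := hf.eLpNorm_indicator_le hp1 hp hη
  refine ⟨min (δ / 2) (1 / 2), by positivity, fun n => ?_⟩
  set h := min (δ / 2) (1 / 2)
  have hvol : volume (shell h n) ≤ ENNReal.ofReal (2 * h) := volume_shell_le n
  have hv1 : volume (shell h n) ≤ 1 := hvol.trans (by
    rw [← ENNReal.ofReal_one]
    exact ENNReal.ofReal_le_ofReal (by have := min_le_right (δ / 2) (1 / 2 : ℝ); linarith))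
  have hvδ : volume (shell h n) ≤ ENNReal.ofReal δ := hvol.trans
    (ENNReal.ofReal_le_ofReal (by have := min_le_left (δ / 2) (1 / 2 : ℝ); linarith))
  have h1 := H _ (measurableSet_shell h n) hvδ
  rw [eLpNorm_indicator_eq_eLpNorm_restrict (measurableSet_shell h n)] at h1
  have hm : AEStronglyMeasurable f (volume.restrict (shell h n)) := hf.1.restrict
  have h2 : eLpNorm f 1 (volume.restrict (shell h n)) ≤ ENNReal.ofReal η := by
    refine (eLpNorm_le_eLpNorm_mul_rpow_measure_univ hp1 hm).trans ?_
    refine (mul_le_of_le_one_right' (ENNReal.rpow_le_one (by simpa using hv1) ?_)).trans h1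
    rw [ENNReal.toReal_one, div_one, sub_nonneg]
    exact div_le_one_of_le₀ (by rw [← ENNReal.toReal_one]; exact ENNReal.toReal_mono hp hp1)
      ENNReal.toReal_nonneg
  have hi : IntegrableOn f (shell h n) :=
    memLp_one_iff_integrable.1 ⟨hm, h2.trans_lt ENNReal.ofReal_lt_top⟩
  refine ⟨hi, ?_⟩
  rw [eLpNorm_one_eq_lintegral_enorm, ← ofReal_integral_norm_eq_lintegral_enorm hi] at h2
  exact (ENNReal.ofReal_le_ofReal_iff hη.le).1 h2

section Existence

open BoundedContinuousFunction

variable {E : Type*} [NormedAddCommGroup E] [NormedSpace ℝ E] [FiniteDimensional ℝ E]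
  {G : Type*} [TopologicalSpace G] [ChartedSpace E G] [Group G] [LieGroup 𝓘(ℝ, E) ∞ G]

/-- One step of the construction: the solution for the coefficient restricted to a shell. -/
lemma exists_shell_solution (w v : GroupLieAlgebra 𝓘(ℝ, E) G) :
    ∃ η > 0, ∀ (f : ℝ → ℂ) (h : ℝ) (n : ℕ), 0 < h → IntegrableOn f (shell h n) →
      ∫ τ in shell h n, ‖f τ‖ ≤ η → ∃ P : ℝ → ℝ → G, Continuous (fun q : ℝ × ℝ => P q.1 q.2) ∧
        (∀ k x, |x| ≤ n * h → P k x = 1) ∧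
        (∀ k x, (n + 1) * h ≤ x → P k x = P k ((n + 1) * h)) ∧
        (∀ k x, x ≤ -((n + 1) * h) → P k x = P k (-((n + 1) * h))) ∧
        (∀ k g, IsSolOn w v (modulate f k) (fun x => g * P k x) (n * h) ((n + 1) * h)) ∧
        ∀ k g, IsSolOn w v (modulate f k) (fun x => g * P k x) (-((n + 1) * h)) (-(n * h)) := by
  obtain ⟨M, R, K, L, hR, hRt, hMK, hML, hMf⟩ := exists_chartField_extension (E := E) (G := G) w v
  -- The first bound makes the Picard map a contraction; the second keeps its fixed point in the
  -- ball where `M` is the true field.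
  refine ⟨min (1 / (2 * (L + 1))) (R / (2 * (K + 1))), by positivity, fun f h n hh hfi hfη => ?_⟩
  set e := oneChart E G 1 with he
  have hη0 : 0 ≤ ∫ τ in shell h n, ‖f τ‖ := integral_nonneg fun _ => norm_nonneg _
  have hL : L * ∫ τ in shell h n, ‖f τ‖ ≤ 1 / 2 := by
    have h1 := hfη.trans (min_le_left _ _)
    have h2 : (L : ℝ) * ∫ τ in shell h n, ‖f τ‖ ≤ L * (1 / (2 * (L + 1))) := by gcongr
    refine h2.trans ?_
    rw [mul_one_div, div_le_div_iff₀ (by positivity) (by positivity)]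
    linarith [L.coe_nonneg]
  have hK : K * ∫ τ in shell h n, ‖f τ‖ < R := by
    have h1 := hfη.trans (min_le_right _ _)
    have h2 : (K : ℝ) * ∫ τ in shell h n, ‖f τ‖ ≤ K * (R / (2 * (K + 1))) := by gcongr
    refine h2.trans_lt ?_
    rw [← mul_div_assoc, div_lt_iff₀ (by positivity)]
    nlinarith [K.coe_nonneg]
  set f₁ := (shell h n).indicator f with hf₁
  have hf₁i : Integrable f₁ := (integrable_indicator_iff (measurableSet_shell h n)).2 hfi
  have hnorm : ∀ k, ∫ τ, ‖modulate f₁ k τ‖ = ∫ τ in shell h n, ‖f τ‖ := by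
    intro k
    simp only [norm_modulate]
    rw [← integral_indicator (measurableSet_shell h n)]
    simp only [hf₁, norm_indicator_eq_indicator_norm]
  have hci : ∀ k, Integrable (modulate f₁ k) := integrable_modulate hf₁i
  have hex := fun k => exists_picard hMK hML (hci k) (by rw [hnorm]; exact hL) e
  choose Y hY using hex
  have hYR : ∀ k x, Y k x ∈ Metric.ball e R := by
    intro k x
    rw [Metric.mem_ball, dist_eq_norm]
    refine (norm_picard_sub_init_le hMK (hci k) (hY k) x).trans_lt ?_
    rwa [hnorm]
  have hYc : Continuous Y := by
    rw [continuous_iff_continuousAt]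
    intro k₀
    rw [ContinuousAt, tendsto_iff_norm_sub_tendsto_zero]
    have h1 : Tendsto (fun k => 2 * (K * ∫ τ, ‖modulate f₁ k τ - modulate f₁ k₀ τ‖)) (𝓝 k₀)
        (𝓝 0) := by
      have : Continuous fun k => 2 * (K * ∫ τ, ‖modulate f₁ k τ - modulate f₁ k₀ τ‖) :=
        continuous_const.mul (continuous_const.mul (continuous_integral_norm_modulate_sub hf₁i k₀))
      have := this.tendsto k₀
      simpa using this
    refine squeeze_zero (fun _ => norm_nonneg _) (fun k => ?_) h1
    exact norm_picard_sub_le hMK hML (hci k) (hci k₀) (by rw [hnorm]; exact hL) (hY k) (hY k₀)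
  have hYj : Continuous fun q : ℝ × ℝ => Y q.1 q.2 :=
    (hYc.comp continuous_fst).eval continuous_snd
  have hYint : ∀ k a b, IntervalIntegrable (fun τ => M (Y k τ) (modulate f₁ k τ)) volume a b :=
    fun k a b => (integrable_field hMK hML (Y k) (hci k)).intervalIntegrable
  have hYsub : ∀ k a b, Y k b = Y k a + ∫ τ in a..b, M (Y k τ) (modulate f₁ k τ) := by
    intro k a b
    rw [hY k a, hY k b, add_assoc, intervalIntegral.integral_add_adjacent_intervals (hYint k _ _)
      (hYint k _ _)]
  have hout : ∀ k x, x ∉ shell h n → modulate f₁ k x = 0 := by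
    intro k x hx
    rw [hf₁, modulate_indicator, indicator_of_notMem hx]
  have hconst : ∀ k a b, (∀ x ∈ uIoc a b, x ∉ shell h n) → Y k b = Y k a := by
    intro k a b hx
    rw [hYsub k a b]
    have h0 : ∫ τ in a..b, M (Y k τ) (modulate f₁ k τ) = ∫ τ in a..b, (0 : E) :=
      intervalIntegral.integral_congr_ae (ae_of_all _ fun τ hτ => by
        rw [hout k τ (hx τ hτ), map_zero])
    rw [h0, intervalIntegral.integral_zero, add_zero]
  -- The points `|x| = n * h` belong to the shell but are negligible for the integral.
  have hYe : ∀ k x, |x| ≤ n * h → Y k x = e := by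
    intro k x hx
    have h0 : Y k 0 = e := by rw [hY k 0]; simp
    by_cases hxn : |x| < n * h
    · rw [hconst k 0 x, h0]
      intro z hz hzs
      have : |z| ≤ |x| := by
        have := abs_sub_left_of_mem_uIcc (uIoc_subset_uIcc hz)
        simpa using this
      exact absurd hzs.1 (not_le.2 (this.trans_lt hxn))
    · have hxe : |x| = n * h := le_antisymm hx (not_lt.1 hxn)
      rw [hY k x]
      have h1 : ∫ τ in (0 : ℝ)..x, M (Y k τ) (modulate f₁ k τ) = ∫ τ in (0 : ℝ)..x, (0 : E) := by
        refine intervalIntegral.integral_congr_ae ?_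
        have hne : ∀ᵐ τ : ℝ, τ ≠ x := by simp [ae_iff, measure_singleton]
        have hne' : ∀ᵐ τ : ℝ, τ ≠ 0 := by simp [ae_iff, measure_singleton]
        filter_upwards [hne, hne'] with τ hτ hτ0 hτI
        rw [hout k τ ?_, map_zero]
        intro hs
        have h2 := hs.1
        rcases le_total 0 x with hx0 | hx0
        · rw [uIoc_of_le hx0] at hτI
          rw [abs_of_nonneg hx0] at hxe
          rw [abs_of_pos hτI.1, ← hxe] at h2
          exact hτ (le_antisymm hτI.2 h2)
        · rw [uIoc_of_ge hx0] at hτI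
          rw [abs_of_nonpos hx0] at hxe
          rw [abs_of_nonpos hτI.2, ← hxe] at h2
          linarith [hτI.1]
      rw [h1, intervalIntegral.integral_zero, add_zero]
  have hsol : ∀ k g a b, a ≤ b → Ioo a b ⊆ shell h n → IsSolOn w v (modulate f k)
      (fun x => g * (oneChart E G).symm (Y k x)) a b := by
    intro k g a b hab hs
    have := isSolOn_of_chart (G := G) (w := w) (v := v) hRt hML.continuous hMK hMf hab
      (hci k).intervalIntegrable (Y k).continuous.continuousOn (fun x _ => hYR k x)
      (fun x _ => hYsub k a x) g
    refine this.congr (fun _ _ => rfl) (ae_of_all _ fun x hx => ?_)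
    rw [hf₁, modulate_indicator, indicator_of_mem (hs hx)]
  have hnh : (0 : ℝ) ≤ n * h := by positivity
  refine ⟨fun k x => (oneChart E G).symm (Y k x), ?_, fun k x hx => ?_, fun k x hx => ?_,
    fun k x hx => ?_, fun k g => hsol k g _ _ (by nlinarith) fun x hx => ?_,
    fun k g => hsol k g _ _ (by nlinarith) fun x hx => ?_⟩
  · exact (continuousOn_extChartAt_symm (I := 𝓘(ℝ, E)) (1 : G)).comp_continuous hYj
      fun q => hRt (hYR _ _)
  · simp only [hYe k x hx, he, oneChart_symm_oneChart_one]
  · refine congrArg (oneChart E G).symm (hconst k _ x fun z hz hzs => ?_)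
    rw [uIoc_of_le hx] at hz
    exact absurd hzs.2 (not_lt.2 (hz.1.le.trans (le_abs_self z)))
  · refine congrArg (oneChart E G).symm (hconst k x _ fun z hz hzs => ?_).symm
    rw [uIoc_of_le hx] at hz
    refine absurd hzs.2 (not_lt.2 ?_)
    have := neg_abs_le z
    linarith [hz.2, neg_le_abs z]
  · have hx0 : 0 ≤ x := hnh.trans hx.1.le
    exact ⟨by rw [abs_of_nonneg hx0]; exact hx.1.le, by rw [abs_of_nonneg hx0]; exact hx.2⟩
  · have hx0 : x ≤ 0 := by linarith [hx.2]
    exact ⟨by rw [abs_of_nonpos hx0]; linarith [hx.2], by rw [abs_of_nonpos hx0]; linarith [hx.1]⟩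

/-- Global existence, with joint continuity in the frequency and the time. -/
theorem exists_solution (w v : GroupLieAlgebra 𝓘(ℝ, E) G) {f : ℝ → ℂ} {p : ℝ≥0∞} (hp1 : 1 ≤ p)
    (hp : p ≠ ⊤) (hf : MemLp f p volume) :
    ∃ Γ : ℝ → ℝ → G, Continuous (fun q : ℝ × ℝ => Γ q.1 q.2) ∧ (∀ k, Γ k 0 = 1) ∧
      ∀ k (N : ℕ), IsSolOn w v (modulate f k) (Γ k) (-N) N := by
  haveI : IsTopologicalGroup G := topologicalGroup_of_lieGroup 𝓘(ℝ, E) ∞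
  obtain ⟨η, hη, H⟩ := exists_shell_solution w v
  obtain ⟨h, hh, hsh⟩ := exists_integral_shell_le hp1 hp hf hη
  choose P hPc hP1 hPr hPl hPsr hPsl using fun n => H f h n hh (hsh n).1 (hsh n).2
  -- `Q n` is constant beyond `n * h` on either side, so on each half of the next shell `Q (n + 1)`
  -- is a left translate of `P n`, which is again a solution.
  let Q : ℕ → ℝ → ℝ → G := fun n => Nat.rec (fun _ _ => 1) (fun n q k x => q k x * P n k x) n
  have hQs : ∀ n k x, Q (n + 1) k x = Q n k x * P n k x := fun _ _ _ => rfl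
  have hQ0 : ∀ k x, Q 0 k x = 1 := fun _ _ => rfl
  have hnh : ∀ n : ℕ, (0 : ℝ) ≤ n * h := fun n => by positivity
  have hnh1 : ∀ n : ℕ, (n : ℝ) * h ≤ (n + 1) * h := fun n => by nlinarith
  have hstep : ∀ (n : ℕ) k x, |x| ≤ n * h → Q (n + 1) k x = Q n k x := by
    intro n k x hx
    rw [hQs, hP1 n k x hx, mul_one]
  have hstable : ∀ (n m : ℕ) k x, n ≤ m → |x| ≤ n * h → Q m k x = Q n k x := by
    intro n m k x hnm hx
    induction m, hnm using Nat.le_induction with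
    | base => rfl
    | succ m hm ih =>
      rw [hstep m k x (hx.trans (by gcongr)), ih]
  have hQc : ∀ n, Continuous fun q : ℝ × ℝ => Q n q.1 q.2 := by
    intro n
    induction n with
    | zero => exact continuous_const
    | succ n ih => exact ih.mul (hPc n)
  have hQr : ∀ (n : ℕ) k x, n * h ≤ x → Q n k x = Q n k (n * h) := by
    intro n
    induction n with
    | zero => intro k x _; rfl
    | succ n ih =>
      intro k x hx
      push_cast at hx ⊢
      rw [hQs, hQs, ih k x ((hnh1 n).trans hx), ih k _ (hnh1 n), hPr n k x hx]
  have hQl : ∀ (n : ℕ) k x, x ≤ -(n * h) → Q n k x = Q n k (-(n * h)) := by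
    intro n
    induction n with
    | zero => intro k x _; rfl
    | succ n ih =>
      intro k x hx
      push_cast at hx ⊢
      have := hnh1 n
      rw [hQs, hQs, ih k x (by linarith), ih k (-((n + 1) * h)) (by linarith), hPl n k x hx]
  have hQsol : ∀ (n : ℕ) k, IsSolOn w v (modulate f k) (Q n k) (-(n * h)) (n * h) := by
    intro n k
    induction n with
    | zero =>
      refine ((hPsr 0 k 1).mono (a' := -((0 : ℕ) * h)) (b' := (0 : ℕ) * h) (by simp) (hnh1 0)).congr
        (fun x hx => ?_) (ae_of_all _ fun _ _ => rfl)
      simp only [hP1 0 k x (abs_le.2 hx), hQ0, mul_one]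
    | succ n ih =>
      push_cast
      have hmid : IsSolOn w v (modulate f k) (Q (n + 1) k) (-(n * h)) (n * h) :=
        ih.congr (fun x hx => (hstep n k x (abs_le.2 hx)).symm) (ae_of_all _ fun _ _ => rfl)
      have hright : IsSolOn w v (modulate f k) (Q (n + 1) k) (n * h) ((n + 1) * h) :=
        (hPsr n k (Q n k (n * h))).congr (fun x hx => by rw [hQs, hQr n k x hx.1])
          (ae_of_all _ fun _ _ => rfl)
      have hleft : IsSolOn w v (modulate f k) (Q (n + 1) k) (-((n + 1) * h)) (-(n * h)) :=
        (hPsl n k (Q n k (-(n * h)))).congr (fun x hx => by rw [hQs, hQl n k x hx.2])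
          (ae_of_all _ fun _ _ => rfl)
      have h1 := hnh n
      have h2 := hnh1 n
      exact (hleft.trans (by linarith) (by linarith) hmid).trans (by linarith) (by linarith) hright
  -- The products have stabilised at this index: any `n` with `|x| ≤ n * h` gives the same value.
  let Γ : ℝ → ℝ → G := fun k x => Q ⌈|x| / h⌉₊ k x
  have hΓ : ∀ (n : ℕ) k x, |x| ≤ n * h → Γ k x = Q n k x := by
    intro n k x hx
    refine (hstable _ n k x (Nat.ceil_le.2 ((div_le_iff₀ hh).2 hx)) ?_).symm
    exact (div_le_iff₀ hh).1 (Nat.le_ceil _)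
  refine ⟨Γ, ?_, fun k => ?_, fun k N => ?_⟩
  · rw [continuous_iff_continuousAt]
    rintro ⟨k, x⟩
    obtain ⟨n, hn⟩ := exists_nat_gt (|x| / h)
    refine (hQc n).continuousAt.congr ?_
    have hev : ∀ᶠ q : ℝ × ℝ in 𝓝 (k, x), |q.2| < n * h :=
      (continuous_snd.abs).continuousAt.eventually (gt_mem_nhds ((div_lt_iff₀ hh).1 hn))
    filter_upwards [hev] with q hq using (hΓ n q.1 q.2 hq.le).symm
  · exact (hΓ 0 k 0 (by simp)).trans (hQ0 k 0)
  · obtain ⟨n, hn⟩ := exists_nat_ge ((N : ℝ) / h)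
    have hNn : (N : ℝ) ≤ n * h := (div_le_iff₀ hh).1 hn
    refine ((hQsol n k).mono (neg_le_neg hNn) hNn).congr (fun x hx => ?_) (ae_of_all _ fun _ _ => rfl)
    exact (hΓ n k x ((abs_le.2 hx).trans hNn)).symm

end Existence

lemma powVariationOn_Icc_add_le {G : Type*} {d : G → G → ℝ≥0∞} {r : ℝ} {γ : ℝ → G} {s u t : ℝ}
    (hsu : s ≤ u) (hut : u ≤ t) : powVariationOn d r γ (Icc s u) +
      powVariationOn d r γ (Icc u t) ≤ powVariationOn d r γ (Icc s t) := by
  refine (powVariationOn_add_le (S := Icc s u) (T := Icc u t) (m := u) (fun _ h => h.2)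
    (fun _ h => h.1) ⟨u, hsu, le_rfl⟩ ⟨u, le_rfl, hut⟩).trans_eq ?_
  rw [Icc_union_Icc_eq_Icc hsu hut]

/-! ### Solutions move little while the driving variation is small. -/

section LocalEstimate

variable {E : Type*} [NormedAddCommGroup E] [NormedSpace ℝ E] [FiniteDimensional ℝ E]
  {G : Type*} [TopologicalSpace G] [T2Space G] [ChartedSpace E G] [Group G]
  [LieGroup 𝓘(ℝ, E) ∞ G]

/-- A solution moves by at most the variation of its driving path, while that is small. -/
theorem exists_leftEDist_le_of_small (N : Seminorm ℝ (GroupLieAlgebra 𝓘(ℝ, E) G))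
    (w v : GroupLieAlgebra 𝓘(ℝ, E) G) {ρ : ℝ} (hρ1 : 1 ≤ ρ) (hρ2 : ρ < 2) :
    ∃ C δ : ℝ≥0, 0 < δ ∧ ∀ (c X : ℝ → ℂ) (Γ : ℝ → G), (∀ a b, IntervalIntegrable c volume a b) →
      (∀ a b, X b - X a = ∫ τ in a..b, c τ) → (∀ a b, IsSolOn w v c Γ a b) → ∀ s t, s ≤ t →
        powVariationOn edist ρ X (Icc s t) ≤ δ →
          leftEDist N (Γ s) (Γ t) ≤ C * powVariationOn edist ρ X (Icc s t) ^ (1 / ρ) := by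
  haveI : IsTopologicalGroup G := topologicalGroup_of_lieGroup 𝓘(ℝ, E) ∞
  have hρ0 : 0 < ρ := by linarith
  obtain ⟨M, R₀, K, L, hR₀, hRt₀, hMK, hML, hMf₀⟩ :=
    exists_chartField_extension (E := E) (G := G) w v
  obtain ⟨C₁, R₁, hR₁, hC₁⟩ := exists_leftEDist_one_le N
  set R := min R₀ R₁ with hRdef
  have hR : 0 < R := lt_min hR₀ hR₁
  have hRt : Metric.ball (oneChart E G 1) R ⊆ (oneChart E G).target :=
    (Metric.ball_subset_ball (min_le_left _ _)).trans hRt₀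
  have hMf : ∀ y ∈ Metric.ball (oneChart E G 1) R, ∀ c : ℂ,
      M y c = chartField G y (c.re • w + c.im • v) := fun y hy =>
    hMf₀ y (Metric.ball_subset_ball (min_le_left _ _) hy)
  set θ : ℝ := (1 - 2 ^ (1 - 2 / ρ)) / (4 * (L + 1)) with hθ
  have hθ0 : 0 < θ := by
    have : (2 : ℝ) ^ (1 - 2 / ρ) < 1 := by
      refine Real.rpow_lt_one_of_one_lt_of_neg one_lt_two ?_
      rw [sub_neg, one_lt_div hρ0]
      exact hρ2
    have : 0 < 1 - (2 : ℝ) ^ (1 - 2 / ρ) := by linarith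
    positivity
  -- `σ < θ` is the smallness asked by `norm_sub_le_of_controlled`, and `2 * K * σ ≤ R / 2` keeps
  -- the curve in half of the chart ball.
  set σ : ℝ := min (θ / 2) (R / (4 * (K + 1))) with hσ
  have hσ0 : 0 < σ := by positivity
  have hσθ : σ < θ := (min_le_left _ _).trans_lt (by linarith)
  have hσK : 2 * K * σ ≤ R / 2 := by
    have : σ ≤ R / (4 * (K + 1)) := min_le_right _ _
    rw [le_div_iff₀ (by positivity)] at this
    nlinarith [K.coe_nonneg]
  refine ⟨C₁ * (2 * K), (σ ^ ρ).toNNReal, by positivity, ?_⟩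
  intro c X Γ hc hX hΓ s t hst hδ
  have hΓc : Continuous Γ := continuous_iff_continuousAt.2 fun x =>
    (hΓ (x - 1) (x + 1)).continuousOn.continuousAt (Icc_mem_nhds (by linarith) (by linarith))
  set e := oneChart E G 1 with he
  set z : ℝ → G := fun x => (Γ s)⁻¹ * Γ x with hz
  have hzc : Continuous z := continuous_const.mul hΓc
  have hzs : z s = 1 := inv_mul_cancel _
  set U : Set G := (oneChart E G).source ∩ (oneChart E G) ⁻¹' Metric.ball e R with hU
  have hUo : IsOpen U :=
    (continuousOn_extChartAt (1 : G)).isOpen_inter_preimage (isOpen_extChartAt_source 1)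
      Metric.isOpen_ball
  have hω : ∀ {x u}, x ∈ Icc s t → u ∈ Icc s t →
      powVariationOn edist ρ X (Icc x u) ≤ ENNReal.ofReal (σ ^ ρ) := fun hx hu =>
    (powVariationOn_mono (Icc_subset_Icc hx.1 hu.2)).trans hδ
  have hωtop : ∀ {x u}, x ∈ Icc s t → u ∈ Icc s t → powVariationOn edist ρ X (Icc x u) ≠ ⊤ :=
    fun hx hu => ((hω hx hu).trans_lt ENNReal.ofReal_lt_top).ne
  have hωσ : ∀ {x u}, x ∈ Icc s t → u ∈ Icc s t →
      (powVariationOn edist ρ X (Icc x u)).toReal ^ (1 / ρ) ≤ σ := by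
    intro x u hx hu
    have h1 : (powVariationOn edist ρ X (Icc x u)).toReal ≤ σ ^ ρ :=
      ENNReal.toReal_le_of_le_ofReal (by positivity) (hω hx hu)
    calc _ ≤ (σ ^ ρ) ^ (1 / ρ) := by gcongr
      _ = σ := by rw [← Real.rpow_mul hσ0.le, mul_one_div_cancel hρ0.ne', Real.rpow_one]
  have key : ∀ u ∈ Icc s t, (∀ x ∈ Icc s u, z x ∈ U) → ‖oneChart E G (z u) - e‖ ≤
      2 * K * (powVariationOn edist ρ X (Icc s u)).toReal ^ (1 / ρ) := by
    intro u hu hUx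
    obtain ⟨yc, yi, ye⟩ := (hΓ s u).chart_eq_integral hML.continuous hMK hMf (hc s u) (g := Γ s)
      (fun x hx => (hUx x hx).1) (fun x hx => (hUx x hx).2) hu.1
    have hsub : Icc s u ⊆ Icc s t := Icc_subset_Icc le_rfl hu.2
    have := norm_sub_le_of_controlled (Ω := fun x z => (powVariationOn edist ρ X (Icc x z)).toReal)
      (B := univ) hρ1 hρ2 K.coe_nonneg L.coe_nonneg hu.1 (fun x _ => hMK x)
      (fun x _ x' _ => hML.norm_sub_le x x') yc (fun _ _ => mem_univ _) (hc s u) yi ye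
      (fun _ _ _ _ _ => ENNReal.toReal_nonneg) ?_ ?_ ((hωσ ⟨le_rfl, hst⟩ hu).trans_lt hσθ)
    · have hys : oneChart E G ((Γ s)⁻¹ * Γ s) = e := by rw [inv_mul_cancel]
      rw [hys] at this
      exact this
    · intro x hx q hq m hm
      rw [← ENNReal.toReal_add (hωtop (hsub hx) (hsub ⟨hx.1.trans hm.1, hm.2.trans hq.2⟩))
        (hωtop (hsub ⟨hx.1.trans hm.1, hm.2.trans hq.2⟩) (hsub hq))]
      exact ENNReal.toReal_mono (hωtop (hsub hx) (hsub hq)) (powVariationOn_Icc_add_le hm.1 hm.2)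
    · intro x hx q hq hxq
      rw [← hX x q]
      have h1 := rpow_le_powVariationOn (d := edist) (r := ρ) (γ := X) hxq
        (left_mem_Icc.2 hxq) (right_mem_Icc.2 hxq)
      have h2 := ENNReal.toReal_mono (hωtop (hsub hx) (hsub hq)) h1
      rw [← ENNReal.toReal_rpow, edist_dist, ENNReal.toReal_ofReal dist_nonneg, dist_eq_norm] at h2
      calc ‖X q - X x‖ = (‖X q - X x‖ ^ ρ) ^ (1 / ρ) := by
            rw [← Real.rpow_mul (norm_nonneg _), mul_one_div_cancel hρ0.ne', Real.rpow_one]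
        _ ≤ _ := by gcongr
  -- Continuity argument. `key` holds as long as the curve stays in `U`, and then confines it to the
  -- closed set `W`, the image of the half ball. At a first exit time the curve would still lie in
  -- `W`, hence in `U`.
  have hall : ∀ x ∈ Icc s t, z x ∈ U := by
    by_contra hcon
    push Not at hcon
    obtain ⟨x₀, hx₀, hx₀U⟩ := hcon
    have hclosed : IsClosed (z ⁻¹' Uᶜ) := (hUo.isClosed_compl).preimage hzc
    obtain ⟨u, ⟨hu, huU⟩, hmin⟩ := (isCompact_Icc.inter_right hclosed).exists_isLeast
      ⟨x₀, hx₀, hx₀U⟩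
    have hbefore : ∀ x ∈ Ico s u, z x ∈ U := by
      intro x hx
      by_contra hxU
      exact absurd (hmin ⟨⟨hx.1, hx.2.le.trans hu.2⟩, hxU⟩) (not_le.2 hx.2)
    set W : Set G := (oneChart E G).symm '' Metric.closedBall e (R / 2) with hW
    have hballs : Metric.closedBall e (R / 2) ⊆ Metric.ball e R :=
      Metric.closedBall_subset_ball (by linarith)
    have hWc : IsClosed W := ((isCompact_closedBall e (R / 2)).image_of_continuousOn
      ((continuousOn_extChartAt_symm (1 : G)).mono (hballs.trans hRt))).isClosed
    have hWU : W ⊆ U := by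
      rintro _ ⟨y, hy, rfl⟩
      refine ⟨(oneChart E G).map_target (hRt (hballs hy)), ?_⟩
      rw [mem_preimage, (oneChart E G).right_inv (hRt (hballs hy))]
      exact hballs hy
    have hsu : s < u := by
      refine lt_of_le_of_ne hu.1 fun h => huU ?_
      rw [← h, hzs]
      exact ⟨one_mem_oneChart_source, Metric.mem_ball_self hR⟩
    have hIco : Ico s u ⊆ z ⁻¹' W := by
      intro x hx
      have hxt : x ∈ Icc s t := ⟨hx.1, hx.2.le.trans hu.2⟩
      have h1 := key x hxt fun q hq => hbefore q ⟨hq.1, hq.2.trans_lt hx.2⟩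
      refine ⟨oneChart E G (z x), ?_, (oneChart E G).left_inv (hbefore x hx).1⟩
      rw [Metric.mem_closedBall, dist_eq_norm]
      refine h1.trans (le_trans ?_ hσK)
      gcongr
      exact hωσ ⟨le_rfl, hst⟩ hxt
    have := closure_minimal hIco (hWc.preimage hzc)
    rw [closure_Ico hsu.ne] at this
    exact huU (hWU (this ⟨hu.1, le_rfl⟩))
  have ht : t ∈ Icc s t := ⟨hst, le_rfl⟩
  have hfin := key t ht hall
  rw [leftEDist_eq_one_inv_mul]
  have h1 := hC₁ (oneChart E G (z t)) (Metric.ball_subset_ball (min_le_right _ _) (hall t ht).2)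
  rw [(oneChart E G).left_inv (hall t ht).1] at h1
  refine h1.trans ?_
  rw [ENNReal.coe_mul, mul_assoc]
  gcongr
  rw [← ofReal_norm]
  refine (ENNReal.ofReal_le_ofReal hfin).trans (le_of_eq ?_)
  rw [ENNReal.ofReal_mul (by positivity), ENNReal.ofReal_mul (by positivity),
    ← ENNReal.ofReal_rpow_of_nonneg ENNReal.toReal_nonneg (by positivity),
    ENNReal.ofReal_toReal (hωtop ⟨le_rfl, hst⟩ ht)]
  simp

end LocalEstimate

/-! ### From the local estimate to the truncated variations. -/

section Control

variable {G : Type*} {d : G → G → ℝ≥0∞} {γ : ℝ → G} {X : ℝ → ℂ} {ρ r : ℝ}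

/-- From small to large variation of the driving path, by cutting into pieces. -/
theorem le_nat_mul_of_local (hρ : 0 < ρ) (hself : ∀ g, d g g = 0)
    (htri : ∀ g h k, d g k ≤ d g h + d h k)
    (hcont : Continuous fun q : ℝ × ℝ => d (γ q.1) (γ q.2)) {δ B : ℝ≥0}
    (hloc : ∀ s t, s ≤ t → powVariationOn edist ρ X (Icc s t) ≤ δ → d (γ s) (γ t) ≤ B) (n : ℕ) :
    ∀ s t, s ≤ t → powVariationOn edist ρ X (Icc s t) ≤ (n + 1) * δ →
      d (γ s) (γ t) ≤ (n + 1) * B := by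
  induction n with
  | zero => simpa using hloc
  | succ n ih =>
    intro s t hst h
    push_cast at h ⊢
    -- The variation is not assumed continuous in its endpoint, so the cut is at the supremum `m`.
    -- The inductive bound reaches `m` by continuity of the distance along the curve. For `u > m`
    -- the variation on `[s, u]` exceeds `(n + 1) * δ`, so superadditivity leaves at most `δ` on
    -- `[u, t]`; then `u` decreases to `m`.
    set T : Set ℝ := {u | u ∈ Icc s t ∧ powVariationOn edist ρ X (Icc s u) ≤ (n + 1) * δ} with hT
    have hsT : s ∈ T := by
      refine ⟨⟨le_rfl, hst⟩, le_of_eq_of_le ?_ zero_le⟩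
      refine le_antisymm (powVariationOn_le fun n u _ hu => ?_) zero_le
      have hus : ∀ j, u j = s := fun j => by simpa using hu j
      simp [hus, hρ]
    have hTb : BddAbove T := ⟨t, fun u hu => hu.1.2⟩
    set m := sSup T with hm
    have hsm : s ≤ m := le_csSup hTb hsT
    have hmt : m ≤ t := csSup_le ⟨s, hsT⟩ fun u hu => hu.1.2
    have h1 : d (γ s) (γ m) ≤ (n + 1) * B := by
      have hcl : IsClosed {u | d (γ s) (γ u) ≤ (n + 1) * B} :=
        isClosed_le (hcont.comp (by fun_prop : Continuous fun u : ℝ => (s, u))) continuous_const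
      exact closure_minimal (fun u hu => ih s u hu.1.1 hu.2) hcl (csSup_mem_closure ⟨s, hsT⟩ hTb)
    have h2 : d (γ m) (γ t) ≤ B := by
      rcases hmt.eq_or_lt with heq | hlt
      · rw [heq, hself]
        exact zero_le
      have hcl : IsClosed {u | d (γ u) (γ t) ≤ B} :=
        isClosed_le (hcont.comp (by fun_prop : Continuous fun u : ℝ => (u, t))) continuous_const
      have hsub : Ioc m t ⊆ {u | d (γ u) (γ t) ≤ B} := by
        intro u hu
        have hsu : s ≤ u := hsm.trans hu.1.le
        refine hloc u t hu.2 (not_lt.1 fun hlt => ?_)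
        have hgt : (n + 1) * (δ : ℝ≥0∞) < powVariationOn edist ρ X (Icc s u) := by
          by_contra hle
          exact absurd (le_csSup hTb ⟨⟨hsu, hu.2⟩, not_lt.1 hle⟩) (not_le.2 hu.1)
        have := (ENNReal.add_lt_add hgt hlt).trans_le ((powVariationOn_Icc_add_le hsu hu.2).trans h)
        exact absurd this (not_lt.2 (le_of_eq (by ring)))
      have := closure_minimal hsub hcl
      rw [closure_Ioc hlt.ne] at this
      exact this ⟨le_rfl, hmt⟩
    calc d (γ s) (γ t) ≤ (n + 1) * B + B := (htri _ _ _).trans (add_le_add h1 h2)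
      _ = _ := by ring

/-- The number of pieces `⌊a / δ⌋₊ + 1` is at most `2 * a / δ` once `a ≥ δ`, and each costs `B`. The
extra 1 in the constant keeps it nonzero, which settles the case of infinite variation. -/
theorem le_mul_of_local (hρ : 0 < ρ) (hself : ∀ g, d g g = 0)
    (htri : ∀ g h k, d g k ≤ d g h + d h k)
    (hcont : Continuous fun q : ℝ × ℝ => d (γ q.1) (γ q.2)) {δ B : ℝ≥0} (hδ : 0 < δ)
    (hloc : ∀ s t, s ≤ t → powVariationOn edist ρ X (Icc s t) ≤ δ → d (γ s) (γ t) ≤ B)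
    {s t : ℝ} (hst : s ≤ t) (h : δ < powVariationOn edist ρ X (Icc s t)) :
    d (γ s) (γ t) ≤ (2 * B / δ + 1 : ℝ≥0) * powVariationOn edist ρ X (Icc s t) := by
  rcases eq_or_ne (powVariationOn edist ρ X (Icc s t)) ⊤ with htop | htop
  · rw [htop, ENNReal.mul_top (by simp)]
    exact le_top
  obtain ⟨a, ha⟩ : ∃ a : ℝ≥0, (a : ℝ≥0∞) = powVariationOn edist ρ X (Icc s t) :=
    ⟨_, ENNReal.coe_toNNReal htop⟩
  rw [← ha] at h ⊢
  have hδa : δ ≤ a := by exact_mod_cast h.le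
  have hle := le_nat_mul_of_local hρ hself htri hcont hloc ⌊a / δ⌋₊ s t hst (by
    rw [← ha]
    have : a ≤ (⌊a / δ⌋₊ + 1) * δ := by
      rw [← div_le_iff₀ hδ]
      exact (Nat.lt_floor_add_one _).le
    exact_mod_cast this)
  refine hle.trans ?_
  have h1 : (⌊a / δ⌋₊ + 1) * B ≤ (2 * B / δ + 1) * a := by
    have h2 : (⌊a / δ⌋₊ : ℝ≥0) ≤ a / δ := Nat.floor_le zero_le
    have h3 : 1 ≤ a / δ := (one_le_div hδ).2 hδa
    calc (⌊a / δ⌋₊ + 1) * B ≤ (a / δ + a / δ) * B := by gcongr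
      _ = 2 * B / δ * a := by ring
      _ ≤ _ := by gcongr; exact le_self_add
  exact_mod_cast h1

/-- The `ρ`-th powers of the increments sum by superadditivity of the control, and the `ℓ^r` norm is
at most the `ℓ^ρ` norm. -/
theorem rVariationOn_le_of_increment_le (hρ : 0 < ρ) (hρr : ρ ≤ r) {S : Set ℝ} {B : ℝ≥0∞}
    (h : ∀ s ∈ S, ∀ t ∈ S, s ≤ t →
      d (γ t) (γ s) ≤ B * powVariationOn edist ρ X (Icc s t) ^ (1 / ρ)) :
    rVariationOn d r γ S ≤ B * rVariationOn edist ρ X univ := by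
  refine rVariationOn_le fun n t ht htS => (rpow_sum_le_rpow_sum _ _ hρ hρr).trans ?_
  have hj : ∀ j, d (γ (t (j + 1))) (γ (t j)) ^ ρ ≤
      B ^ ρ * powVariationOn edist ρ X (Icc (t j) (t (j + 1))) := by
    intro j
    calc _ ≤ (B * powVariationOn edist ρ X (Icc (t j) (t (j + 1))) ^ (1 / ρ)) ^ ρ :=
          ENNReal.rpow_le_rpow (h _ (htS j) _ (htS (j + 1)) (ht j.le_succ)) hρ.le
      _ = _ := by
          rw [ENNReal.mul_rpow_of_nonneg _ _ hρ.le, ← ENNReal.rpow_mul, one_div_mul_cancel hρ.ne',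
            ENNReal.rpow_one]
  calc _ ≤ (B ^ ρ * powVariationOn edist ρ X univ) ^ (1 / ρ) := by
        refine ENNReal.rpow_le_rpow ?_ (by positivity)
        refine (Finset.sum_le_sum fun j _ => hj j).trans ?_
        rw [← Finset.mul_sum]
        gcongr
        exact (sum_powVariationOn_Icc_le ht n).trans (powVariationOn_mono (subset_univ _))
    _ = _ := by
        rw [ENNReal.mul_rpow_of_nonneg _ _ (by positivity), ← ENNReal.rpow_mul,
          mul_one_div_cancel hρ.ne', ENNReal.rpow_one, rVariationOn_eq_rpow hρ]

lemma rpow_le_mul_rpow_of_le {θ : ℝ≥0} (hθ : 0 < θ) {x : ℝ≥0∞} (hx : θ ≤ x) {q r : ℝ} (hq : 0 ≤ q)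
    (hqr : q ≤ r) : x ^ q ≤ (θ ^ (q - r) : ℝ≥0) * x ^ r := by
  have hθ0 : (θ : ℝ≥0∞) ≠ 0 := by exact_mod_cast hθ.ne'
  rw [ENNReal.coe_rpow_of_ne_zero hθ.ne']
  calc x ^ q = (θ : ℝ≥0∞) ^ (q - r) * (θ : ℝ≥0∞) ^ (r - q) * x ^ q := by
        rw [← ENNReal.rpow_add _ _ hθ0 ENNReal.coe_ne_top]
        simp
    _ ≤ (θ : ℝ≥0∞) ^ (q - r) * x ^ (r - q) * x ^ q := by
        gcongr
    _ = _ := by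
        rw [mul_assoc, ← ENNReal.rpow_add_of_nonneg _ _ (by linarith) hq, sub_add_cancel]

/-- The pointwise estimates of the truncated variations by the variation of the driving path. -/
theorem exists_truncated_le (hρ1 : 1 ≤ ρ) (hρr : ρ ≤ r) {δ : ℝ≥0} (hδ : 0 < δ) (C₁ C₂ : ℝ≥0) :
    ∃ C θ : ℝ≥0, 0 < θ ∧ ∀ (γ : ℝ → G) (X : ℝ → ℂ), (∀ g h, d g h = d h g) →
      (∀ s t, s ≤ t → powVariationOn edist ρ X (Icc s t) ≤ δ →
        d (γ s) (γ t) ≤ C₁ * powVariationOn edist ρ X (Icc s t) ^ (1 / ρ)) →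
      (∀ s t, s ≤ t → δ < powVariationOn edist ρ X (Icc s t) →
        d (γ s) (γ t) ≤ C₂ * powVariationOn edist ρ X (Icc s t)) →
      (∀ S, (∀ s ∈ S, ∀ t ∈ S, d (γ s) (γ t) ≤ 2) →
        rVariationOn d r γ S ≤ C * rVariationOn edist ρ X univ) ∧
      (∀ S, θ ≤ rVariationOn edist ρ X univ →
        rVariationOn d r γ S ≤ C * rVariationOn edist ρ X univ ^ r) ∧
      (rVariationOn edist ρ X univ < θ →
        (∀ s t, d (γ s) (γ t) < 1) ∧ rVariationOn d r γ univ < 1) := by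
  have hρ : 0 < ρ := by linarith
  have hρi : 0 ≤ 1 - 1 / ρ := by rw [sub_nonneg, div_le_one hρ]; exact hρ1
  -- Below the first bound every interval is in the local regime; the second then gives `C₁ * a <
  -- 1`.
  set θ : ℝ≥0 := min (δ ^ (1 / ρ)) (1 / (C₁ + 1)) with hθ
  have hθ0 : 0 < θ := by
    have : 0 < δ ^ (1 / ρ) := NNReal.rpow_pos hδ
    positivity
  refine ⟨max (max C₁ (2 * δ ^ (-(1 / ρ)))) (C₁ * θ ^ (1 - r) + C₂ * θ ^ (ρ - r)), θ, hθ0, ?_⟩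
  intro γ X hsymm hloc hlin
  set a := rVariationOn edist ρ X univ with ha
  have hωa : ∀ s t, powVariationOn edist ρ X (Icc s t) ^ (1 / ρ) ≤ a := by
    intro s t
    rw [ha, rVariationOn_eq_rpow hρ]
    exact ENNReal.rpow_le_rpow (powVariationOn_mono (subset_univ _)) (by positivity)
  have hωa' : ∀ s t, powVariationOn edist ρ X (Icc s t) ≤ a ^ ρ := by
    intro s t
    rw [ha, rVariationOn_rpow hρ]
    exact powVariationOn_mono (subset_univ _)
  refine ⟨fun S hS => ?_, fun S haθ => ?_, fun haθ => ?_⟩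
  -- Outside the local regime, distances bounded by 2 are at most `2 * δ ^ (-(1 / ρ))` times the
  -- control to the power `1 / ρ`.
  · have h1 : rVariationOn d r γ S ≤ (max C₁ (2 * δ ^ (-(1 / ρ))) : ℝ≥0) * a := by
      refine rVariationOn_le_of_increment_le hρ hρr fun s hs t ht hst => ?_
      rw [hsymm]
      rcases le_or_gt (powVariationOn edist ρ X (Icc s t)) δ with hle | hgt
      · refine (hloc s t hst hle).trans ?_
        gcongr
        exact le_max_left _ _
      · refine (hS s hs t ht).trans ?_
        have hδ' : (δ : ℝ≥0∞) ≠ 0 := by exact_mod_cast hδ.ne'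
        calc (2 : ℝ≥0∞) = 2 * ((δ : ℝ≥0∞) ^ (-(1 / ρ)) * (δ : ℝ≥0∞) ^ (1 / ρ)) := by
              rw [← ENNReal.rpow_add _ _ hδ' ENNReal.coe_ne_top]
              simp
          _ ≤ 2 * ((δ : ℝ≥0∞) ^ (-(1 / ρ)) * powVariationOn edist ρ X (Icc s t) ^ (1 / ρ)) := by
              gcongr
          _ = (2 * δ ^ (-(1 / ρ)) : ℝ≥0) * powVariationOn edist ρ X (Icc s t) ^ (1 / ρ) := by
              rw [ENNReal.coe_mul, ENNReal.coe_rpow_of_ne_zero hδ.ne', mul_assoc]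
              rfl
          _ ≤ _ := by
              gcongr
              exact le_max_right _ _
    exact h1.trans (mul_le_mul' (ENNReal.coe_le_coe.2 (le_max_left _ _)) le_rfl)
  -- In the linear regime ω = ω^{1-1/ρ} ω^{1/ρ} ≤ a^{ρ-1} ω^{1/ρ}. The total is of order a + a^ρ,
  -- and `a ≥ θ` lets `a ^ r` dominate both.
  · have h1 : rVariationOn d r γ S ≤ (C₁ + C₂ * a ^ (ρ - 1)) * a := by
      refine rVariationOn_le_of_increment_le hρ hρr fun s hs t ht hst => ?_
      rw [hsymm]
      rcases le_or_gt (powVariationOn edist ρ X (Icc s t)) δ with hle | hgt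
      · refine (hloc s t hst hle).trans ?_
        gcongr
        exact le_self_add
      · refine (hlin s t hst hgt).trans ?_
        rw [add_mul]
        refine le_trans ?_ le_add_self
        rw [mul_assoc]
        gcongr
        calc powVariationOn edist ρ X (Icc s t) = powVariationOn edist ρ X (Icc s t) ^ (1 - 1 / ρ) *
              powVariationOn edist ρ X (Icc s t) ^ (1 / ρ) := by
              rw [← ENNReal.rpow_add_of_nonneg _ _ hρi (by positivity), sub_add_cancel,
                ENNReal.rpow_one]
          _ ≤ (a ^ ρ) ^ (1 - 1 / ρ) * powVariationOn edist ρ X (Icc s t) ^ (1 / ρ) := by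
              gcongr
              exact hωa' s t
          _ = _ := by
              rw [← ENNReal.rpow_mul, mul_sub, mul_one, mul_one_div_cancel hρ.ne']
    have h2 : a ≤ (θ ^ (1 - r) : ℝ≥0) * a ^ r := by
      have := rpow_le_mul_rpow_of_le hθ0 haθ zero_le_one (hρ1.trans hρr)
      rwa [ENNReal.rpow_one] at this
    have h3 : a ^ (ρ - 1) * a ≤ (θ ^ (ρ - r) : ℝ≥0) * a ^ r := by
      have h4 : a ^ (ρ - 1) * a = a ^ ρ := by
        conv_lhs => rw [← ENNReal.rpow_one a, ← ENNReal.rpow_mul, one_mul,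
          ← ENNReal.rpow_add_of_nonneg _ _ (by linarith) zero_le_one, sub_add_cancel]
      rw [h4]
      exact rpow_le_mul_rpow_of_le hθ0 haθ hρ.le hρr
    calc _ ≤ (C₁ + C₂ * a ^ (ρ - 1)) * a := h1
      _ = C₁ * a + C₂ * (a ^ (ρ - 1) * a) := by ring
      _ ≤ C₁ * ((θ ^ (1 - r) : ℝ≥0) * a ^ r) + C₂ * ((θ ^ (ρ - r) : ℝ≥0) * a ^ r) := by gcongr
      _ = (C₁ * θ ^ (1 - r) + C₂ * θ ^ (ρ - r) : ℝ≥0) * a ^ r := by push_cast; ring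
      _ ≤ _ := by
          gcongr
          exact le_max_right _ _
  · have hsm : ∀ s t, powVariationOn edist ρ X (Icc s t) ≤ δ := by
      intro s t
      have h1 : a ≤ (δ : ℝ≥0∞) ^ (1 / ρ) := by
        rw [← ENNReal.coe_rpow_of_ne_zero hδ.ne']
        exact haθ.le.trans (by exact_mod_cast min_le_left _ _)
      calc _ ≤ a ^ ρ := hωa' s t
        _ ≤ ((δ : ℝ≥0∞) ^ (1 / ρ)) ^ ρ := by gcongr
        _ = δ := by rw [← ENNReal.rpow_mul, one_div_mul_cancel hρ.ne', ENNReal.rpow_one]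
    have hlt : C₁ * a < 1 := by
      have h1 : a ≤ (1 / (C₁ + 1) : ℝ≥0) := haθ.le.trans (by exact_mod_cast min_le_right _ _)
      refine (mul_le_mul_right h1 _).trans_lt ?_
      rw [← ENNReal.coe_mul, ENNReal.coe_lt_one_iff, mul_one_div,
        div_lt_one (by positivity)]
      exact lt_add_one _
    have hinc : ∀ s t, s ≤ t → d (γ s) (γ t) < 1 := fun s t hst =>
      ((hloc s t hst (hsm s t)).trans (by gcongr; exact hωa s t)).trans_lt hlt
    refine ⟨fun s t => ?_, lt_of_le_of_lt (rVariationOn_le_of_increment_le hρ hρr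
      fun s _ t _ hst => ?_) hlt⟩
    · rcases le_total s t with hst | hst
      · exact hinc s t hst
      · rw [hsymm]
        exact hinc t s hst
    · rw [hsymm]
      exact hloc s t hst (hsm s t)

end Control

/-! ### Measurability of the variation in the frequency. -/

lemma _root_.IsSigmaCompact.measurableSet {X : Type*} [TopologicalSpace X] [T2Space X]
    [MeasurableSpace X] [OpensMeasurableSpace X] {s : Set X} (hs : IsSigmaCompact s) :
    MeasurableSet s := by
  obtain ⟨K, hK, rfl⟩ := hs
  exact MeasurableSet.iUnion fun n => (hK n).measurableSet

/-- An open set of a pseudo-metric space is a countable union of closed sets, so `F ∩ U` is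
σ-compact, and so is its continuous image. -/
lemma measurableSet_image_of_isClosed_inter_isOpen {X Y : Type*} [PseudoEMetricSpace X]
    [SigmaCompactSpace X] [TopologicalSpace Y] [T2Space Y] [MeasurableSpace Y]
    [OpensMeasurableSpace Y] {φ : X → Y} (hφ : Continuous φ) {F U : Set X} (hF : IsClosed F)
    (hU : IsOpen U) : MeasurableSet (φ '' (F ∩ U)) := by
  obtain ⟨K, hK, -, hKU, -⟩ := hU.exists_iUnion_isClosed
  rw [← hKU, inter_iUnion, image_iUnion]
  exact MeasurableSet.iUnion fun n => ((isSigmaCompact_univ.of_isClosed_subset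
    (hF.inter (hK n)) (subset_univ _)).image hφ).measurableSet

/-- The variation of a family of curves on a closed family of sets is measurable. -/
theorem measurable_rVariationOn {G : Type*} {d : G → G → ℝ≥0∞} {Γ : ℝ → ℝ → G}
    (hd : Continuous fun q : ℝ × ℝ × ℝ => d (Γ q.1 q.2.1) (Γ q.1 q.2.2)) {S : ℝ → Set ℝ}
    (hS : IsClosed {q : ℝ × ℝ | q.2 ∈ S q.1}) (r : ℝ) :
    Measurable fun k => rVariationOn d r (Γ k) (S k) := by
  refine measurable_of_Ioi fun l => ?_
  -- A partition with `n` increments is a point of ℝ^{n+1}, repeated at its last entry to form a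
  -- sequence. Admissibility (`F`) is a closed condition and exceeding the level `l` (`U`) an open
  -- one; the superlevel set is the union of their projections.
  let ι : ∀ n : ℕ, ℕ → Fin (n + 1) := fun n j => ⟨min j n, by omega⟩
  have hι : ∀ n, Monotone (ι n) := fun n i j hij => by
    simp only [ι, Fin.mk_le_mk]
    omega
  let F : ∀ n : ℕ, Set (ℝ × (Fin (n + 1) → ℝ)) := fun n =>
    (⋂ (i : Fin (n + 1)) (j : Fin (n + 1)) (_ : i ≤ j), {q | q.2 i ≤ q.2 j}) ∩
      ⋂ i : Fin (n + 1), {q | q.2 i ∈ S q.1}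
  let U : ∀ n : ℕ, Set (ℝ × (Fin (n + 1) → ℝ)) := fun n =>
    {q | l < (∑ j ∈ Finset.range n, d (Γ q.1 (q.2 (ι n (j + 1)))) (Γ q.1 (q.2 (ι n j))) ^ r) ^
      (1 / r)}
  have hF : ∀ n, IsClosed (F n) := by
    intro n
    refine IsClosed.inter (isClosed_iInter fun i => isClosed_iInter fun j => isClosed_iInter fun _ =>
      isClosed_le (by fun_prop) (by fun_prop)) (isClosed_iInter fun i => ?_)
    exact hS.preimage (by fun_prop : Continuous fun q : ℝ × (Fin (n + 1) → ℝ) => (q.1, q.2 i))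
  have hU : ∀ n, IsOpen (U n) := by
    intro n
    refine isOpen_lt continuous_const (ENNReal.continuous_rpow_const.comp
      (continuous_finsetSum _ fun j _ => ENNReal.continuous_rpow_const.comp ?_))
    exact hd.comp (by fun_prop : Continuous fun q : ℝ × (Fin (n + 1) → ℝ) =>
      (q.1, q.2 (ι n (j + 1)), q.2 (ι n j)))
  have heq : (fun k => rVariationOn d r (Γ k) (S k)) ⁻¹' Ioi l =
      ⋃ n, Prod.fst '' (F n ∩ U n) := by
    ext k
    simp only [mem_preimage, mem_Ioi, mem_iUnion, mem_image, Prod.exists, exists_and_right,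
      exists_eq_right]
    constructor
    · intro h
      simp only [rVariationOn, lt_iSup_iff] at h
      obtain ⟨n, t, ht, htS, hlt⟩ := h
      refine ⟨n, fun i => t i, ⟨?_, ?_⟩, ?_⟩
      · simp only [mem_iInter]
        exact fun i j hij => ht hij
      · simp only [mem_iInter]
        exact fun i => htS i
      · refine lt_of_lt_of_eq hlt ?_
        congr 1
        refine Finset.sum_congr rfl fun j hj => ?_
        rw [Finset.mem_range] at hj
        simp only [ι]
        rw [min_eq_left (by omega : j + 1 ≤ n), min_eq_left hj.le]
    · rintro ⟨n, t, ⟨h1, h2⟩, h3⟩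
      simp only [mem_iInter] at h1 h2
      refine lt_of_lt_of_le h3 (le_rVariationOn (t := fun j => t (ι n j)) ?_ (fun j => h2 _) n)
      exact fun i j hij => h1 _ _ (hι n hij)
  rw [heq]
  exact MeasurableSet.iUnion fun n =>
    measurableSet_image_of_isClosed_inter_isOpen continuous_fst (hF n) (hU n)

/-- Pointwise bounds by powers of a function in `L^q` give the truncated bounds. -/
lemma truncatedBounds_of_le {G : Type*} {d : G → G → ℝ≥0∞} {q : ℝ≥0∞} {r : ℝ} (hr : 0 < r)
    {Γ : ℝ → ℝ → G} {size : ℝ → ℝ → ℝ≥0∞} {a : ℝ → ℝ≥0∞} {C C' : ℝ≥0} {A : ℝ≥0∞}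
    (ha : eLpNorm a q volume ≤ C' * A)
    (hle : ∀ k, rVariationOn d r (Γ k) {x | size k x ≤ 1} ≤ C * a k)
    (hge : ∀ k, rVariationOn d r (Γ k) {x | 1 ≤ size k x} ≤ C * a k ^ r)
    (hmle : Measurable fun k => rVariationOn d r (Γ k) {x | size k x ≤ 1})
    (hmge : Measurable fun k => rVariationOn d r (Γ k) {x | 1 ≤ size k x}) :
    TruncatedBounds d q r ((max (C * C') (C ^ (1 / r) * C') : ℝ≥0) * A) Γ size where
  aemeasurable_le := hmle.aemeasurable
  aemeasurable_ge := hmge.aemeasurable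
  bound_le := by
    refine (eLpNorm_le_nnreal_smul_eLpNorm_of_ae_le_mul' (c := C) (g := a)
      (ae_of_all _ fun k => by simpa [enorm_eq_self] using hle k) q).trans ?_
    rw [ENNReal.smul_def, smul_eq_mul]
    calc (C : ℝ≥0∞) * eLpNorm a q volume ≤ C * (C' * A) := by gcongr
      _ = (C * C' : ℝ≥0) * A := by push_cast; ring
      _ ≤ _ := by
        gcongr
        exact le_max_left _ _
  bound_ge := by
    have hr' : ENNReal.ofReal r ≠ 0 := by simpa using hr
    -- The norm of `a ^ r` with exponent `q / r` is the `r`-th power of the norm of `a` with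
    -- exponent `q`, so the final root restores linearity in `A`.
    have h1 : eLpNorm (fun k => rVariationOn d r (Γ k) {x | 1 ≤ size k x})
        (q / ENNReal.ofReal r) volume ≤ C * (C' * A) ^ r := by
      refine (eLpNorm_le_nnreal_smul_eLpNorm_of_ae_le_mul' (c := C) (g := fun k => a k ^ r)
        (ae_of_all _ fun k => by simpa [enorm_eq_self] using hge k) _).trans ?_
      rw [ENNReal.smul_def, smul_eq_mul, eLpNorm_rpow_of_pos _ hr,
        ENNReal.div_mul_cancel hr' ENNReal.ofReal_ne_top]
      gcongr
    calc _ ≤ ((C : ℝ≥0∞) * (C' * A) ^ r) ^ (1 / r) := ENNReal.rpow_le_rpow h1 (by positivity)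
      _ = (C : ℝ≥0∞) ^ (1 / r) * (C' * A) := by
          rw [ENNReal.mul_rpow_of_nonneg _ _ (by positivity), ← ENNReal.rpow_mul,
            mul_one_div_cancel hr.ne', ENNReal.rpow_one]
      _ = (C ^ (1 / r) * C' : ℝ≥0) * A := by
          rw [ENNReal.coe_mul, ENNReal.coe_rpow_of_nonneg _ (by positivity), mul_assoc]
      _ ≤ _ := by
        gcongr
        exact le_max_right _ _

lemma TruncatedBounds.mono {G : Type*} {d : G → G → ℝ≥0∞} {q : ℝ≥0∞} {r : ℝ} {B B' : ℝ≥0∞}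
    {Γ : ℝ → ℝ → G} {size : ℝ → ℝ → ℝ≥0∞} (h : TruncatedBounds d q r B Γ size) (hB : B ≤ B') :
    TruncatedBounds d q r B' Γ size :=
  ⟨h.aemeasurable_le, h.bound_le.trans hB, h.aemeasurable_ge, h.bound_ge.trans hB⟩

/-- The opposite group structure on the same type. -/
@[reducible] def oppositeGroup (G : Type*) [Group G] : Group G :=
  @Group.ofLeftAxioms G ⟨fun g h => h * g⟩ ⟨fun g => g⁻¹⟩ ⟨1⟩
    (fun g h k => (mul_assoc k h g).symm) mul_one mul_inv_cancel

/-! ### The left equation, and the right one through the opposite group. -/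

section Main

variable {E : Type*} [NormedAddCommGroup E] [NormedSpace ℝ E] [FiniteDimensional ℝ E]
  {G : Type*} [TopologicalSpace G] [T2Space G] [ChartedSpace E G] [Group G]
  [LieGroup 𝓘(ℝ, E) ∞ G]

lemma IsLeftNC.isSolOn {w v : GroupLieAlgebra 𝓘(ℝ, E) G} {f : ℝ → ℂ} {Γ : ℝ → ℝ → G}
    (h : IsLeftNC w v f Γ) (k a b : ℝ) : IsSolOn w v (modulate f k) (Γ k) a b :=
  isSolOn_of_isLocallyAC (h.locallyAC k) (h.ode k) a b

/-- The theorem for the left equation and the left-invariant distance. -/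
theorem exists_left_truncatedBounds (N : Seminorm ℝ (GroupLieAlgebra 𝓘(ℝ, E) G))
    (w v : GroupLieAlgebra 𝓘(ℝ, E) G) {p p' : ℝ≥0∞} (hp1 : 1 ≤ p) (hp2 : p < 2)
    (hpp' : p.HolderConjugate p') {r : ℝ} (hr : p < ENNReal.ofReal r) :
    ∃ C : ℝ≥0, ∀ f : ℝ → ℂ, MemLp f p volume → (∃! Γ : ℝ → ℝ → G, IsLeftNC w v f Γ) ∧
      ∀ Γ : ℝ → ℝ → G, IsLeftNC w v f Γ →
        TruncatedBounds (leftEDist N) p' r (C * eLpNorm f p volume) Γ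
          (fun k x => leftEDist N 1 (Γ k x)) ∧
        TruncatedBounds (leftEDist N) p' r (C * eLpNorm f p volume) Γ
          (fun k _ => rVariationOn (leftEDist N) r (Γ k) univ) := by
  have hptop : p ≠ ⊤ := (hp2.trans (by norm_num)).ne
  -- `ρ > p` for the linear estimate, `ρ < 2` for Young's regime, `ρ ≤ r` to pass from `ρ`- to
  -- `r`-variation.
  obtain ⟨ρ, hρp, hρm⟩ : ∃ ρ, p.toReal < ρ ∧ ρ < min r 2 := by
    refine exists_between (lt_min ((ENNReal.lt_ofReal_iff_toReal_lt hptop).1 hr) ?_)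
    exact (ENNReal.toReal_lt_toReal hptop (by norm_num)).2 hp2
  have hp1' : 1 ≤ p.toReal := by
    rw [← ENNReal.toReal_one]
    exact ENNReal.toReal_mono hptop hp1
  have hρ1 : 1 ≤ ρ := by linarith
  have hρ0 : 0 < ρ := by linarith
  have hρ2 : ρ < 2 := hρm.trans_le (min_le_right _ _)
  have hρr : ρ ≤ r := (hρm.trans_le (min_le_left _ _)).le
  have hr0 : 0 < r := by linarith
  obtain ⟨C₀, hC₀⟩ := exists_eLpNorm_rVariationOn_partialFourier_le hp1 hp2 hpp'
    ((ENNReal.lt_ofReal_iff_toReal_lt hptop).2 hρp) hρ2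
  obtain ⟨C₁, δ, hδ, hloc⟩ := exists_leftEDist_le_of_small N w v hρ1 hρ2
  obtain ⟨C, θ, hθ, htr⟩ := exists_truncated_le (d := leftEDist N) (r := r) hρ1 hρr hδ C₁
    (2 * (C₁ * δ ^ (1 / ρ)) / δ + 1)
  refine ⟨max (C * C₀) (C ^ (1 / r) * C₀), fun f hf => ?_⟩
  have hfi : ∀ a b, IntervalIntegrable f volume a b := fun a b =>
    intervalIntegrable_iff.2 (((hf.locallyIntegrable hp1).integrableOn_isCompact
      isCompact_uIcc).mono_set uIoc_subset_uIcc)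
  have hci := intervalIntegrable_modulate hfi
  obtain ⟨Γ₀, hΓ₀c, hΓ₀1, hΓ₀s⟩ := exists_solution w v hp1 hptop hf
  have hΓ₀ : IsLeftNC w v f Γ₀ := ⟨hΓ₀1, fun k => isLocallyAC_of_isSolOn (hΓ₀s k),
    fun k => ae_hasMFDerivAt_of_isSolOn (hΓ₀s k)⟩
  have huniq : ∀ Γ, IsLeftNC w v f Γ → Γ = Γ₀ := fun Γ hΓ => funext fun k =>
    IsSolOn.unique (hci k) (hΓ.isSolOn k) (hΓ₀.isSolOn k) (by rw [hΓ.init, hΓ₀.init])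
  refine ⟨⟨Γ₀, hΓ₀, huniq⟩, fun Γ hΓ => ?_⟩
  -- Joint continuity is built into the constructed solution and passes to `Γ` by uniqueness.
  have hΓc : Continuous fun q : ℝ × ℝ => Γ q.1 q.2 := by rw [huniq Γ hΓ]; exact hΓ₀c
  have hdc : Continuous fun q : ℝ × ℝ × ℝ => leftEDist N (Γ q.1 q.2.1) (Γ q.1 q.2.2) :=
    (continuous_leftEDist N).comp ((hΓc.comp (by fun_prop : Continuous fun q : ℝ × ℝ × ℝ =>
      (q.1, q.2.1))).prodMk (hΓc.comp (by fun_prop : Continuous fun q : ℝ × ℝ × ℝ =>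
      (q.1, q.2.2))))
  have hd1 : Continuous fun q : ℝ × ℝ => leftEDist N 1 (Γ q.1 q.2) :=
    (continuous_leftEDist N).comp (continuous_const.prodMk hΓc)
  set a : ℝ → ℝ≥0∞ := fun k => rVariationOn edist ρ (partialFourier f k) univ with ha
  have hloc' : ∀ k s t, s ≤ t → powVariationOn edist ρ (partialFourier f k) (Icc s t) ≤ δ →
      leftEDist N (Γ k s) (Γ k t) ≤
        C₁ * powVariationOn edist ρ (partialFourier f k) (Icc s t) ^ (1 / ρ) := fun k =>
    hloc (modulate f k) (partialFourier f k) (Γ k) (hci k) (partialFourier_sub hfi k) (hΓ.isSolOn k)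
  have hlin : ∀ k s t, s ≤ t → δ < powVariationOn edist ρ (partialFourier f k) (Icc s t) →
      leftEDist N (Γ k s) (Γ k t) ≤ (2 * (C₁ * δ ^ (1 / ρ)) / δ + 1 : ℝ≥0) *
        powVariationOn edist ρ (partialFourier f k) (Icc s t) := by
    intro k s t hst h
    refine le_mul_of_local (γ := Γ k) hρ0 (leftEDist_self N) (leftEDist_triangle N)
      (hdc.comp (by fun_prop : Continuous fun q : ℝ × ℝ => (k, q.1, q.2))) hδ
      (fun s t hst h => (hloc' k s t hst h).trans ?_) hst h
    rw [ENNReal.coe_mul, ENNReal.coe_rpow_of_nonneg _ (by positivity)]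
    gcongr
  have H := fun k => htr (Γ k) (partialFourier f k) (leftEDist_comm N) (hloc' k) (hlin k)
  -- For small `a k` the power `a k ^ r` could not dominate `a k`; there the bound holds because the
  -- truncated set is empty.
  have hge : ∀ k S, (a k < θ → S = ∅) →
      rVariationOn (leftEDist N) r (Γ k) S ≤ C * a k ^ r := by
    intro k S hS
    rcases lt_or_ge (a k) θ with h | h
    · rw [hS h, rVariationOn_empty]
      exact zero_le
    · exact (H k).2.1 S h
  refine ⟨truncatedBounds_of_le hr0 (hC₀ f hf) (fun k => (H k).1 _ fun s hs t ht => ?_)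
    (fun k => hge k _ fun hak => ?_) ?_ ?_,
    truncatedBounds_of_le hr0 (hC₀ f hf) (fun k => (H k).1 _ fun s hs t ht => ?_)
    (fun k => hge k _ fun hak => ?_) ?_ ?_⟩
  · refine (leftEDist_triangle N _ 1 _).trans ?_
    rw [leftEDist_comm N _ 1, ← one_add_one_eq_two]
    exact add_le_add hs ht
  · refine eq_empty_of_forall_notMem fun x hx => ?_
    have := ((H k).2.2 hak).1 0 x
    rw [hΓ.init k] at this
    exact absurd hx (not_le.2 this)
  · have hS : IsClosed {q : ℝ × ℝ | leftEDist N 1 (Γ q.1 q.2) ≤ 1} :=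
      isClosed_le hd1 continuous_const
    exact measurable_rVariationOn hdc (S := fun k => {x | leftEDist N 1 (Γ k x) ≤ 1}) hS r
  · have hS : IsClosed {q : ℝ × ℝ | 1 ≤ leftEDist N 1 (Γ q.1 q.2)} :=
      isClosed_le continuous_const hd1
    exact measurable_rVariationOn hdc (S := fun k => {x | 1 ≤ leftEDist N 1 (Γ k x)}) hS r
  · have hs' : rVariationOn (leftEDist N) r (Γ k) univ ≤ 1 := hs
    have hone : ∀ s t, s ≤ t → leftEDist N (Γ k s) (Γ k t) ≤ 1 := by
      intro s t hst
      have h1 := rpow_le_powVariationOn (d := leftEDist N) (r := r) (γ := Γ k) hst (mem_univ s)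
        (mem_univ t)
      rw [← rVariationOn_rpow hr0, ENNReal.rpow_le_rpow_iff hr0] at h1
      rw [leftEDist_comm]
      exact h1.trans hs'
    refine le_trans ?_ one_le_two
    rcases le_total s t with hst | hst
    · exact hone s t hst
    · rw [leftEDist_comm]
      exact hone t s hst
  · exact eq_empty_of_forall_notMem fun x hx => absurd hx (not_le.2 ((H k).2.2 hak).2)
  -- This size does not depend on `x`, so the truncated set is all of ℝ or empty.
  · have hV := measurable_rVariationOn (r := r) hdc (S := fun _ => univ) (by simp)
    have : (fun k => rVariationOn (leftEDist N) r (Γ k)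
        {_x : ℝ | rVariationOn (leftEDist N) r (Γ k) univ ≤ 1}) =
        fun k => if rVariationOn (leftEDist N) r (Γ k) univ ≤ 1 then
          rVariationOn (leftEDist N) r (Γ k) univ else 0 := by
      funext k
      split_ifs with h
      · simp [h]
      · simp [h, rVariationOn_empty]
    rw [this]
    exact Measurable.ite (measurableSet_le hV measurable_const) hV measurable_const
  · have hV := measurable_rVariationOn (r := r) hdc (S := fun _ => univ) (by simp)
    have : (fun k => rVariationOn (leftEDist N) r (Γ k)
        {_x : ℝ | 1 ≤ rVariationOn (leftEDist N) r (Γ k) univ}) =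
        fun k => if 1 ≤ rVariationOn (leftEDist N) r (Γ k) univ then
          rVariationOn (leftEDist N) r (Γ k) univ else 0 := by
      funext k
      split_ifs with h
      · simp [h]
      · simp [h, rVariationOn_empty]
    rw [this]
    exact Measurable.ite (measurableSet_le measurable_const hV) hV measurable_const

lemma lieGroup_oppositeGroup :
    @LieGroup ℝ _ E _ E _ _ 𝓘(ℝ, E) ∞ G (oppositeGroup G) _ _ := by
  haveI := isManifold_of_lieGroup (E := E) (G := G)
  have hm : ContMDiff (𝓘(ℝ, E).prod 𝓘(ℝ, E)) 𝓘(ℝ, E) ∞ fun q : G × G => q.2 * q.1 :=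
    contMDiff_snd.mul contMDiff_fst
  have hi : ContMDiff 𝓘(ℝ, E) 𝓘(ℝ, E) ∞ fun g : G => g⁻¹ := contMDiff_inv 𝓘(ℝ, E) ∞
  exact @LieGroup.mk ℝ _ E _ E _ _ 𝓘(ℝ, E) ∞ G (oppositeGroup G) _ _
    (@ContMDiffMul.mk ℝ _ E _ E _ _ 𝓘(ℝ, E) ∞ G (oppositeGroup G).toMul _ _ _ hm) hi

/-- The theorem for the right equation and the right-invariant distance. -/
theorem exists_right_truncatedBounds (N : Seminorm ℝ (GroupLieAlgebra 𝓘(ℝ, E) G))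
    (w v : GroupLieAlgebra 𝓘(ℝ, E) G) {p p' : ℝ≥0∞} (hp1 : 1 ≤ p) (hp2 : p < 2)
    (hpp' : p.HolderConjugate p') {r : ℝ} (hr : p < ENNReal.ofReal r) :
    ∃ C : ℝ≥0, ∀ f : ℝ → ℂ, MemLp f p volume → (∃! Γ : ℝ → ℝ → G, IsRightNC w v f Γ) ∧
      ∀ Γ : ℝ → ℝ → G, IsRightNC w v f Γ →
        TruncatedBounds (rightEDist N) p' r (C * eLpNorm f p volume) Γ
          (fun k x => rightEDist N 1 (Γ k x)) ∧
        TruncatedBounds (rightEDist N) p' r (C * eLpNorm f p volume) Γ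
          (fun k _ => rVariationOn (rightEDist N) r (Γ k) univ) := by
  -- The opposite group lives on the same manifold with the same identity and inverse, and its left
  -- translations are the right translations of `G`; the right-handed notions are therefore
  -- definitionally the left-handed ones.
  have hiff : ∀ f Γ, IsRightNC w v f Γ ↔ @IsLeftNC E _ _ G _ _ (oppositeGroup G) w v f Γ :=
    fun f Γ => ⟨fun ⟨h₁, h₂, h₃⟩ => @IsLeftNC.mk E _ _ G _ _ (oppositeGroup G) w v f Γ h₁ h₂ h₃,
      fun h => by
        rcases h with ⟨h₁, h₂, h₃⟩
        exact ⟨h₁, h₂, h₃⟩⟩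
  obtain ⟨C, hC⟩ := @exists_left_truncatedBounds E _ _ _ G _ _ _ (oppositeGroup G)
    lieGroup_oppositeGroup N w v p p' hp1 hp2 hpp' r hr
  refine ⟨C, fun f hf => ?_⟩
  obtain ⟨⟨Γ₀, h₀, hu⟩, hb⟩ := hC f hf
  exact ⟨⟨Γ₀, (hiff f Γ₀).2 h₀, fun Γ hΓ => hu Γ ((hiff f Γ).1 hΓ)⟩,
    fun Γ hΓ => hb Γ ((hiff f Γ).1 hΓ)⟩

end Main

end LieVariation

theorem mainTheorem7
    {E : Type*} [NormedAddCommGroup E] [NormedSpace ℝ E] [FiniteDimensional ℝ E]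
    {G : Type*} [TopologicalSpace G] [T2Space G] [ChartedSpace E G] [Group G]
    [LieGroup 𝓘(ℝ, E) ∞ G] [ConnectedSpace G]
    (N : Seminorm ℝ (GroupLieAlgebra 𝓘(ℝ, E) G)) (hN : ∀ X, N X = 0 → X = 0)
    (w v : GroupLieAlgebra 𝓘(ℝ, E) G)
    (p p' : ℝ≥0∞) (hp1 : 1 ≤ p) (hp2 : p < 2) (hpp' : p.HolderConjugate p')
    (r : ℝ) (hr : p < ENNReal.ofReal r) :
    ∃ C : ℝ≥0, ∀ f : ℝ → ℂ, MemLp f p volume →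
      ((∃! Γ : ℝ → ℝ → G, LieVariation.IsLeftNC w v f Γ) ∧
        ∀ Γ : ℝ → ℝ → G, LieVariation.IsLeftNC w v f Γ →
          LieVariation.TruncatedBounds (LieVariation.leftEDist N) p' r (C * eLpNorm f p volume) Γ
            (fun k x => LieVariation.leftEDist N 1 (Γ k x)) ∧
          LieVariation.TruncatedBounds (LieVariation.leftEDist N) p' r (C * eLpNorm f p volume) Γ
            (fun k _ => LieVariation.rVariationOn (LieVariation.leftEDist N) r (Γ k) univ)) ∧
      ((∃! Γ : ℝ → ℝ → G, LieVariation.IsRightNC w v f Γ) ∧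
        ∀ Γ : ℝ → ℝ → G, LieVariation.IsRightNC w v f Γ →
          LieVariation.TruncatedBounds (LieVariation.rightEDist N) p' r (C * eLpNorm f p volume) Γ
            (fun k x => LieVariation.rightEDist N 1 (Γ k x)) ∧
          LieVariation.TruncatedBounds (LieVariation.rightEDist N) p' r (C * eLpNorm f p volume) Γ
            (fun k _ => LieVariation.rVariationOn (LieVariation.rightEDist N) r (Γ k) univ)) := by
  obtain ⟨C₁, h₁⟩ := LieVariation.exists_left_truncatedBounds N w v hp1 hp2 hpp' hr
  obtain ⟨C₂, h₂⟩ := LieVariation.exists_right_truncatedBounds N w v hp1 hp2 hpp' hr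
  refine ⟨max C₁ C₂, fun f hf => ⟨⟨(h₁ f hf).1, fun Γ hΓ => ?_⟩, ⟨(h₂ f hf).1, fun Γ hΓ => ?_⟩⟩⟩
  · have hle : (C₁ : ℝ≥0∞) * eLpNorm f p volume ≤ (max C₁ C₂ : ℝ≥0) * eLpNorm f p volume :=
      mul_le_mul' (ENNReal.coe_le_coe.2 (le_max_left _ _)) le_rfl
    exact ⟨((h₁ f hf).2 Γ hΓ).1.mono hle, ((h₁ f hf).2 Γ hΓ).2.mono hle⟩
  · have hle : (C₂ : ℝ≥0∞) * eLpNorm f p volume ≤ (max C₁ C₂ : ℝ≥0) * eLpNorm f p volume :=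
      mul_le_mul' (ENNReal.coe_le_coe.2 (le_max_right _ _)) le_rfl
    exact ⟨((h₂ f hf).2 Γ hΓ).1.mono hle, ((h₂ f hf).2 Γ hΓ).2.mono hle⟩
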